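/- Let $N\ge 2$, let $\lambda_1,\dots,\lambda_N$ be distinct real numbers and $\Lambda=\mathrm{diag}(\lambda_1,\dots,\lambda_N)$. A point of $\mathbb R^{6N}\cong(\mathbb C^N)^3$ is written $(\Phi_1,\Phi_2,\Phi_3)$ with $\Phi_j=(\phi_{j1},\dots,\phi_{jN})^T\in\mathbb C^N$, and $\mathbb R^{6N}$ carries the symplectic form $\omega=2\sum_{j,k}d\,\mathrm{Im}\,\phi_{jk}\wedge d\,\mathrm{Re}\,\phi_{jk}$, so that the Hamiltonian system of a real function $H$ is $\mathrm i\,\dot\phi_{jk}=\partial H/\partial\bar\phi_{jk}$. Put $\langle V_1,V_2\rangle=V_1^*V_2$, $f=\langle\Phi_3,\Phi_1\rangle$, $g=\langle\Phi_3,\Phi_2\rangle$, $\Omega_j=\langle\Phi_j,\Phi_j\rangle$, $$u=\frac{2\mathrm i\langle\Phi_2,\Lambda\Phi_1\rangle+2\mathrm i\langle\Phi_2,\Phi_3\rangle\langle\Phi_3,\Phi_1\rangle}{\Omega_1-\Omega_2},$$ $$q=\frac{2\mathrm i}{\Omega_1-\Omega_2}\Big[2\mathrm i\langle\Phi_2,\Lambda^2\Phi_1\rangle+2\mathrm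 if\langle\Phi_2,\Lambda\Phi_3\rangle+2\mathrm i\bar g\langle\Phi_3,\Lambda\Phi_1\rangle+\mathrm if\bar g(2\Omega_3-\Omega_1-\Omega_2)+u(|g|^2-|f|^2)+u(\langle\Phi_2,\Lambda\Phi_2\rangle-\langle\Phi_1,\Lambda\Phi_1\rangle)\Big],$$ and define the real functions $$H^x=-\langle\Phi_1,\Lambda\Phi_1\rangle-\langle\Phi_2,\Lambda\Phi_2\rangle-|\langle\Phi_1,\Phi_3\rangle|^2-|\langle\Phi_2,\Phi_3\rangle|^2,$$ $$H^y=-\langle\Phi_1,\Lambda\Phi_1\rangle+\langle\Phi_2,\Lambda\Phi_2\rangle-|\langle\Phi_1,\Phi_3\rangle|^2+|\langle\Phi_2,\Phi_3\rangle|^2+\mathrm iu\langle\Phi_1,\Phi_2\rangle-\mathrm i\bar u\langle\Phi_2,\Phi_1\rangle,$$ $$\begin{aligned}H^t={}&2\langle\Phi_1,\Lambda^2\Phi_1\rangle-2\langle\Phi_2,\Lambda^2\Phi_2\rangle+4\,\mathrm{Re}(\langle\Phi_1,\Phi_3\rangle\langle\Phi_3,\Lambda\Phi_1\rangle)-4\,\mathrm{Re}(\langle\Phi_2,\Phi_3\rangle\langle\Phi_3,\Lambda\Phi_2\rangle)\\&+2(\Omega_3-\Omega_1)|\langle\Phi_1,\Phi_3\rangle|^2-2(\Omega_3-\Omega_2)|\langle\Phi_2,\Phi_3\rangle|^2\\&+\frac{4}{\Omega_1-\Omega_2}\big|\langle\Phi_2,\Lambda\Phi_1\rangle+\langle\Phi_2,\Phi_3\rangle\langle\Phi_3,\Phi_1\rangle\big|^2-2\,\mathrm{Re}(q\langle\Phi_1,\Phi_2\rangle).\end{aligned}$$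 Let $a^{m}_{ij}=\langle\Phi_j,\Lambda^m\Phi_i\rangle$, $D_m=\sum_{1\le i<j\le3}\sum_{l=1}^m\big(a^{l-1}_{ii}a^{m-l}_{jj}-a^{m-l}_{ij}a^{l-1}_{ji}\big)$, and define the real functions $$E^{(1)}_m=\langle\Phi_1,\Lambda^m\Phi_1\rangle+\langle\Phi_2,\Lambda^m\Phi_2\rangle-D_m,\qquad E^{(3)}_m=\langle\Phi_3,\Lambda^m\Phi_3\rangle+D_m,$$ $$E^{(2)}_m=\sum_{l=0}^m\begin{vmatrix}a^l_{11}&a^{m-l}_{12}\\a^l_{21}&a^{m-l}_{22}\end{vmatrix}-\sum_{\substack{i+j+k=m-1\\i,j,k\ge0}}\begin{vmatrix}a^i_{11}&a^j_{12}&a^k_{13}\\a^i_{21}&a^j_{22}&a^k_{23}\\a^i_{31}&a^j_{32}&a^k_{33}\end{vmatrix}.$$ Then $$S=\{(\Phi_1,\Phi_2,\Phi_3)\in\mathbb R^{6N}:\langle\Phi_1,\Phi_2\rangle=0,\ \langle\Phi_1,\Phi_1\rangle\ne\langle\Phi_2,\Phi_2\rangle\}$$ is a $(6N-2)$-dimensional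 symplectic submanifold of $(\mathbb R^{6N},\omega)$; at every point of $S$ the Hamiltonian vector fields of $H^x,H^y,H^t$ on $\mathbb R^{6N}$ are tangent to $S$, and hence coincide there with the Hamiltonian vector fields of the restrictions to $S$ for the induced symplectic form; and the Hamiltonian systems of $H^x$, $H^y$ and $H^t$ on $S$ are completely integrable in the Liouville sense. That is, the Hamiltonians and the $3N-1=\tfrac12\dim S$ functions $E^{(1)}_m,E^{(3)}_m$ $(0\le m\le N-1)$, $E^{(2)}_m$ $(0\le m\le N-2)$ are smooth on $S$; for the Poisson bracket induced on $S$ these $3N-1$ functions commute with each other and with $H^x,H^y,H^t$; their differentials along $S$ are linearly independent at every point of a dense open subset of $S$; and the Hamiltonian vector fields on $S$ of all these functions and of $H^x,H^y,H^t$ are complete. -/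

import Mathlib

open scoped ContDiff ComplexConjugate

noncomputable section

/-! ### Hamiltonian systems on regular level sets in a symplectic vector space -/

section General

variable {V W : Type*} [NormedAddCommGroup V] [NormedSpace ℝ V]
  [NormedAddCommGroup W] [NormedSpace ℝ W]

/-- The tangent space at `p` of a regular level set of `g`. -/
def levelTangent (g : V → W) (p : V) : Submodule ℝ V :=
  LinearMap.ker (fderiv ℝ g p : V →ₗ[ℝ] W)

/-- `S` is a nonempty `d`-dimensional smooth submanifold of `V`, cut out by the regular equation
`g = 0` inside an open set, and the constant form `σ` restricts to a symplectic form on `S`. -/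
structure IsSymplecticSubmanifold (σ : LinearMap.BilinForm ℝ V) (S : Set V) (g : V → W)
    (d : ℕ) : Prop where
  nonempty : S.Nonempty
  level : ∃ U : Set V, IsOpen U ∧ ContDiffOn ℝ ∞ g U ∧ S = {p | p ∈ U ∧ g p = 0}
  regular : ∀ p ∈ S, Function.Surjective (fderiv ℝ g p)
  dim : ∀ p ∈ S, Module.finrank ℝ (levelTangent g p) = d
  alternating : σ.IsAlt
  nondegenerate : ∀ p ∈ S, ∀ v ∈ levelTangent g p,
    (∀ w ∈ levelTangent g p, σ v w = 0) → v = 0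

/-- `X` is the Hamiltonian vector at `p` of `f` restricted to the level set of `g`: it is tangent to
the level set and `df(w) = σ(w, X)` for every tangent vector `w`. -/
def IsHamiltonianVector (σ : LinearMap.BilinForm ℝ V) (g : V → W) (f : V → ℝ) (p X : V) : Prop :=
  X ∈ levelTangent g p ∧ ∀ w ∈ levelTangent g p, σ w X = fderiv ℝ f p w

/-- The Hamiltonian vector field of `f` restricted to the level set of `g` (the vector exists and is
unique wherever `σ` is nondegenerate on the tangent space). -/
def hamiltonianField (σ : LinearMap.BilinForm ℝ V) (g : V → W) (f : V → ℝ) (p : V) : V :=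
  Classical.epsilon (IsHamiltonianVector σ g f p)

/-- The Poisson bracket `{f, h} = σ(X_h, X_f) = df(X_h)` for the form induced on the level set. -/
def inducedBracket (σ : LinearMap.BilinForm ℝ V) (g : V → W) (f h : V → ℝ) (p : V) : ℝ :=
  σ (hamiltonianField σ g h p) (hamiltonianField σ g f p)

/-- A vector field is complete on `S`: through every point of `S` there is an integral curve that is
defined for all times and stays in `S`. -/
def IsCompleteOn (X : V → V) (S : Set V) : Prop :=
  ∀ p ∈ S, ∃ c : ℝ → V, c 0 = p ∧ ∀ t, c t ∈ S ∧ HasDerivAt c (X (c t)) t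

/-- Liouville integrability of the Hamiltonian system of `H` on the symplectic submanifold `S`
through the integrals `F i`. -/
structure IsLiouvilleIntegrable (σ : LinearMap.BilinForm ℝ V) (S : Set V) (g : V → W)
    (H : V → ℝ) {ι : Type*} [Fintype ι] (F : ι → V → ℝ) : Prop where
  smooth_hamiltonian : ∀ p ∈ S, ContDiffAt ℝ ∞ H p
  smooth_integral : ∀ i, ∀ p ∈ S, ContDiffAt ℝ ∞ (F i) p
  /-- The number of integrals is half the dimension of `S`. -/
  half_dim : ∀ p ∈ S, 2 * Fintype.card ι = Module.finrank ℝ (levelTangent g p)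
  conserved : ∀ i, ∀ p ∈ S, inducedBracket σ g (F i) H p = 0
  involution : ∀ i j, ∀ p ∈ S, inducedBracket σ g (F i) (F j) p = 0
  /-- The differentials along `S` are independent on a dense, relatively open subset of `S`. -/
  independent : ∃ O : Set V, IsOpen O ∧ S ⊆ closure (S ∩ O) ∧ ∀ p ∈ S ∩ O,
    LinearIndependent ℝ fun i => (fderiv ℝ (F i) p).comp (levelTangent g p).subtypeL
  complete_hamiltonian : IsCompleteOn (hamiltonianField σ g H) S
  complete_integral : ∀ i, IsCompleteOn (hamiltonianField σ g (F i)) S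

end General

/-! ### The phase space -/

/-- `ℝ^{6N} = (ℂ^N)³`. The vectors `Φ₁, Φ₂, Φ₃` are `Φ 0, Φ 1, Φ 2`. -/
abbrev Phase (N : ℕ) : Type := Fin 3 → Fin N → ℂ

/-- The form `2 ∑ d Im φ ∧ d Re φ`. -/
def symp (N : ℕ) : LinearMap.BilinForm ℝ (Phase N) :=
  LinearMap.mk₂ ℝ
    (fun v w => 2 * ∑ j, ∑ k, ((v j k).im * (w j k).re - (v j k).re * (w j k).im))
    (by
      intro a b c
      simp only [Finset.mul_sum, ← Finset.sum_add_distrib, Pi.add_apply, Complex.add_re,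
        Complex.add_im]
      exact Finset.sum_congr rfl fun j _ => Finset.sum_congr rfl fun k _ => by ring)
    (by
      intro r a b
      simp only [Finset.mul_sum, Pi.smul_apply, Complex.smul_re, Complex.smul_im, smul_eq_mul]
      exact Finset.sum_congr rfl fun j _ => Finset.sum_congr rfl fun k _ => by ring)
    (by
      intro a b c
      simp only [Finset.mul_sum, ← Finset.sum_add_distrib, Pi.add_apply, Complex.add_re,
        Complex.add_im]
      exact Finset.sum_congr rfl fun j _ => Finset.sum_congr rfl fun k _ => by ring)
    (by
      intro r a b
      simp only [Finset.mul_sum, Pi.smul_apply, Complex.smul_re, Complex.smul_im, smul_eq_mul]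
      exact Finset.sum_congr rfl fun j _ => Finset.sum_congr rfl fun k _ => by ring)

/-- The right-hand side of Hamilton's equations `i φ_{jk}' = ∂H/∂φ̄_{jk}` on the whole phase space,
where `∂/∂φ̄ = (∂/∂Re φ + i ∂/∂Im φ)/2`. -/
def ambientField {N : ℕ} (H : Phase N → ℝ) (p : Phase N) : Phase N := fun j k =>
  -Complex.I * (1 / 2) *
    ((fderiv ℝ H p (Pi.single j (Pi.single k 1)) : ℝ) +
      Complex.I * (fderiv ℝ H p (Pi.single j (Pi.single k Complex.I)) : ℝ))

/-- `⟨Φ_{i+1}, Λ^m Φ_{j+1}⟩`, conjugate-linear in the first argument, `Λ = diag lam`. -/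
def ip {N : ℕ} (lam : Fin N → ℝ) (Φ : Phase N) (i j : Fin 3) (m : ℕ) : ℂ :=
  ∑ k, conj (Φ i k) * (lam k : ℂ) ^ m * Φ j k

/-- The constraint function `⟨Φ₁, Φ₂⟩`. -/
def constraint (N : ℕ) (Φ : Phase N) : ℂ := ∑ k, conj (Φ 0 k) * Φ 1 k

/-- `S = {⟨Φ₁, Φ₂⟩ = 0, ⟨Φ₁, Φ₁⟩ ≠ ⟨Φ₂, Φ₂⟩}`. -/
def constraintManifold (N : ℕ) : Set (Phase N) :=
  {Φ | constraint N Φ = 0 ∧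
    ∑ k, conj (Φ 0 k) * Φ 0 k ≠ ∑ k, conj (Φ 1 k) * Φ 1 k}

/-! ### The three Hamiltonians -/

section Hamiltonians

variable {N : ℕ} (lam : Fin N → ℝ) (Φ : Phase N)

/-- `u = (2i⟨Φ₂,ΛΦ₁⟩ + 2i⟨Φ₂,Φ₃⟩⟨Φ₃,Φ₁⟩) / (⟨Φ₁,Φ₁⟩ - ⟨Φ₂,Φ₂⟩)`. -/
def uFun : ℂ :=
  (2 * Complex.I * ip lam Φ 1 0 1 + 2 * Complex.I * ip lam Φ 1 2 0 * ip lam Φ 2 0 0) /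
    (ip lam Φ 0 0 0 - ip lam Φ 1 1 0)

/-- The function `q`, with `f = ⟨Φ₃,Φ₁⟩` and `g = ⟨Φ₃,Φ₂⟩`. -/
def qFun : ℂ :=
  let f := ip lam Φ 2 0 0
  let g := ip lam Φ 2 1 0
  let u := uFun lam Φ
  2 * Complex.I / (ip lam Φ 0 0 0 - ip lam Φ 1 1 0) *
    (2 * Complex.I * ip lam Φ 1 0 2 + 2 * Complex.I * f * ip lam Φ 1 2 1
      + 2 * Complex.I * conj g * ip lam Φ 2 0 1
      + Complex.I * f * conj g * (2 * ip lam Φ 2 2 0 - ip lam Φ 0 0 0 - ip lam Φ 1 1 0)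
      + u * ((Complex.normSq g : ℂ) - (Complex.normSq f : ℂ))
      + u * (ip lam Φ 1 1 1 - ip lam Φ 0 0 1))

/-- `H^x` (the expression is real; `re` only changes its type, also below). -/
def Hx : ℝ :=
  (-ip lam Φ 0 0 1 - ip lam Φ 1 1 1
    - (Complex.normSq (ip lam Φ 0 2 0) : ℂ) - (Complex.normSq (ip lam Φ 1 2 0) : ℂ)).re

/-- `H^y`. -/
def Hy : ℝ :=
  (-ip lam Φ 0 0 1 + ip lam Φ 1 1 1
    - (Complex.normSq (ip lam Φ 0 2 0) : ℂ) + (Complex.normSq (ip lam Φ 1 2 0) : ℂ)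
    + Complex.I * uFun lam Φ * ip lam Φ 0 1 0
    - Complex.I * conj (uFun lam Φ) * ip lam Φ 1 0 0).re

/-- `H^t`. -/
def Ht : ℝ :=
  (2 * ip lam Φ 0 0 2 - 2 * ip lam Φ 1 1 2
    + 4 * ((ip lam Φ 0 2 0 * ip lam Φ 2 0 1).re : ℂ)
    - 4 * ((ip lam Φ 1 2 0 * ip lam Φ 2 1 1).re : ℂ)
    + 2 * (ip lam Φ 2 2 0 - ip lam Φ 0 0 0) * ip lam Φ 0 2 0 * ip lam Φ 2 0 0
    - 2 * (ip lam Φ 2 2 0 - ip lam Φ 1 1 0) * ip lam Φ 1 2 0 * ip lam Φ 2 1 0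
    + 4 / (ip lam Φ 0 0 0 - ip lam Φ 1 1 0) *
        (Complex.normSq (ip lam Φ 1 0 1 + ip lam Φ 1 2 0 * ip lam Φ 2 0 0) : ℂ)
    - 2 * ((qFun lam Φ * ip lam Φ 0 1 0).re : ℂ)).re

/-! ### The integrals -/

/-- `∑_{i<j} ∑_{l=1}^m` of the `2 × 2` minors in the integrals. -/
def minorSum (m : ℕ) : ℂ :=
  ∑ i : Fin 3, ∑ j ∈ Finset.Ioi i, ∑ l ∈ Finset.Icc 1 m,
    Matrix.det !![ip lam Φ i i (l - 1), ip lam Φ j i (m - l);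
                  ip lam Φ i j (l - 1), ip lam Φ j j (m - l)]

/-- `E_m^{(1)}`. -/
def E1 (m : ℕ) : ℝ := (ip lam Φ 0 0 m + ip lam Φ 1 1 m - minorSum lam Φ m).re

/-- `E_m^{(2)}`. -/
def E2 (m : ℕ) : ℝ :=
  (∑ l ∈ Finset.range (m + 1),
      Matrix.det !![ip lam Φ 0 0 l, ip lam Φ 1 0 (m - l);
                    ip lam Φ 0 1 l, ip lam Φ 1 1 (m - l)]
    - ∑ i ∈ Finset.range m, ∑ j ∈ Finset.range m, ∑ k ∈ Finset.range m,
        if i + j + k + 1 = m then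
          Matrix.det !![ip lam Φ 0 0 i, ip lam Φ 1 0 j, ip lam Φ 2 0 k;
                        ip lam Φ 0 1 i, ip lam Φ 1 1 j, ip lam Φ 2 1 k;
                        ip lam Φ 0 2 i, ip lam Φ 1 2 j, ip lam Φ 2 2 k]
        else 0).re

/-- `E_m^{(3)}`. -/
def E3 (m : ℕ) : ℝ := (ip lam Φ 2 2 m + minorSum lam Φ m).re

end Hamiltonians

/-- The `3N - 1` integrals `E_m^{(1)}, E_m^{(3)}` (`0 ≤ m ≤ N-1`) and `E_m^{(2)}`
(`0 ≤ m ≤ N-2`). -/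
def integrals {N : ℕ} (lam : Fin N → ℝ) : Fin N ⊕ Fin (N - 1) ⊕ Fin N → Phase N → ℝ
  | Sum.inl m => fun Φ => E1 lam Φ m
  | Sum.inr (Sum.inl m) => fun Φ => E2 lam Φ m
  | Sum.inr (Sum.inr m) => fun Φ => E3 lam Φ m

end

/-! The integrals are spectral data of the Hermitian 3×3 Lax matrix L(z) = diag(1,1,0) + ∑ₖ φₖφₖ*/(z
− λₖ), where φₖ = (φ₁ₖ, φ₂ₖ, φ₃ₖ). On the whole phase space the bracket of tr L(z)ⁿ and tr L(z')ᵐ is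
a multiple of tr(L(z')ᵐ⁻¹ [L(z)ⁿ⁻¹, L(z) − L(z')]), which vanishes by cyclicity of the trace
(`inInvolution_laxTrace`). The symmetric functions of the eigenvalues of L(z) have only simple poles
in z, because minors with a repeated site vanish. Suitable combinations of them have the residues
`res1`, `res2`, `res3` at λₖ, and the integrals are moments of these: ∑ λₖᵐ `res1`, ∑ λₖᵐ⁺¹ `res2`,
∑ λₖᵐ `res3` (`E1_eq`, `E2_eq`, `E3_eq`). Hence all integrals commute.

Since diag(1,1,0) is scalar on the first two coordinates, the trace flows preserve ⟨Φ₁,Φ₂⟩ as well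
as every ⟨Φᵢ,Φᵢ⟩. The flows of the integrals are therefore bounded, hence complete, and they stay in
S. As the ambient Hamiltonian fields are tangent to S, they are the induced ones, and the induced
bracket is the ambient bracket.

`Hx` is a polynomial in the integrals; `Hy` is such a polynomial divided by the gap ⟨Φ₁,Φ₁⟩ −
⟨Φ₂,Φ₂⟩; `Ht` is a combination of such polynomials over powers of the gap, plus a term of second
order in ⟨Φ₁,Φ₂⟩ (`Hx_eq`, `Hy_eq`, `Ht_eq`). The gap is conserved, so on one of its levels each
inverse power may be replaced by its linearization. The result is a globally smooth function with
the same differential there, to which the above applies (`HasCommonModel`).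

Independence is an explicit computation at one point where most minors vanish
(`residue_relation_basePoint`). Every point of S is joined to it by an analytic path inside ⟨Φ₁,Φ₂⟩
= 0, so a suitable analytic determinant is nonzero on a dense subset of S. Independence passes to
the tangent spaces because the Hamiltonian vectors are tangent and the form is nondegenerate there.
-/

noncomputable section

/-! ### Hamiltonian vectors in phase space -/

section Bracket

variable {N : ℕ}

/-- The vector dual to a covector under the symplectic form. -/
def hamVec (ℓ : Phase N →L[ℝ] ℝ) : Phase N := fun j k =>
  -Complex.I * (1 / 2) *
    ((ℓ (Pi.single j (Pi.single k 1)) : ℝ) +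
      Complex.I * (ℓ (Pi.single j (Pi.single k Complex.I)) : ℝ))

/-- The coordinate `φ_{jk}`. -/
def coordCLM (j : Fin 3) (k : Fin N) : Phase N →L[ℝ] ℂ :=
  (ContinuousLinearMap.proj k : (Fin N → ℂ) →L[ℝ] ℂ).comp
    (ContinuousLinearMap.proj j : Phase N →L[ℝ] (Fin N → ℂ))

lemma coordCLM_apply (j : Fin 3) (k : Fin N) (v : Phase N) : coordCLM j k v = v j k := rfl

lemma ambientField_eq_hamVec (H : Phase N → ℝ) (p : Phase N) :
    ambientField H p = hamVec (fderiv ℝ H p) := rfl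

lemma symp_apply (v w : Phase N) :
    symp N v w = 2 * ∑ j, ∑ k, ((v j k).im * (w j k).re - (v j k).re * (w j k).im) := rfl

lemma phase_eq_sum_single (w : Phase N) :
    w = ∑ j, ∑ k, ((w j k).re • (Pi.single j (Pi.single k 1) : Phase N) +
      (w j k).im • (Pi.single j (Pi.single k Complex.I) : Phase N)) := by
  funext j k
  rw [Finset.sum_apply, Finset.sum_apply, Finset.sum_eq_single j]
  · rw [Finset.sum_apply, Finset.sum_apply, Finset.sum_eq_single k]
    · apply Complex.ext <;> simp
    · intro b _ hb
      simp [Pi.single_eq_of_ne' hb]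
    · simp
  · intro b _ hb
    simp [Finset.sum_apply, Pi.single_eq_of_ne' hb]
  · simp

/-- This fixes the sign convention: `ambientField` satisfies the equation required by
`IsHamiltonianVector`, on all vectors and not only on tangent ones. -/
lemma symp_hamVec (ℓ : Phase N →L[ℝ] ℝ) (w : Phase N) : symp N w (hamVec ℓ) = ℓ w := by
  conv_rhs => rw [phase_eq_sum_single w]
  simp only [map_sum, map_add, map_smul, symp_apply, hamVec, Finset.mul_sum, smul_eq_mul]
  refine Finset.sum_congr rfl fun j _ => Finset.sum_congr rfl fun k _ => ?_
  simp
  ring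

lemma symp_isAlt : (symp N).IsAlt := by
  intro v
  rw [symp_apply]
  simp [mul_comm]

lemma symp_swap (v w : Phase N) : symp N v w = -symp N w v := by
  simp only [symp_apply, Finset.mul_sum, ← Finset.sum_neg_distrib]
  exact Finset.sum_congr rfl fun j _ => Finset.sum_congr rfl fun k _ => by ring

lemma eq_zero_of_symp_eq_zero {v : Phase N} (h : ∀ w, symp N v w = 0) : v = 0 := by
  have key : ∀ ℓ : Phase N →L[ℝ] ℝ, ℓ v = 0 := fun ℓ => by rw [← symp_hamVec, h]
  funext j k
  exact Complex.ext (key (Complex.reCLM.comp (coordCLM j k)))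
    (key (Complex.imCLM.comp (coordCLM j k)))

/-- The Poisson bracket of the whole phase space. -/
def pb (F G : Phase N → ℝ) (p : Phase N) : ℝ := fderiv ℝ F p (ambientField G p)

lemma pb_swap (F G : Phase N → ℝ) (p : Phase N) : pb F G p = -pb G F p := by
  simp only [pb, ambientField_eq_hamVec]
  rw [← symp_hamVec, ← symp_hamVec, symp_swap]

/-- `F` and `G` are in involution on the whole phase space. -/
def InInvolution (F G : Phase N → ℝ) : Prop := ∀ p, pb F G p = 0

-- By the Leibniz rule the differentiable functions commuting with a fixed `H` form an algebra.
namespace InInvolution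

variable {F G H : Phase N → ℝ}

lemma symm (h : InInvolution F G) : InInvolution G F := fun p => by
  rw [pb_swap, h p, neg_zero]

lemma const (r : ℝ) : InInvolution (fun _ => r) H := fun p => by simp [pb]

lemma add (hF : Differentiable ℝ F) (hG : Differentiable ℝ G) (h₁ : InInvolution F H)
    (h₂ : InInvolution G H) : InInvolution (fun p => F p + G p) H := fun p => by
  have e₁ := h₁ p
  have e₂ := h₂ p
  simp only [pb] at *
  rw [fderiv_fun_add (hF p) (hG p)]
  simp [e₁, e₂]

lemma mul (hF : Differentiable ℝ F) (hG : Differentiable ℝ G) (h₁ : InInvolution F H)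
    (h₂ : InInvolution G H) : InInvolution (fun p => F p * G p) H := fun p => by
  have e₁ := h₁ p
  have e₂ := h₂ p
  simp only [pb] at *
  rw [fderiv_fun_mul (hF p) (hG p)]
  simp [e₁, e₂]

lemma const_mul (r : ℝ) (hF : Differentiable ℝ F) (h : InInvolution F H) :
    InInvolution (fun p => r * F p) H :=
  mul (differentiable_const r) hF (const r) h

lemma neg (hF : Differentiable ℝ F) (h : InInvolution F H) :
    InInvolution (fun p => -F p) H := by
  simpa using const_mul (-1) hF h

lemma sub (hF : Differentiable ℝ F) (hG : Differentiable ℝ G) (h₁ : InInvolution F H)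
    (h₂ : InInvolution G H) : InInvolution (fun p => F p - G p) H := by
  simpa [sub_eq_add_neg] using add hF hG.neg h₁ (neg hG h₂)

lemma pow (n : ℕ) (hF : Differentiable ℝ F) (h : InInvolution F H) :
    InInvolution (fun p => F p ^ n) H := by
  induction n with
  | zero => simpa using const 1
  | succ n ih => simpa [pow_succ] using mul (hF.pow n) hF ih h

lemma sum {ι : Type*} (s : Finset ι) {f : ι → Phase N → ℝ} (hf : ∀ i ∈ s, Differentiable ℝ (f i))
    (h : ∀ i ∈ s, InInvolution (f i) H) : InInvolution (fun p => ∑ i ∈ s, f i p) H := by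
  classical
  induction s using Finset.induction_on with
  | empty => simpa using const 0
  | insert a s ha ih =>
    simp only [Finset.sum_insert ha]
    exact add (hf a (Finset.mem_insert_self ..))
      (Differentiable.fun_sum fun i hi => hf i (Finset.mem_insert_of_mem hi))
      (h a (Finset.mem_insert_self ..))
      (ih (fun i hi => hf i (Finset.mem_insert_of_mem hi))
        fun i hi => h i (Finset.mem_insert_of_mem hi))

end InInvolution

end Bracket

/-! ### The constraint manifold -/

section Constraint

variable {N : ℕ}

/-- `∑_k w_k conj(Φ_{ik}) Φ_{jk}`, a weighted Hermitian product. -/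
def wip (w : Fin N → ℝ) (Φ : Phase N) (i j : Fin 3) : ℂ :=
  ∑ k, (w k : ℂ) * (conj (Φ i k) * Φ j k)

/-- The differential of `wip`. -/
def dwip (w : Fin N → ℝ) (Φ v : Phase N) (i j : Fin 3) : ℂ :=
  ∑ k, (w k : ℂ) * (conj (v i k) * Φ j k + conj (Φ i k) * v j k)

lemma ip_eq_wip (lam : Fin N → ℝ) (Φ : Phase N) (i j : Fin 3) (m : ℕ) :
    ip lam Φ i j m = wip (fun k => lam k ^ m) Φ i j := by
  simp only [ip, wip, Complex.ofReal_pow]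
  exact Finset.sum_congr rfl fun k _ => by ring

@[fun_prop]
lemma contDiff_conj {n : WithTop ℕ∞} : ContDiff ℝ n (fun z : ℂ => conj z) :=
  Complex.conjCLE.contDiff

@[fun_prop]
lemma contDiff_wip {n : WithTop ℕ∞} (w : Fin N → ℝ) (i j : Fin 3) :
    ContDiff ℝ n fun Φ => wip w Φ i j := by
  unfold wip
  fun_prop

@[fun_prop]
lemma differentiable_wip (w : Fin N → ℝ) (i j : Fin 3) :
    Differentiable ℝ fun Φ => wip w Φ i j :=
  (contDiff_wip (n := 1) w i j).differentiable (by simp)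

lemma fderiv_wip (w : Fin N → ℝ) (i j : Fin 3) (Φ v : Phase N) :
    fderiv ℝ (fun Φ => wip w Φ i j) Φ v = dwip w Φ v i j := by
  have hev : ∀ (j : Fin 3) (k : Fin N), HasFDerivAt (fun Φ : Phase N => Φ j k) (coordCLM j k) Φ :=
    fun j k => (coordCLM j k).hasFDerivAt
  have hc : ∀ (j : Fin 3) (k : Fin N), HasFDerivAt (fun Φ : Phase N => conj (Φ j k))
      ((Complex.conjCLE : ℂ →L[ℝ] ℂ).comp (coordCLM j k)) Φ :=
    fun j k => (Complex.conjCLE : ℂ →L[ℝ] ℂ).hasFDerivAt.comp Φ (hev j k)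
  have h := HasFDerivAt.fun_sum (u := Finset.univ) fun k _ =>
    ((hc i k).fun_mul (hev j k)).const_mul (w k : ℂ)
  unfold wip
  rw [h.fderiv]
  simp only [dwip, sum_apply, smul_apply, add_apply, smul_eq_mul]
  refine Finset.sum_congr rfl fun k _ => ?_
  simp [coordCLM_apply]
  left
  ring

lemma conj_wip (w : Fin N → ℝ) (Φ : Phase N) (i j : Fin 3) :
    conj (wip w Φ i j) = wip w Φ j i := by
  simp only [wip, map_sum, map_mul, Complex.conj_ofReal, Complex.conj_conj]
  exact Finset.sum_congr rfl fun k _ => by ring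

lemma constraint_eq_wip (Φ : Phase N) : constraint N Φ = wip (fun _ => 1) Φ 0 1 := by
  simp [constraint, wip]

lemma fderiv_constraint (Φ v : Phase N) :
    fderiv ℝ (constraint N) Φ v = dwip (fun _ => 1) Φ v 0 1 := by
  rw [← fderiv_wip]
  congr 2
  funext Φ
  exact constraint_eq_wip Φ

lemma mem_levelTangent_constraint {p v : Phase N} :
    v ∈ levelTangent (constraint N) p ↔ dwip (fun _ => 1) p v 0 1 = 0 := by
  rw [← fderiv_constraint]
  rfl

/-- The squared norm `⟨Φ_{i+1}, Φ_{i+1}⟩`. -/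
def sqNorm (i : Fin 3) (Φ : Phase N) : ℝ := ∑ k, Complex.normSq (Φ i k)

lemma wip_one_self (Φ : Phase N) (i : Fin 3) : wip (fun _ => 1) Φ i i = (sqNorm i Φ : ℂ) := by
  simp only [wip, sqNorm, Complex.ofReal_sum, Complex.normSq_eq_conj_mul_self]
  simp

/-- The difference `⟨Φ₁, Φ₁⟩ - ⟨Φ₂, Φ₂⟩`. -/
def gap (Φ : Phase N) : ℝ := sqNorm 0 Φ - sqNorm 1 Φ

lemma sqNorm_eq_re (i : Fin 3) (Φ : Phase N) : sqNorm i Φ = (wip (fun _ => 1) Φ i i).re := by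
  rw [wip_one_self, Complex.ofReal_re]

@[fun_prop]
lemma contDiff_re {n : WithTop ℕ∞} : ContDiff ℝ n (fun z : ℂ => z.re) :=
  Complex.reCLM.contDiff

@[fun_prop]
lemma contDiff_sqNorm {n : WithTop ℕ∞} (i : Fin 3) :
    ContDiff ℝ n (sqNorm i : Phase N → ℝ) := by
  have : (sqNorm i : Phase N → ℝ) = fun Φ => (wip (fun _ => 1) Φ i i).re :=
    funext (sqNorm_eq_re i)
  rw [this]
  fun_prop

@[fun_prop]
lemma contDiff_gap {n : WithTop ℕ∞} : ContDiff ℝ n (gap : Phase N → ℝ) := by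
  unfold gap
  fun_prop

lemma contDiff_constraint {n : WithTop ℕ∞} : ContDiff ℝ n (constraint N) := by
  have : constraint N = fun Φ => wip (fun _ => 1) Φ 0 1 := funext constraint_eq_wip
  rw [this]
  fun_prop

lemma mem_constraintManifold {p : Phase N} :
    p ∈ constraintManifold N ↔ constraint N p = 0 ∧ gap p ≠ 0 := by
  have h : ∀ i, ∑ k, conj (p i k) * p i k = (sqNorm i p : ℂ) := fun i => by
    rw [← wip_one_self]
    simp [wip]
  simp only [constraintManifold, Set.mem_ofPred_eq, h, gap, sub_ne_zero, ne_eq,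
    Complex.ofReal_inj]

/-- A tangent vector on which the differential of the constraint takes the value `ζ`. -/
def transversal (p : Phase N) (ζ : ℂ) : Phase N :=
  ![fun k => -(conj ζ * p 1 k) / (gap p : ℂ), fun k => ζ * p 0 k / (gap p : ℂ), 0]

lemma dwip_transversal {p : Phase N} (hp : gap p ≠ 0) (ζ : ℂ) :
    dwip (fun _ => 1) p (transversal p ζ) 0 1 = ζ := by
  have hp' : (gap p : ℂ) ≠ 0 := by exact_mod_cast hp
  have h : dwip (fun _ => 1) p (transversal p ζ) 0 1 =
      ζ / (gap p : ℂ) * (wip (fun _ => 1) p 0 0 - wip (fun _ => 1) p 1 1) := by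
    simp only [dwip, wip, transversal, Finset.mul_sum, ← Finset.sum_sub_distrib]
    refine Finset.sum_congr rfl fun k _ => ?_
    simp
    ring
  rw [h, wip_one_self, wip_one_self, ← Complex.ofReal_sub]
  change ζ / (gap p : ℂ) * (gap p : ℂ) = ζ
  field_simp

lemma symp_eq_im (v w : Phase N) :
    symp N v w = -2 * (∑ j, ∑ k, conj (v j k) * w j k).im := by
  simp only [symp_apply, Complex.im_sum, Finset.mul_sum]
  refine Finset.sum_congr rfl fun j _ => Finset.sum_congr rfl fun k _ => ?_
  simp
  ring

/-- Tangency says that the two sums `A` and `B` satisfy `A = -conj B`, which makes the Hermitian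
pairing with a transversal vector real. The transversal vectors thus lie in the symplectic
complement of the tangent space. -/
lemma symp_transversal {p v : Phase N} (hv : dwip (fun _ => 1) p v 0 1 = 0) (ζ : ℂ) :
    symp N v (transversal p ζ) = 0 := by
  rw [symp_eq_im]
  set A := ∑ k, conj (v 0 k) * p 1 k with hA
  set B := ∑ k, conj (v 1 k) * p 0 k with hB
  have h : A = -conj B := by
    rw [eq_neg_iff_add_eq_zero, ← hv, hA, hB, map_sum, ← Finset.sum_add_distrib]
    simp only [dwip]
    refine Finset.sum_congr rfl fun k _ => ?_
    simp
    ring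
  have h2 : ∑ j, ∑ k, conj (v j k) * transversal p ζ j k =
      (conj (ζ * B) + ζ * B) / (gap p : ℂ) := by
    have : conj (ζ * B) + ζ * B = -conj ζ * A + ζ * B := by rw [h, map_mul]; ring
    rw [this, Fin.sum_univ_three, hA, hB, Finset.mul_sum, Finset.mul_sum,
      ← Finset.sum_add_distrib, ← Finset.sum_add_distrib, ← Finset.sum_add_distrib,
      Finset.sum_div]
    refine Finset.sum_congr rfl fun k _ => ?_
    simp [transversal]
    ring
  rw [h2, Complex.div_ofReal_im]
  have : (conj (ζ * B) + ζ * B).im = 0 := by rw [Complex.add_im, Complex.conj_im]; ring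
  rw [this, zero_div, mul_zero]

/-- Every vector is the sum of a tangent and a transversal one, and tangent vectors pair to zero
with the latter. Nondegeneracy on the tangent space thus follows from nondegeneracy on the whole
space. -/
lemma symp_nondegenerate_on_tangent {p v : Phase N} (hp : gap p ≠ 0)
    (hv : v ∈ levelTangent (constraint N) p)
    (h : ∀ w ∈ levelTangent (constraint N) p, symp N v w = 0) : v = 0 := by
  have hv' := mem_levelTangent_constraint.1 hv
  refine eq_zero_of_symp_eq_zero fun x => ?_
  set ζ := fderiv ℝ (constraint N) p x
  have hw : x - transversal p ζ ∈ levelTangent (constraint N) p := by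
    change fderiv ℝ (constraint N) p (x - transversal p ζ) = 0
    rw [map_sub, fderiv_constraint p (transversal p ζ), dwip_transversal hp, sub_self]
  have := h _ hw
  rw [map_sub, symp_transversal hv', sub_zero] at this
  exact this

lemma fderiv_constraint_surjective {p : Phase N} (hp : gap p ≠ 0) :
    Function.Surjective (fderiv ℝ (constraint N) p) := fun ζ =>
  ⟨transversal p ζ, by rw [fderiv_constraint, dwip_transversal hp]⟩

lemma finrank_levelTangent {p : Phase N} (hp : gap p ≠ 0) :
    Module.finrank ℝ (levelTangent (constraint N) p) = 6 * N - 2 := by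
  have h := LinearMap.finrank_range_add_finrank_ker
    (fderiv ℝ (constraint N) p : Phase N →ₗ[ℝ] ℂ)
  rw [LinearMap.range_eq_top.2 (fderiv_constraint_surjective hp), finrank_top,
    Complex.finrank_real_complex] at h
  have h3 : Module.finrank ℝ (Phase N) = 6 * N := by
    simp [Phase, Module.finrank_pi_fintype, Complex.finrank_real_complex]
    ring
  rw [h3] at h
  unfold levelTangent
  omega

lemma isSymplecticSubmanifold_constraintManifold (hN : 2 ≤ N) :
    IsSymplecticSubmanifold (symp N) (constraintManifold N) (constraint N) (6 * N - 2) where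
  nonempty := by
    refine ⟨![Pi.single ⟨0, by omega⟩ 1, 0, 0], mem_constraintManifold.2 ⟨?_, ?_⟩⟩
    · simp [constraint]
    · have : ∀ k : Fin N, Complex.normSq ((Pi.single ⟨0, by omega⟩ 1 : Fin N → ℂ) k) =
          (Pi.single ⟨0, by omega⟩ 1 : Fin N → ℝ) k := fun k => by
        by_cases hk : k = ⟨0, by omega⟩
        · subst hk; simp
        · simp [Pi.single_eq_of_ne hk]
      simp [gap, sqNorm, this]
  level := by
    refine ⟨{p | gap p ≠ 0}, ?_, contDiff_constraint.contDiffOn, ?_⟩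
    · exact isOpen_ne_fun (contDiff_gap (n := 0)).continuous continuous_const
    · ext p
      rw [mem_constraintManifold]
      exact and_comm
  regular p hp := fderiv_constraint_surjective (mem_constraintManifold.1 hp).2
  dim p hp := finrank_levelTangent (mem_constraintManifold.1 hp).2
  alternating := symp_isAlt
  nondegenerate p hp _ hv h :=
    symp_nondegenerate_on_tangent (mem_constraintManifold.1 hp).2 hv h

lemma isHamiltonianVector_ambientField {H : Phase N → ℝ} {p : Phase N}
    (h : ambientField H p ∈ levelTangent (constraint N) p) :
    IsHamiltonianVector (symp N) (constraint N) H p (ambientField H p) :=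
  ⟨h, fun w _ => symp_hamVec _ w⟩

/-- Nondegeneracy makes Hamiltonian vectors unique, so the choice made in `hamiltonianField` is the
ambient vector as soon as that one is tangent. -/
lemma hamiltonianField_eq_ambientField {H : Phase N → ℝ} {p : Phase N} (hp : gap p ≠ 0)
    (h : ambientField H p ∈ levelTangent (constraint N) p) :
    hamiltonianField (symp N) (constraint N) H p = ambientField H p := by
  have h₁ := isHamiltonianVector_ambientField h
  have h₂ : IsHamiltonianVector (symp N) (constraint N) H p
      (hamiltonianField (symp N) (constraint N) H p) := Classical.epsilon_spec ⟨_, h₁⟩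
  refine sub_eq_zero.1 (symp_nondegenerate_on_tangent hp (sub_mem h₂.1 h₁.1) fun w hw => ?_)
  rw [symp_swap, map_sub, h₁.2 w hw, h₂.2 w hw, sub_self, neg_zero]

lemma inducedBracket_eq_pb {F G : Phase N → ℝ} {p : Phase N} (hp : gap p ≠ 0)
    (hF : ambientField F p ∈ levelTangent (constraint N) p)
    (hG : ambientField G p ∈ levelTangent (constraint N) p) :
    inducedBracket (symp N) (constraint N) F G p = pb F G p := by
  rw [inducedBracket, hamiltonianField_eq_ambientField hp hF,
    hamiltonianField_eq_ambientField hp hG]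
  exact symp_hamVec _ _

end Constraint

/-! ### Completeness of vector fields with a proper first integral -/

section Completeness

variable {E : Type*} [NormedAddCommGroup E] [NormedSpace ℝ E]

/-- Such a field is bounded and globally Lipschitz, so integral curves exist for a time that does
not depend on the initial point, and they can be continued indefinitely. -/
lemma exists_integralCurve_of_hasCompactSupport [CompleteSpace E] {v : E → E}
    (hv : ContDiff ℝ 1 v) (hc : HasCompactSupport v) (x : E) :
    ∃ c : ℝ → E, c 0 = x ∧ ∀ t, HasDerivAt c (v (c t)) t := by
  obtain ⟨K, hK⟩ := hv.lipschitzWith_of_hasCompactSupport hc (by simp)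
  obtain ⟨C, hC⟩ := hc.exists_bound_of_continuous hv.continuous
  have hC0 : 0 ≤ C := (norm_nonneg _).trans (hC 0)
  have hloc : ∀ x : E, ∃ γ : ℝ → E, γ 0 = x ∧
      IsMIntegralCurveOn (I := modelWithCornersSelf ℝ E) γ v (Set.Ioo (-1) 1) := fun x => by
    -- With speed at most `C`, a ball of radius `C` is not left within unit time.
    have hpl : IsPicardLindelof (fun _ => v) (tmin := -1) (tmax := 1) ⟨0, by simp⟩ x
        (Real.toNNReal C) 0 (Real.toNNReal C) K :=
      .of_time_independent (fun y _ => (hC y).trans (Real.le_coe_toNNReal C))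
        hK.lipschitzOnWith (by simp)
    obtain ⟨α, h0, hα⟩ := hpl.exists_eq_forall_mem_Icc_hasDerivWithinAt₀
    refine ⟨α, h0, fun t ht => ?_⟩
    have h := (hα t (Set.Ioo_subset_Icc_self ht)).mono Set.Ioo_subset_Icc_self
    exact h.hasFDerivWithinAt.hasMFDerivWithinAt
  obtain ⟨γ, h0, hγ⟩ := exists_isMIntegralCurve_of_isMIntegralCurveOn
    (I := modelWithCornersSelf ℝ E) (v := v)
    (contMDiff_vectorSpace_iff_contDiff.2 hv) one_pos hloc x
  refine ⟨γ, h0, fun t => ?_⟩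
  have h : HasFDerivAt γ ((1 : ℝ →L[ℝ] ℝ).smulRight (v (γ t))) t := (hγ t).hasFDerivAt
  have h' := h.hasDerivAt
  rwa [ContinuousLinearMap.smulRight_apply, one_apply_eq_self, one_smul] at h'

lemma eq_of_hasDerivAt_of_fderiv_eq_zero {ρ : E → ℝ} (hρ : Differentiable ℝ ρ) {v : E → E}
    (hcons : ∀ x, fderiv ℝ ρ x (v x) = 0) {c : ℝ → E} (hc : ∀ t, HasDerivAt c (v (c t)) t)
    (t : ℝ) : ρ (c t) = ρ (c 0) := by
  have h : ∀ t, HasDerivAt (fun t => ρ (c t)) 0 t := fun t => by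
    have := (hρ (c t)).hasFDerivAt.comp_hasDerivAt t (hc t)
    rwa [hcons] at this
  exact is_const_of_deriv_eq_zero (fun t => (h t).differentiableAt) (fun t => (h t).deriv) t 0

lemma exists_integralCurve_of_proper_firstIntegral [FiniteDimensional ℝ E] {v : E → E}
    (hv : ContDiff ℝ 1 v) {ρ : E → ℝ} (hρ : Differentiable ℝ ρ)
    (hcons : ∀ x, fderiv ℝ ρ x (v x) = 0) (hbdd : ∀ r, Bornology.IsBounded {x | ρ x ≤ r}) (x : E) :
    ∃ c : ℝ → E, c 0 = x ∧ ∀ t, HasDerivAt c (v (c t)) t := by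
  obtain ⟨R, hR0, hR⟩ := (hbdd (ρ x)).subset_closedBall_lt 0 0
  -- The cut-off field still preserves `ρ`, so its curve remains in a sublevel set of `ρ`, where the
  -- cut-off equals one.
  let χ : ContDiffBump (0 : E) := ⟨R, R + 1, hR0, by linarith⟩
  have hw : ContDiff ℝ 1 fun y => χ y • v y := χ.contDiff.smul hv
  have hcs : HasCompactSupport fun y => χ y • v y := χ.hasCompactSupport.smul_right
  obtain ⟨c, h0, hc⟩ := exists_integralCurve_of_hasCompactSupport hw hcs x
  have hconst := eq_of_hasDerivAt_of_fderiv_eq_zero hρ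
    (fun y => by rw [map_smul, hcons, smul_zero]) hc
  refine ⟨c, h0, fun t => ?_⟩
  have hmem : c t ∈ Metric.closedBall (0 : E) χ.rIn := hR (by
    change ρ (c t) ≤ ρ x
    rw [hconst t, h0])
  have := hc t
  rwa [χ.one_of_mem_closedBall hmem, one_smul] at this

end Completeness

/-! ### Flows that stay on the constraint manifold -/

section Flows

variable {N : ℕ}

lemma contDiff_ambientField {P : Phase N → ℝ} (hP : ContDiff ℝ ∞ P) :
    ContDiff ℝ 1 (ambientField P) := by
  have h : ContDiff ℝ 1 (fderiv ℝ P) := hP.fderiv_right (m := 1) (WithTop.coe_le_coe.2 le_top : ((2 : ℕ∞) : WithTop ℕ∞) ≤ ∞)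
  rw [contDiff_pi]
  intro j
  rw [contDiff_pi]
  intro k
  have h₁ : ∀ w : Phase N, ContDiff ℝ 1 fun p => ((fderiv ℝ P p w : ℝ) : ℂ) := fun w =>
    Complex.ofRealCLM.contDiff.comp (h.clm_apply contDiff_const)
  exact contDiff_const.mul ((h₁ _).add (contDiff_const.mul (h₁ _)))

/-- The squared modulus of the constraint function. -/
def constraintSq (Φ : Phase N) : ℝ := Complex.normSq (constraint N Φ)

lemma contDiff_constraintSq {n : WithTop ℕ∞} : ContDiff ℝ n (constraintSq : Phase N → ℝ) := by
  have : (constraintSq : Phase N → ℝ) = fun Φ => (conj (constraint N Φ) * constraint N Φ).re := by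
    funext Φ
    rw [constraintSq, ← Complex.normSq_eq_conj_mul_self, Complex.ofReal_re]
  rw [this]
  have h := contDiff_constraint (N := N) (n := n)
  exact contDiff_re.comp ((contDiff_conj.comp h).mul h)

lemma sqNorm_nonneg (i : Fin 3) (Φ : Phase N) : 0 ≤ sqNorm i Φ :=
  Finset.sum_nonneg fun _ _ => Complex.normSq_nonneg _

lemma isBounded_totalNorm_le (r : ℝ) :
    Bornology.IsBounded {Φ : Phase N | sqNorm 0 Φ + sqNorm 1 Φ + sqNorm 2 Φ ≤ r} := by
  refine (Metric.isBounded_closedBall (x := (0 : Phase N)) (r := √r)).subset fun Φ hΦ => ?_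
  rw [mem_closedBall_zero_iff, pi_norm_le_iff_of_nonneg (Real.sqrt_nonneg _)]
  intro j
  rw [pi_norm_le_iff_of_nonneg (Real.sqrt_nonneg _)]
  intro k
  refine Real.le_sqrt_of_sq_le ?_
  rw [← Complex.normSq_eq_norm_sq]
  have h₁ : Complex.normSq (Φ j k) ≤ sqNorm j Φ :=
    Finset.single_le_sum (f := fun k => Complex.normSq (Φ j k))
      (fun _ _ => Complex.normSq_nonneg _) (Finset.mem_univ k)
  have h₂ : sqNorm j Φ ≤ ∑ i, sqNorm i Φ :=
    Finset.single_le_sum (fun i _ => sqNorm_nonneg i Φ) (Finset.mem_univ j)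
  rw [Fin.sum_univ_three] at h₂
  exact (h₁.trans h₂).trans hΦ

/-- Functions commuting with `⟨Φ_i, Φ_i⟩` and `|⟨Φ₁, Φ₂⟩|²` have complete flows preserving the
constraint manifold and the gap. -/
lemma exists_flow_in_constraintManifold {P : Phase N → ℝ} (hP : ContDiff ℝ ∞ P)
    (hn : ∀ i, InInvolution (sqNorm i) P) (hc : InInvolution constraintSq P) {p : Phase N}
    (hp : p ∈ constraintManifold N) :
    ∃ c : ℝ → Phase N, c 0 = p ∧ ∀ t, c t ∈ constraintManifold N ∧ gap (c t) = gap p ∧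
      HasDerivAt c (ambientField P (c t)) t := by
  have hd : ∀ i, Differentiable ℝ (sqNorm i : Phase N → ℝ) := fun i =>
    (contDiff_sqNorm (n := 1) i).differentiable (by simp)
  obtain ⟨c, h0, h⟩ := exists_integralCurve_of_proper_firstIntegral (contDiff_ambientField hP)
    (((hd 0).add (hd 1)).add (hd 2))
    (InInvolution.add ((hd 0).add (hd 1)) (hd 2)
      (InInvolution.add (hd 0) (hd 1) (hn 0) (hn 1)) (hn 2))
    isBounded_totalNorm_le p
  have hgap : ∀ t, gap (c t) = gap p := fun t => by
    rw [gap, gap, eq_of_hasDerivAt_of_fderiv_eq_zero (hd 0) (hn 0) h t,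
      eq_of_hasDerivAt_of_fderiv_eq_zero (hd 1) (hn 1) h t, h0]
  have hcons : ∀ t, constraint N (c t) = 0 := fun t => by
    -- Conservation of the modulus of the constraint suffices, since its initial value is zero.
    have := eq_of_hasDerivAt_of_fderiv_eq_zero
      ((contDiff_constraintSq (n := 1)).differentiable (by simp)) hc h t
    rw [h0, constraintSq, constraintSq, (mem_constraintManifold.1 hp).1, map_zero] at this
    exact Complex.normSq_eq_zero.1 this
  exact ⟨c, h0, fun t => ⟨mem_constraintManifold.2
    ⟨hcons t, by rw [hgap t]; exact (mem_constraintManifold.1 hp).2⟩, hgap t, h t⟩⟩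

end Flows

/-! ### Involution of the spectral invariants of the Lax matrix -/

section Lax

variable {N : ℕ}

/-- `F` is differentiable at `p` with directional derivatives `D v`. -/
def HasDirDeriv (F : Phase N → ℂ) (p : Phase N) (D : Phase N → ℂ) : Prop :=
  DifferentiableAt ℝ F p ∧ ∀ v, fderiv ℝ F p v = D v

namespace HasDirDeriv

variable {F G : Phase N → ℂ} {p : Phase N} {D D' : Phase N → ℂ}

lemma const (z : ℂ) : HasDirDeriv (fun _ => z) p fun _ => 0 :=
  ⟨differentiableAt_const z, fun v => by simp⟩

lemma add (hF : HasDirDeriv F p D) (hG : HasDirDeriv G p D') :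
    HasDirDeriv (fun Φ => F Φ + G Φ) p fun v => D v + D' v :=
  ⟨hF.1.add hG.1, fun v => by
    rw [fderiv_fun_add hF.1 hG.1, add_apply, hF.2, hG.2]⟩

lemma mul (hF : HasDirDeriv F p D) (hG : HasDirDeriv G p D') :
    HasDirDeriv (fun Φ => F Φ * G Φ) p fun v => D v * G p + F p * D' v :=
  ⟨hF.1.mul hG.1, fun v => by
    rw [fderiv_fun_mul hF.1 hG.1, add_apply, smul_apply, smul_apply, hF.2, hG.2, smul_eq_mul,
      smul_eq_mul]
    ring⟩

lemma sum {ι : Type*} {s : Finset ι} {f : ι → Phase N → ℂ} {d : ι → Phase N → ℂ}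
    (h : ∀ i ∈ s, HasDirDeriv (f i) p (d i)) :
    HasDirDeriv (fun Φ => ∑ i ∈ s, f i Φ) p fun v => ∑ i ∈ s, d i v :=
  ⟨DifferentiableAt.fun_sum fun i hi => (h i hi).1, fun v => by
    rw [fderiv_fun_sum fun i hi => (h i hi).1, sum_apply]
    exact Finset.sum_congr rfl fun i hi => (h i hi).2 v⟩

lemma fderiv_re (hF : HasDirDeriv F p D) (v : Phase N) :
    fderiv ℝ (fun Φ => (F Φ).re) p v = (D v).re := by
  have h := (Complex.reCLM.hasFDerivAt (x := F p)).comp p hF.1.hasFDerivAt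
  have h' : fderiv ℝ (fun Φ => (F Φ).re) p = Complex.reCLM.comp (fderiv ℝ F p) := h.fderiv
  rw [h', ← hF.2]
  rfl

end HasDirDeriv

lemma hasDirDeriv_wip (w : Fin N → ℝ) (i j : Fin 3) (p : Phase N) :
    HasDirDeriv (fun Φ => wip w Φ i j) p fun v => dwip w p v i j :=
  ⟨differentiable_wip w i j p, fderiv_wip w i j p⟩

open Matrix

/-- The Hermitian matrix `∑_k w_k φ_k φ_k^*`, where `φ_k = (φ_{1k}, φ_{2k}, φ_{3k})`. -/
def siteGram (w : Fin N → ℝ) (Φ : Phase N) : Matrix (Fin 3) (Fin 3) ℂ :=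
  Matrix.of fun i j => wip w Φ j i

/-- The differential of `siteGram`. -/
def dsiteGram (w : Fin N → ℝ) (Φ v : Phase N) : Matrix (Fin 3) (Fin 3) ℂ :=
  Matrix.of fun i j => dwip w Φ v j i

/-- The constant part of the Lax matrix. -/
def laxConst : Matrix (Fin 3) (Fin 3) ℂ := Matrix.diagonal ![1, 1, 0]

/-- The Lax matrix with weights `w_k`. -/
def lax (w : Fin N → ℝ) (Φ : Phase N) : Matrix (Fin 3) (Fin 3) ℂ := laxConst + siteGram w Φ

/-- The power traces of the Lax matrix. -/
def laxTrace (w : Fin N → ℝ) (n : ℕ) (Φ : Phase N) : ℝ := ((lax w Φ ^ n).trace).re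

lemma isHermitian_siteGram (w : Fin N → ℝ) (Φ : Phase N) : (siteGram w Φ).IsHermitian := by
  ext i j
  simp only [conjTranspose_apply, siteGram, of_apply]
  exact conj_wip w Φ i j

lemma isHermitian_lax (w : Fin N → ℝ) (Φ : Phase N) : (lax w Φ).IsHermitian := by
  refine IsHermitian.add ?_ (isHermitian_siteGram w Φ)
  rw [laxConst, IsHermitian, diagonal_conjTranspose]
  congr 1
  funext i
  fin_cases i <;> simp

lemma trace_lax_pow (w : Fin N → ℝ) (n : ℕ) (Φ : Phase N) :
    (lax w Φ ^ n).trace = (laxTrace w n Φ : ℂ) := by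
  have h := ((isHermitian_lax w Φ).pow n).eq
  have h' := congrArg Matrix.trace h
  rw [trace_conjTranspose] at h'
  exact (Complex.conj_eq_iff_re.1 h').symm

/-- The differential of a matrix power is a noncommutative sum, but under a trace against a matrix
commuting with the Lax matrix its terms coincide. The commuting `B` is arbitrary because the
induction replaces it by `lax w p * B`. -/
lemma hasDirDeriv_lax_pow (w : Fin N → ℝ) (n : ℕ) (p : Phase N) :
    ∃ D : Phase N → Matrix (Fin 3) (Fin 3) ℂ,
      (∀ i j, HasDirDeriv (fun Φ => (lax w Φ ^ n) i j) p fun v => D v i j) ∧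
      ∀ v (B : Matrix (Fin 3) (Fin 3) ℂ), Commute B (lax w p) →
        (B * D v).trace = n * (B * lax w p ^ (n - 1) * dsiteGram w p v).trace := by
  induction n with
  | zero =>
    refine ⟨fun _ => 0, fun i j => ?_, fun v B _ => by simp⟩
    simpa using HasDirDeriv.const _
  | succ n ih =>
    obtain ⟨D, hD, hB⟩ := ih
    refine ⟨fun v => D v * lax w p + lax w p ^ n * dsiteGram w p v, fun i j => ?_, fun v B hc => ?_⟩
    · have h₁ : ∀ k, HasDirDeriv (fun Φ => lax w Φ k j) p fun v => dsiteGram w p v k j := fun k => by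
        simpa [lax, siteGram, dsiteGram] using
          (HasDirDeriv.const (laxConst k j)).add (hasDirDeriv_wip w j k p)
      have h₂ := HasDirDeriv.sum (s := Finset.univ) fun k _ => (hD i k).mul (h₁ k)
      simpa only [pow_succ, Matrix.mul_apply, Matrix.add_apply, Finset.sum_add_distrib] using h₂
    · have h₁ : (B * (D v * lax w p)).trace = (lax w p * B * D v).trace := by
        rw [← mul_assoc, trace_mul_comm, mul_assoc]
      have hc' : Commute (lax w p * B) (lax w p) := (Commute.refl _).mul_left hc
      rw [mul_add, trace_add, h₁, hB v _ hc', ← mul_assoc]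
      -- The exponent `n - 1` in the induction hypothesis is truncated at `n = 0`.
      rcases n with _ | n
      · simp
      · have : lax w p * B * lax w p ^ (n + 1 - 1) = B * lax w p ^ (n + 1) := by
          rw [← hc.eq, mul_assoc, Nat.add_sub_cancel, pow_succ']
        rw [this]
        push_cast
        ring

lemma fderiv_laxTrace (w : Fin N → ℝ) (n : ℕ) (p v : Phase N) :
    fderiv ℝ (laxTrace w n) p v = n * ((lax w p ^ (n - 1) * dsiteGram w p v).trace).re := by
  obtain ⟨D, hD, hB⟩ := hasDirDeriv_lax_pow w n p
  have h := HasDirDeriv.sum (s := Finset.univ) fun i _ => hD i i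
  have h' := h.fderiv_re v
  have h₂ := hB v 1 (Commute.one_left _)
  rw [one_mul, one_mul] at h₂
  change fderiv ℝ (laxTrace w n) p v = ((D v).trace).re at h'
  rw [h', h₂, ← Complex.ofReal_natCast, Complex.re_ofReal_mul]

@[fun_prop]
lemma contDiff_lax_apply {m : WithTop ℕ∞} (w : Fin N → ℝ) (n : ℕ) (i j : Fin 3) :
    ContDiff ℝ m fun Φ : Phase N => (lax w Φ ^ n) i j := by
  induction n generalizing i j with
  | zero => simpa using contDiff_const
  | succ n ih =>
    simp only [pow_succ, Matrix.mul_apply]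
    refine ContDiff.sum fun k _ => (ih i k).mul ?_
    exact contDiff_const.add (contDiff_wip w j k)

@[fun_prop]
lemma contDiff_laxTrace {m : WithTop ℕ∞} (w : Fin N → ℝ) (n : ℕ) :
    ContDiff ℝ m (laxTrace w n : Phase N → ℝ) :=
  contDiff_re.comp (ContDiff.sum fun i _ => contDiff_lax_apply w n i i)

/-- Here `Γ` plays the role of ∂/∂φ̄, so Hamilton's equations read φ' = −iΓ. -/
lemma hamVec_eq_of_gradient {ℓ : Phase N →L[ℝ] ℝ} {Γ : Phase N}
    (h : ∀ v, ℓ v = 2 * (∑ j, ∑ k, conj (Γ j k) * v j k).re) :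
    hamVec ℓ = fun j k => -Complex.I * Γ j k := by
  refine sub_eq_zero.1 (eq_zero_of_symp_eq_zero fun w => ?_)
  rw [symp_swap, map_sub, symp_hamVec, h, symp_apply]
  simp only [Complex.re_sum, Finset.mul_sum, ← Finset.sum_sub_distrib, ← Finset.sum_neg_distrib]
  refine Finset.sum_eq_zero fun j _ => Finset.sum_eq_zero fun k _ => ?_
  simp
  ring

lemma ambientField_laxTrace (w : Fin N → ℝ) (n : ℕ) (p : Phase N) :
    ambientField (laxTrace w n) p = fun j k =>
      -Complex.I * (n * w k * ∑ l, (lax w p ^ (n - 1)) j l * p l k) := by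
  rw [ambientField_eq_hamVec]
  refine hamVec_eq_of_gradient fun v => ?_
  rw [fderiv_laxTrace]
  set M := lax w p ^ (n - 1) with hM
  have hherm : ∀ i j, conj (M i j) = M j i := fun i j =>
    ((isHermitian_lax w p).pow (n - 1)).apply j i
  set A := ∑ k, ∑ i, ∑ j, (w k : ℂ) * (M i j * (conj (p i k) * v j k)) with hA
  have h₁ : (M * dsiteGram w p v).trace = A + conj A := by
    have e₁ : (M * dsiteGram w p v).trace = ∑ k, ∑ i, ∑ j,
        ((w k : ℂ) * (M i j * (conj (p i k) * v j k)) +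
          (w k : ℂ) * (M i j * (conj (v i k) * p j k))) := by
      rw [Finset.sum_comm]
      refine Finset.sum_congr rfl fun i _ => ?_
      rw [diag_apply, Matrix.mul_apply, Finset.sum_comm]
      refine Finset.sum_congr rfl fun j _ => ?_
      simp only [dsiteGram, of_apply, dwip, Finset.mul_sum]
      exact Finset.sum_congr rfl fun k _ => by ring
    have e₂ : conj A = ∑ k, ∑ i, ∑ j, (w k : ℂ) * (M i j * (conj (v i k) * p j k)) := by
      simp only [hA, map_sum, map_mul, Complex.conj_ofReal, Complex.conj_conj, hherm]
      refine Finset.sum_congr rfl fun k _ => ?_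
      rw [Finset.sum_comm]
      exact Finset.sum_congr rfl fun i _ => Finset.sum_congr rfl fun j _ => by ring
    rw [e₁, e₂, hA]
    simp only [Finset.sum_add_distrib]
  have h₂ : ∑ j, ∑ k, conj ((n : ℂ) * w k * ∑ l, M j l * p l k) * v j k = n * A := by
    rw [hA, Finset.mul_sum, Finset.sum_comm]
    refine Finset.sum_congr rfl fun k _ => ?_
    simp only [map_mul, map_sum, Complex.conj_ofReal, hherm, Finset.mul_sum, Finset.sum_mul,
      map_natCast]
    rw [Finset.sum_comm]
    exact Finset.sum_congr rfl fun i _ => Finset.sum_congr rfl fun j _ => by ring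
  rw [h₁, h₂, Complex.add_re, Complex.conj_re, ← Complex.ofReal_natCast, Complex.re_ofReal_mul]
  ring

/-- The site vector φₖ moves with velocity −i n wₖ Lⁿ⁻¹φₖ. As Lⁿ⁻¹ is Hermitian, each φₖφₖ* changes
by a commutator with Lⁿ⁻¹, and the two weights multiply. -/
lemma dsiteGram_ambientField_laxTrace (w w' : Fin N → ℝ) (n : ℕ) (p : Phase N) :
    dsiteGram w' p (ambientField (laxTrace w n) p) =
      (-Complex.I * n) • (lax w p ^ (n - 1) * siteGram (fun k => w k * w' k) p -
        siteGram (fun k => w k * w' k) p * lax w p ^ (n - 1)) := by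
  rw [ambientField_laxTrace]
  set M := lax w p ^ (n - 1) with hM
  have hherm : ∀ i j, conj (M i j) = M j i := fun i j =>
    ((isHermitian_lax w p).pow (n - 1)).apply j i
  ext i j
  simp only [dsiteGram, siteGram, of_apply, Matrix.smul_apply, Matrix.sub_apply, Matrix.mul_apply, wip,
    dwip, smul_eq_mul, Finset.mul_sum, Finset.sum_mul, map_mul, map_sum, hherm, map_neg,
    Complex.conj_I, map_natCast, Complex.conj_ofReal, mul_sub]
  simp only [← Finset.sum_sub_distrib]
  rw [Finset.sum_comm]
  refine Finset.sum_congr rfl fun k _ => ?_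
  simp only [mul_add, Finset.mul_sum, ← Finset.sum_add_distrib]
  refine Finset.sum_congr rfl fun l _ => ?_
  push_cast
  ring

/-- In the commutator with `M` the part `T` drops out, and what remains cancels by cyclicity of the
trace, since `M'` commutes with `T'`. -/
lemma trace_mul_commutator_eq_zero {M M' T T' : Matrix (Fin 3) (Fin 3) ℂ} (h : Commute M T)
    (h' : Commute M' T') : (M' * (M * (T - T') - (T - T') * M)).trace = 0 := by
  have e : M' * (M * (T - T') - (T - T') * M) = M' * T' * M - M' * M * T' := by
    have : M * (T - T') - (T - T') * M = T' * M - M * T' := by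
      rw [mul_sub, sub_mul, h.eq]
      abel
    rw [this, mul_sub, mul_assoc, mul_assoc]
  rw [e, trace_sub, h'.eq, mul_assoc, trace_mul_comm, mul_assoc, sub_self]

/-- The hypothesis is the resolvent identity, with `r` the difference of the spectral parameters. It
turns the Gram matrix with product weights into a multiple of L − L', because the constant parts
cancel. -/
lemma inInvolution_laxTrace {w w' : Fin N → ℝ} {r : ℝ} (hr : r ≠ 0)
    (h : ∀ k, r * (w k * w' k) = w k - w' k) (n m : ℕ) :
    InInvolution (laxTrace w' m : Phase N → ℝ) (laxTrace w n) := fun p => by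
  have hg : siteGram (fun k => w k * w' k) p = (r : ℂ)⁻¹ • (lax w p - lax w' p) := by
    rw [eq_inv_smul_iff₀ (by exact_mod_cast hr)]
    ext i j
    simp only [lax, siteGram, wip, Matrix.smul_apply, Matrix.sub_apply, Matrix.add_apply, of_apply,
      smul_eq_mul, Finset.mul_sum, add_sub_add_left_eq_sub, ← Finset.sum_sub_distrib]
    refine Finset.sum_congr rfl fun k _ => ?_
    rw [← sub_mul, ← mul_assoc]
    congr 1
    exact_mod_cast h k
  rw [pb, fderiv_laxTrace, dsiteGram_ambientField_laxTrace, hg]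
  have := trace_mul_commutator_eq_zero ((Commute.refl (lax w p)).pow_left (n - 1))
    ((Commute.refl (lax w' p)).pow_left (m - 1))
  rw [Matrix.mul_smul (lax w p ^ (n - 1)), Matrix.smul_mul, ← smul_sub, smul_smul, Matrix.mul_smul,
    trace_smul, this]
  simp

/-- With unit weights the derivative is a commutator of Lⁿ⁻¹ with L minus its constant part. Only
the diagonal constant part contributes, and its commutator has no entry between equal diagonal
values. -/
lemma dwip_ambientField_laxTrace (w : Fin N → ℝ) (n : ℕ) (p : Phase N) {i j : Fin 3}
    (hij : (![1, 1, 0] : Fin 3 → ℂ) i = (![1, 1, 0] : Fin 3 → ℂ) j) :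
    dwip (fun _ => 1) p (ambientField (laxTrace w n) p) i j = 0 := by
  have h := congrFun₂ (dsiteGram_ambientField_laxTrace w (fun _ => 1) n p) j i
  simp only [dsiteGram, of_apply, mul_one] at h
  have hg : siteGram (fun k => w k) p = lax w p - laxConst := by simp [lax]
  have hc : lax w p ^ (n - 1) * lax w p = lax w p * lax w p ^ (n - 1) :=
    ((Commute.refl (lax w p)).pow_left (n - 1)).eq
  rw [h, hg, mul_sub, sub_mul, hc, sub_sub_sub_cancel_left, laxConst]
  simp only [Matrix.smul_apply, Matrix.sub_apply, diagonal_mul, mul_diagonal, hij]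
  simp [mul_comm]

lemma fderiv_re_wip (w : Fin N → ℝ) (i j : Fin 3) (p v : Phase N) :
    fderiv ℝ (fun Φ => (wip w Φ i j).re) p v = (dwip w p v i j).re :=
  (hasDirDeriv_wip w i j p).fderiv_re v

lemma fderiv_im_wip (w : Fin N → ℝ) (i j : Fin 3) (p v : Phase N) :
    fderiv ℝ (fun Φ => (wip w Φ i j).im) p v = (dwip w p v i j).im := by
  have h := (Complex.imCLM.hasFDerivAt (x := wip w p i j)).comp p
    (differentiable_wip w i j p).hasFDerivAt
  have h' : fderiv ℝ (fun Φ => (wip w Φ i j).im) p =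
    Complex.imCLM.comp (fderiv ℝ (fun Φ => wip w Φ i j) p) := h.fderiv
  rw [h', ← fderiv_wip]
  rfl

end Lax

/-! ### Residues of the generating functions -/

section Residues

variable {N : ℕ}

open Matrix

/-- The squared modulus of a `2 × 2` minor of two sites. -/
def wedgeSq (i j : Fin 3) (k l : Fin N) (Φ : Phase N) : ℝ :=
  Complex.normSq (Φ i k * Φ j l - Φ j k * Φ i l)

/-- The determinant of three sites. -/
def siteDet (k l m : Fin N) (Φ : Phase N) : ℂ :=
  Φ 0 k * (Φ 1 l * Φ 2 m - Φ 2 l * Φ 1 m) - Φ 1 k * (Φ 0 l * Φ 2 m - Φ 2 l * Φ 0 m)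
    + Φ 2 k * (Φ 0 l * Φ 1 m - Φ 1 l * Φ 0 m)

/-- The residue at `λ_k` of a `2 × 2` minor of the Lax matrix. -/
def pairRes (lam : Fin N → ℝ) (i j : Fin 3) (k : Fin N) (Φ : Phase N) : ℝ :=
  ∑ l, wedgeSq i j k l Φ / (lam k - lam l)

/-- The residue at `λ_k` of the determinant of the resolvent part of the Lax matrix. -/
def tripleRes (lam : Fin N → ℝ) (k : Fin N) (Φ : Phase N) : ℝ :=
  1 / 2 * ∑ l, ∑ m, Complex.normSq (siteDet k l m Φ) / ((lam k - lam l) * (lam k - lam m))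

/-- The sum of the residues of the three principal minors. -/
def minorRes (lam : Fin N → ℝ) (k : Fin N) (Φ : Phase N) : ℝ :=
  pairRes lam 0 1 k Φ + pairRes lam 0 2 k Φ + pairRes lam 1 2 k Φ

/-- The residues generating `E1`. -/
def res1 (lam : Fin N → ℝ) (k : Fin N) (Φ : Phase N) : ℝ :=
  Complex.normSq (Φ 0 k) + Complex.normSq (Φ 1 k) - minorRes lam k Φ

/-- The residues generating `E2`. -/
def res2 (lam : Fin N → ℝ) (k : Fin N) (Φ : Phase N) : ℝ :=
  pairRes lam 0 1 k Φ - tripleRes lam k Φ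

/-- The residues generating `E3`. -/
def res3 (lam : Fin N → ℝ) (k : Fin N) (Φ : Phase N) : ℝ :=
  Complex.normSq (Φ 2 k) + minorRes lam k Φ

lemma wip_self (w : Fin N → ℝ) (Φ : Phase N) (i : Fin 3) :
    wip w Φ i i = ((∑ k, w k * Complex.normSq (Φ i k) : ℝ) : ℂ) := by
  simp only [wip, Complex.ofReal_sum, Complex.ofReal_mul, Complex.normSq_eq_conj_mul_self]

lemma wip_minor (a b : Fin N → ℝ) (Φ : Phase N) (i j : Fin 3) :
    wip a Φ i i * wip b Φ j j - wip b Φ j i * wip a Φ i j =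
      ∑ k, ∑ l, ((a k * b l : ℝ) : ℂ) *
        (conj (Φ i k) * conj (Φ j l) * (Φ i k * Φ j l - Φ j k * Φ i l)) := by
  rw [mul_comm (wip b Φ j i)]
  simp only [wip, Finset.sum_mul_sum, ← Finset.sum_sub_distrib]
  refine Finset.sum_congr rfl fun k _ => Finset.sum_congr rfl fun l _ => ?_
  push_cast
  ring

/-- Off the diagonal `h` is the divided difference of `x`, hence symmetric. Symmetrizing the summand
produces the squared modulus of the minor, and splitting the divided difference collects the
residues. Different `x` serve the moments (powers of λ), the generating functions (resolvent
weights) and the vanishing sum of `res2` (a constant). -/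
lemma sum_mul_pairRes {lam : Fin N → ℝ} (hlam : Function.Injective lam) {x : Fin N → ℝ}
    {h : Fin N → Fin N → ℝ} (hx : ∀ k l, h k l * (lam k - lam l) = x k - x l) (Φ : Phase N)
    (i j : Fin 3) :
    ∑ k, ∑ l, (h k l : ℂ) *
        (conj (Φ i k) * conj (Φ j l) * (Φ i k * Φ j l - Φ j k * Φ i l)) =
      ((∑ k, x k * pairRes lam i j k Φ : ℝ) : ℂ) := by
  set P : Fin N → Fin N → ℂ := fun k l =>
    conj (Φ i k) * conj (Φ j l) * (Φ i k * Φ j l - Φ j k * Φ i l) with hP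
  set d : Fin N → Fin N → ℝ := fun k l => (x k - x l) * (lam k - lam l)⁻¹ with hd
  have hneg : ∀ k l, (lam l - lam k)⁻¹ = -(lam k - lam l)⁻¹ := fun k l => by
    rw [← neg_sub, inv_neg]
  have hPN : ∀ k l, P k l + P l k = (wedgeSq i j k l Φ : ℂ) := fun k l => by
    rw [wedgeSq, Complex.normSq_eq_conj_mul_self]
    simp only [hP, map_sub, map_mul]
    ring
  have h₁ : ∑ k, ∑ l, (h k l : ℂ) * P k l = ∑ k, ∑ l, (d k l : ℂ) * P k l := by
    refine Finset.sum_congr rfl fun k _ => Finset.sum_congr rfl fun l _ => ?_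
    -- On the diagonal `h` is unconstrained, but the minor of a repeated site is zero.
    by_cases hkl : k = l
    · subst hkl
      simp [hP, mul_comm]
    · have : lam k - lam l ≠ 0 := sub_ne_zero.2 fun e => hkl (hlam e)
      rw [hd]
      simp only
      rw [← hx k l, mul_inv_cancel_right₀ this]
  have h₂ : ∑ k, ∑ l, (d k l : ℂ) * P k l = ∑ k, ∑ l, (d k l : ℂ) * P l k := by
    rw [Finset.sum_comm]
    refine Finset.sum_congr rfl fun k _ => Finset.sum_congr rfl fun l _ => ?_
    have : d l k = d k l := by simp only [hd, hneg k l]; ring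
    rw [this]
  have h₃ : ∑ k, ∑ l, (d k l : ℂ) * P k l =
      1 / 2 * ((∑ k, ∑ l, d k l * wedgeSq i j k l Φ : ℝ) : ℂ) := by
    have : ∑ k, ∑ l, (d k l : ℂ) * P k l + ∑ k, ∑ l, (d k l : ℂ) * P k l =
        ((∑ k, ∑ l, d k l * wedgeSq i j k l Φ : ℝ) : ℂ) := by
      conv_lhs => rw [h₂]; arg 1; rw [← h₂]
      push_cast
      simp only [← Finset.sum_add_distrib, ← mul_add, hPN]
    rw [← this]
    ring
  have h₄ : ∑ k, ∑ l, d k l * wedgeSq i j k l Φ = 2 * ∑ k, x k * pairRes lam i j k Φ := by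
    have e₁ : ∑ k, x k * pairRes lam i j k Φ =
        ∑ k, ∑ l, x k * (wedgeSq i j k l Φ * (lam k - lam l)⁻¹) := by
      simp only [pairRes, Finset.mul_sum, div_eq_mul_inv]
    have e₂ : ∑ k, ∑ l, x k * (wedgeSq i j k l Φ * (lam k - lam l)⁻¹) =
        ∑ k, ∑ l, -(x l * (wedgeSq i j k l Φ * (lam k - lam l)⁻¹)) := by
      rw [Finset.sum_comm]
      refine Finset.sum_congr rfl fun k _ => Finset.sum_congr rfl fun l _ => ?_
      have : wedgeSq i j l k Φ = wedgeSq i j k l Φ := by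
        have := hPN k l
        rw [add_comm, hPN l k] at this
        exact_mod_cast this
      rw [this, hneg k l]
      ring
    rw [e₁, two_mul]
    nth_rewrite 2 [e₂]
    simp only [← Finset.sum_add_distrib, hd]
    exact Finset.sum_congr rfl fun k _ => Finset.sum_congr rfl fun l _ => by ring
  rw [h₁, h₃, h₄]
  push_cast
  ring

lemma sum_mul_sum_mul_sum {ι R : Type*} [Fintype ι] [CommRing R] (f g h : ι → R) :
    (∑ k, f k) * (∑ l, g l) * (∑ m, h m) = ∑ k, ∑ l, ∑ m, f k * g l * h m := by
  rw [Finset.sum_mul_sum, Finset.sum_mul]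
  refine Finset.sum_congr rfl fun k _ => ?_
  rw [Finset.sum_mul]
  exact Finset.sum_congr rfl fun l _ => Finset.mul_sum ..

lemma det_wip (a b c : Fin N → ℝ) (Φ : Phase N) :
    Matrix.det !![wip a Φ 0 0, wip b Φ 1 0, wip c Φ 2 0;
                  wip a Φ 0 1, wip b Φ 1 1, wip c Φ 2 1;
                  wip a Φ 0 2, wip b Φ 1 2, wip c Φ 2 2] =
      ∑ k, ∑ l, ∑ m, ((a k * b l * c m : ℝ) : ℂ) *
        (conj (Φ 0 k) * conj (Φ 1 l) * conj (Φ 2 m) * siteDet k l m Φ) := by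
  have e : ∀ i j r : Fin 3, wip a Φ 0 i * wip b Φ 1 j * wip c Φ 2 r = ∑ k, ∑ l, ∑ m,
      ((a k : ℂ) * (conj (Φ 0 k) * Φ i k)) * ((b l : ℂ) * (conj (Φ 1 l) * Φ j l)) *
        ((c m : ℂ) * (conj (Φ 2 m) * Φ r m)) := fun i j r => sum_mul_sum_mul_sum _ _ _
  have hdet : Matrix.det !![wip a Φ 0 0, wip b Φ 1 0, wip c Φ 2 0;
                  wip a Φ 0 1, wip b Φ 1 1, wip c Φ 2 1;
                  wip a Φ 0 2, wip b Φ 1 2, wip c Φ 2 2] =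
      wip a Φ 0 0 * wip b Φ 1 1 * wip c Φ 2 2 - wip a Φ 0 0 * wip b Φ 1 2 * wip c Φ 2 1
      - (wip a Φ 0 1 * wip b Φ 1 0 * wip c Φ 2 2 - wip a Φ 0 1 * wip b Φ 1 2 * wip c Φ 2 0)
      + (wip a Φ 0 2 * wip b Φ 1 0 * wip c Φ 2 1 - wip a Φ 0 2 * wip b Φ 1 1 * wip c Φ 2 0) := by
    rw [det_fin_three]
    simp
    ring
  rw [hdet]
  simp only [e, ← Finset.sum_sub_distrib, ← Finset.sum_add_distrib]
  refine Finset.sum_congr rfl fun k _ => Finset.sum_congr rfl fun l _ =>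
    Finset.sum_congr rfl fun m _ => ?_
  simp only [siteDet]
  push_cast
  ring

lemma siteDet_eq_zero_left (k m : Fin N) (Φ : Phase N) : siteDet k k m Φ = 0 := by
  simp only [siteDet]; ring

lemma siteDet_eq_zero_right (k l : Fin N) (Φ : Phase N) : siteDet k l l Φ = 0 := by
  simp only [siteDet]; ring

lemma siteDet_eq_zero_outer (k l : Fin N) (Φ : Phase N) : siteDet k l k Φ = 0 := by
  simp only [siteDet]; ring

section SumPerm

variable {ι M : Type*} [Fintype ι] [AddCommMonoid M]

lemma sum_swap_left (f : ι → ι → ι → M) :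
    ∑ k, ∑ l, ∑ m, f l k m = ∑ k, ∑ l, ∑ m, f k l m := Finset.sum_comm

lemma sum_swap_right (f : ι → ι → ι → M) :
    ∑ k, ∑ l, ∑ m, f k m l = ∑ k, ∑ l, ∑ m, f k l m :=
  Finset.sum_congr rfl fun _ _ => Finset.sum_comm

end SumPerm

/-- The analogue for three sites: `h` is the second divided difference of `x` wherever the sites are
distinct, and the six permutations of the summand add up to the squared modulus of the determinant.
The factor 1/2 in `tripleRes` accounts for the two orders of the other two sites. -/
lemma sum_mul_tripleRes {lam : Fin N → ℝ} (hlam : Function.Injective lam) {x : Fin N → ℝ}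
    {h : Fin N → Fin N → Fin N → ℝ}
    (hx : ∀ k l m, h k l m * ((lam k - lam l) * (lam k - lam m) * (lam l - lam m)) =
      x k * (lam l - lam m) - x l * (lam k - lam m) + x m * (lam k - lam l)) (Φ : Phase N) :
    ∑ k, ∑ l, ∑ m, (h k l m : ℂ) *
        (conj (Φ 0 k) * conj (Φ 1 l) * conj (Φ 2 m) * siteDet k l m Φ) =
      ((∑ k, x k * tripleRes lam k Φ : ℝ) : ℂ) := by
  set P : Fin N → Fin N → Fin N → ℂ := fun k l m =>
    conj (Φ 0 k) * conj (Φ 1 l) * conj (Φ 2 m) * siteDet k l m Φ with hP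
  set D : Fin N → Fin N → Fin N → ℝ := fun k l m => Complex.normSq (siteDet k l m Φ) with hD
  set y : Fin N → Fin N → Fin N → ℝ := fun k l m =>
    x k * ((lam k - lam l)⁻¹ * (lam k - lam m)⁻¹) with hy
  set d : Fin N → Fin N → Fin N → ℝ := fun k l m => y k l m + y l k m + y m k l with hd
  have hyr : ∀ k l m, y k m l = y k l m := fun k l m => by simp only [hy]; ring
  have hD₁ : ∀ k l m, D l k m = D k l m := fun k l m => by
    have : siteDet l k m Φ = -siteDet k l m Φ := by simp only [siteDet]; ring
    simp only [hD, this, Complex.normSq_neg]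
  have hD₂ : ∀ k l m, D k m l = D k l m := fun k l m => by
    have : siteDet k m l Φ = -siteDet k l m Φ := by simp only [siteDet]; ring
    simp only [hD, this, Complex.normSq_neg]
  have hd₁ : ∀ k l m, d l k m = d k l m := fun k l m => by
    simp only [hd]; rw [hyr m k l]; ring
  have hd₂ : ∀ k l m, d k m l = d k l m := fun k l m => by
    simp only [hd]; rw [hyr k l m]; ring
  have hPD : ∀ k l m, P k l m + P l k m + P k m l + P l m k + P m k l + P m l k =
      (D k l m : ℂ) := fun k l m => by
    simp only [hD, hP, Complex.normSq_eq_conj_mul_self, siteDet, map_sub, map_mul, map_add]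
    ring
  have h₁ : ∑ k, ∑ l, ∑ m, (h k l m : ℂ) * P k l m = ∑ k, ∑ l, ∑ m, (d k l m : ℂ) * P k l m := by
    refine Finset.sum_congr rfl fun k _ => Finset.sum_congr rfl fun l _ =>
      Finset.sum_congr rfl fun m _ => ?_
    by_cases hkl : k = l
    · subst hkl; simp [hP, siteDet_eq_zero_left]
    by_cases hkm : k = m
    · subst hkm; simp [hP, siteDet_eq_zero_outer]
    by_cases hlm : l = m
    · subst hlm; simp [hP, siteDet_eq_zero_right]
    have a₁ : lam k - lam l ≠ 0 := sub_ne_zero.2 fun e => hkl (hlam e)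
    have a₂ : lam k - lam m ≠ 0 := sub_ne_zero.2 fun e => hkm (hlam e)
    have a₃ : lam l - lam m ≠ 0 := sub_ne_zero.2 fun e => hlm (hlam e)
    have a₁' : lam l - lam k = -(lam k - lam l) := by ring
    have a₂' : lam m - lam k = -(lam k - lam m) := by ring
    have a₃' : lam m - lam l = -(lam l - lam m) := by ring
    have : h k l m = d k l m := by
      refine mul_right_cancel₀ (mul_ne_zero (mul_ne_zero a₁ a₂) a₃) ?_
      rw [hx]
      simp only [hd, hy, a₁', a₂', a₃', inv_neg]
      field_simp
      ring
    rw [this]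
  have h₃ : 6 * ∑ k, ∑ l, ∑ m, (d k l m : ℂ) * P k l m =
      ((∑ k, ∑ l, ∑ m, d k l m * D k l m : ℝ) : ℂ) := by
    set F : Fin N → Fin N → Fin N → ℂ := fun k l m => (d k l m : ℂ) * P k l m with hF
    have s₁ := sum_swap_left F
    have s₂ := sum_swap_right F
    have s₃ := (sum_swap_right fun k l m => F l k m).trans s₁
    have s₄ := (sum_swap_left fun k l m => F k m l).trans s₂
    have s₅ := (sum_swap_left fun k l m => F m k l).trans s₃
    calc 6 * ∑ k, ∑ l, ∑ m, F k l m
        = ∑ k, ∑ l, ∑ m, F k l m + ∑ k, ∑ l, ∑ m, F l k m + ∑ k, ∑ l, ∑ m, F k m l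
          + ∑ k, ∑ l, ∑ m, F l m k + ∑ k, ∑ l, ∑ m, F m k l + ∑ k, ∑ l, ∑ m, F m l k := by
          rw [s₁, s₂, s₃, s₄, s₅]; ring
      _ = _ := by
          push_cast
          simp only [← Finset.sum_add_distrib]
          refine Finset.sum_congr rfl fun k _ => Finset.sum_congr rfl fun l _ =>
            Finset.sum_congr rfl fun m _ => ?_
          rw [← hPD]
          simp only [hF]
          rw [hd₂ m k l, hd₁ k m l, hd₂ l k m, hd₁ k l m, hd₂ k l m]
          ring
  have h₄ : ∑ k, ∑ l, ∑ m, d k l m * D k l m = 6 * ∑ k, x k * tripleRes lam k Φ := by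
    set G : Fin N → Fin N → Fin N → ℝ := fun k l m => y k l m * D k l m with hG
    have e₁ : ∑ k, x k * tripleRes lam k Φ = 1 / 2 * ∑ k, ∑ l, ∑ m, G k l m := by
      simp only [tripleRes, Finset.mul_sum, hG, hy, hD]
      refine Finset.sum_congr rfl fun k _ => Finset.sum_congr rfl fun l _ =>
        Finset.sum_congr rfl fun m _ => ?_
      rw [div_eq_mul_inv (Complex.normSq _), mul_inv]
      ring
    have s₁ := sum_swap_left G
    have s₃ := (sum_swap_right fun k l m => G l k m).trans s₁
    have s₅ := (sum_swap_left fun k l m => G m k l).trans s₃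
    have s₆ : ∑ k, ∑ l, ∑ m, G m k l = ∑ k, ∑ l, ∑ m, G k l m := by
      rw [← sum_swap_left (fun k l m => G m k l)]
      exact s₅
    calc ∑ k, ∑ l, ∑ m, d k l m * D k l m
        = ∑ k, ∑ l, ∑ m, G k l m + ∑ k, ∑ l, ∑ m, G l k m + ∑ k, ∑ l, ∑ m, G m k l := by
          simp only [← Finset.sum_add_distrib]
          refine Finset.sum_congr rfl fun k _ => Finset.sum_congr rfl fun l _ =>
            Finset.sum_congr rfl fun m _ => ?_
          simp only [hG]
          rw [hD₁ k m l, hD₂ k l m, hD₁ k l m]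
          simp only [hd]
          ring
      _ = _ := by rw [s₁, s₆, e₁]; ring
  rw [h₁]
  have h₅ : (6 : ℂ) ≠ 0 := by norm_num
  refine mul_left_cancel₀ h₅ ?_
  rw [h₃, h₄]
  push_cast
  ring

end Residues

section Expansion

variable {N : ℕ}

open Matrix

/-! ### The integrals in terms of the residues -/

lemma minorSum_eq {lam : Fin N → ℝ} (hlam : Function.Injective lam) (Φ : Phase N) (m : ℕ) :
    minorSum lam Φ m = ((∑ k, lam k ^ m * minorRes lam k Φ : ℝ) : ℂ) := by
  have key : ∀ i j : Fin 3, ∑ l ∈ Finset.Icc 1 m,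
      Matrix.det !![ip lam Φ i i (l - 1), ip lam Φ j i (m - l);
                    ip lam Φ i j (l - 1), ip lam Φ j j (m - l)] =
      ((∑ k, lam k ^ m * pairRes lam i j k Φ : ℝ) : ℂ) := fun i j => by
    have hgeom : ∀ k l, (∑ n ∈ Finset.Icc 1 m, lam k ^ (n - 1) * lam l ^ (m - n)) *
        (lam k - lam l) = lam k ^ m - lam l ^ m := fun k l => by
      rw [← geom_sum₂_mul]
      congr 1
      refine Finset.sum_nbij' (fun n => n - 1) (fun n => n + 1) ?_ ?_ ?_ ?_ ?_ <;>
        simp only [Finset.mem_Icc, Finset.mem_range]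
      · intro n hn; omega
      · intro n hn; omega
      · intro n hn; omega
      · intro n hn; omega
      · intro n hn
        congr 2
        omega
    rw [← sum_mul_pairRes hlam hgeom Φ i j]
    simp only [det_fin_two_of, ip_eq_wip, wip_minor]
    rw [Finset.sum_comm]
    refine Finset.sum_congr rfl fun k _ => ?_
    rw [Finset.sum_comm]
    refine Finset.sum_congr rfl fun l _ => ?_
    rw [← Finset.sum_mul, ← Complex.ofReal_sum]
  have h0 : Finset.Ioi (0 : Fin 3) = {1, 2} := by decide
  have h1 : Finset.Ioi (1 : Fin 3) = {2} := by decide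
  have h2 : Finset.Ioi (2 : Fin 3) = ∅ := by decide
  rw [minorSum, Fin.sum_univ_three, h0, h1, h2, Finset.sum_pair (by decide),
    Finset.sum_singleton, Finset.sum_empty, key, key, key, ← Complex.ofReal_add,
    ← Complex.ofReal_add, add_zero]
  congr 1
  simp only [minorRes, mul_add, Finset.sum_add_distrib]

lemma E1_eq {lam : Fin N → ℝ} (hlam : Function.Injective lam) (Φ : Phase N) (m : ℕ) :
    E1 lam Φ m = ∑ k, lam k ^ m * res1 lam k Φ := by
  rw [E1, minorSum_eq hlam, ip_eq_wip, ip_eq_wip, wip_self, wip_self, ← Complex.ofReal_add,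
    ← Complex.ofReal_sub, Complex.ofReal_re]
  simp only [res1, mul_add, mul_sub, Finset.sum_add_distrib, Finset.sum_sub_distrib]

lemma E3_eq {lam : Fin N → ℝ} (hlam : Function.Injective lam) (Φ : Phase N) (m : ℕ) :
    E3 lam Φ m = ∑ k, lam k ^ m * res3 lam k Φ := by
  rw [E3, minorSum_eq hlam, ip_eq_wip, wip_self, ← Complex.ofReal_add, Complex.ofReal_re]
  simp only [res3, mul_add, Finset.sum_add_distrib]

/-- The complete homogeneous symmetric polynomial of degree `m - 1` in three variables. -/
def homSum (x y z : ℝ) (m : ℕ) : ℝ :=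
  ∑ i ∈ Finset.range m, ∑ j ∈ Finset.range m, ∑ k ∈ Finset.range m,
    if i + j + k + 1 = m then x ^ i * y ^ j * z ^ k else 0

/-- The complete homogeneous polynomial of degree `m - 1` is the second divided difference of the
power `m + 1`. Two nested geometric sums give this. -/
lemma homSum_mul (x y z : ℝ) (m : ℕ) :
    homSum x y z m * ((x - y) * (x - z) * (y - z)) =
      x ^ (m + 1) * (y - z) - y ^ (m + 1) * (x - z) + z ^ (m + 1) * (x - y) := by
  have h₁ : ∀ i ∈ Finset.range m, (∑ j ∈ Finset.range m, ∑ k ∈ Finset.range m,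
      if i + j + k + 1 = m then x ^ i * y ^ j * z ^ k else 0) * (y - z) =
      x ^ i * (y ^ (m - 1 - i) * y - z ^ (m - 1 - i) * z) := by
    intro i hi
    have hi' := Finset.mem_range.1 hi
    have e : ∑ j ∈ Finset.range m, ∑ k ∈ Finset.range m,
        (if i + j + k + 1 = m then x ^ i * y ^ j * z ^ k else 0) =
        x ^ i * ∑ j ∈ Finset.range (m - i), y ^ j * z ^ (m - i - 1 - j) := by
      rw [Finset.mul_sum, ← Finset.sum_subset (Finset.range_mono (Nat.sub_le m i))]
      · refine Finset.sum_congr rfl fun j hj => ?_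
        have hj' := Finset.mem_range.1 hj
        rw [Finset.sum_eq_single (m - i - 1 - j)]
        · rw [if_pos (by omega)]
          ring
        · intro k _ hk
          rw [if_neg (by omega)]
        · intro hk
          exact absurd (Finset.mem_range.2 (by omega)) hk
      · intro j _ hj
        refine Finset.sum_eq_zero fun k _ => ?_
        rw [Finset.mem_range] at hj
        rw [if_neg (by omega)]
    rw [e, mul_assoc, geom_sum₂_mul, ← pow_succ, ← pow_succ]
    have : m - 1 - i + 1 = m - i := by omega
    rw [this]
  have h₂ : homSum x y z m * (y - z) = (∑ i ∈ Finset.range m, x ^ i * y ^ (m - 1 - i)) * y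
      - (∑ i ∈ Finset.range m, x ^ i * z ^ (m - 1 - i)) * z := by
    rw [homSum, Finset.sum_mul, Finset.sum_congr rfl h₁, Finset.sum_mul, Finset.sum_mul,
      ← Finset.sum_sub_distrib]
    exact Finset.sum_congr rfl fun i _ => by ring
  have h₃ := geom_sum₂_mul x y m
  have h₄ := geom_sum₂_mul x z m
  linear_combination (x - y) * (x - z) * h₂ + (x - z) * y * h₃ - (x - y) * z * h₄

/-- The exponent `m + 1` fits both parts: the sum of degree `m` over pairs is its first divided
difference, and the sum of degree `m - 1` over triples is its second. -/
lemma E2_complex {lam : Fin N → ℝ} (hlam : Function.Injective lam) (Φ : Phase N) (m : ℕ) :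
    ∑ l ∈ Finset.range (m + 1),
      Matrix.det !![ip lam Φ 0 0 l, ip lam Φ 1 0 (m - l);
                    ip lam Φ 0 1 l, ip lam Φ 1 1 (m - l)]
    - ∑ i ∈ Finset.range m, ∑ j ∈ Finset.range m, ∑ k ∈ Finset.range m,
        (if i + j + k + 1 = m then
          Matrix.det !![ip lam Φ 0 0 i, ip lam Φ 1 0 j, ip lam Φ 2 0 k;
                        ip lam Φ 0 1 i, ip lam Φ 1 1 j, ip lam Φ 2 1 k;
                        ip lam Φ 0 2 i, ip lam Φ 1 2 j, ip lam Φ 2 2 k]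
        else 0) = ((∑ k, lam k ^ (m + 1) * res2 lam k Φ : ℝ) : ℂ) := by
  have h₁ : ∑ l ∈ Finset.range (m + 1),
      Matrix.det !![ip lam Φ 0 0 l, ip lam Φ 1 0 (m - l);
                    ip lam Φ 0 1 l, ip lam Φ 1 1 (m - l)] =
      ((∑ k, lam k ^ (m + 1) * pairRes lam 0 1 k Φ : ℝ) : ℂ) := by
    have hgeom : ∀ k l, (∑ n ∈ Finset.range (m + 1), lam k ^ n * lam l ^ (m - n)) *
        (lam k - lam l) = lam k ^ (m + 1) - lam l ^ (m + 1) := fun k l =>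
      geom_sum₂_mul (lam k) (lam l) (m + 1)
    rw [← sum_mul_pairRes hlam hgeom Φ 0 1]
    simp only [det_fin_two_of, ip_eq_wip, wip_minor]
    rw [Finset.sum_comm]
    refine Finset.sum_congr rfl fun k _ => ?_
    rw [Finset.sum_comm]
    refine Finset.sum_congr rfl fun l _ => ?_
    rw [← Finset.sum_mul, ← Complex.ofReal_sum]
  have h₂ : ∑ i ∈ Finset.range m, ∑ j ∈ Finset.range m, ∑ k ∈ Finset.range m,
        (if i + j + k + 1 = m then
          Matrix.det !![ip lam Φ 0 0 i, ip lam Φ 1 0 j, ip lam Φ 2 0 k;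
                        ip lam Φ 0 1 i, ip lam Φ 1 1 j, ip lam Φ 2 1 k;
                        ip lam Φ 0 2 i, ip lam Φ 1 2 j, ip lam Φ 2 2 k]
        else 0) = ((∑ k, lam k ^ (m + 1) * tripleRes lam k Φ : ℝ) : ℂ) := by
    rw [← sum_mul_tripleRes hlam (h := fun k l n => homSum (lam k) (lam l) (lam n) m)
      (fun k l n => homSum_mul _ _ _ m) Φ]
    have e : ∀ i j k : ℕ, (if i + j + k + 1 = m then
          Matrix.det !![ip lam Φ 0 0 i, ip lam Φ 1 0 j, ip lam Φ 2 0 k;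
                        ip lam Φ 0 1 i, ip lam Φ 1 1 j, ip lam Φ 2 1 k;
                        ip lam Φ 0 2 i, ip lam Φ 1 2 j, ip lam Φ 2 2 k]
        else 0) = ∑ a, ∑ b, ∑ c,
          (((if i + j + k + 1 = m then lam a ^ i * lam b ^ j * lam c ^ k else 0 : ℝ)) : ℂ) *
            (conj (Φ 0 a) * conj (Φ 1 b) * conj (Φ 2 c) * siteDet a b c Φ) := fun i j k => by
      split_ifs with hm
      · simp only [ip_eq_wip, det_wip]
      · simp
    simp only [e]
    have swap : ∀ f : ℕ → Fin N → ℂ, ∑ i ∈ Finset.range m, ∑ a, f i a =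
      ∑ a, ∑ i ∈ Finset.range m, f i a := fun f => Finset.sum_comm
    simp only [swap]
    refine Finset.sum_congr rfl fun a _ => Finset.sum_congr rfl fun b _ =>
      Finset.sum_congr rfl fun c _ => ?_
    simp only [← Finset.sum_mul, ← Complex.ofReal_sum]
    rfl
  rw [h₁, h₂, ← Complex.ofReal_sub, ← Finset.sum_sub_distrib]
  congr 1
  exact Finset.sum_congr rfl fun k _ => by rw [res2, mul_sub]

lemma E2_eq {lam : Fin N → ℝ} (hlam : Function.Injective lam) (Φ : Phase N) (m : ℕ) :
    E2 lam Φ m = ∑ k, lam k ^ (m + 1) * res2 lam k Φ := by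
  rw [E2, E2_complex hlam, Complex.ofReal_re]

/-- All divided differences of a constant vanish. This single relation among the residues explains
why the family `E2` has one member fewer. -/
lemma sum_res2 {lam : Fin N → ℝ} (hlam : Function.Injective lam) (Φ : Phase N) :
    ∑ k, res2 lam k Φ = 0 := by
  have h₁ := sum_mul_pairRes hlam (x := fun _ => 1) (h := fun _ _ => 0) (by simp) Φ 0 1
  have h₂ := sum_mul_tripleRes hlam (x := fun _ => 1) (h := fun _ _ _ => 0)
    (fun k l m => by ring) Φ
  simp only [Complex.ofReal_zero, zero_mul, Finset.sum_const_zero, one_mul] at h₁ h₂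
  have h₁' : ∑ k, pairRes lam 0 1 k Φ = 0 := by exact_mod_cast h₁.symm
  have h₂' : ∑ k, tripleRes lam k Φ = 0 := by exact_mod_cast h₂.symm
  simp only [res2, Finset.sum_sub_distrib, h₁', h₂', sub_self]

/-! ### The generating functions -/

/-- The weights `1 / (z - λ_k)`. -/
def resolventWeight (lam : Fin N → ℝ) (z : ℝ) (k : Fin N) : ℝ := (z - lam k)⁻¹

lemma resolventWeight_pair {lam : Fin N → ℝ} {z : ℝ} (hz : ∀ k, z ≠ lam k) (k l : Fin N) :
    resolventWeight lam z k * resolventWeight lam z l * (lam k - lam l) =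
      resolventWeight lam z k - resolventWeight lam z l := by
  have h₁ := sub_ne_zero.2 (hz k)
  have h₂ := sub_ne_zero.2 (hz l)
  simp only [resolventWeight]
  field_simp
  ring

lemma resolventWeight_triple {lam : Fin N → ℝ} {z : ℝ} (hz : ∀ k, z ≠ lam k) (k l m : Fin N) :
    resolventWeight lam z k * resolventWeight lam z l * resolventWeight lam z m *
        ((lam k - lam l) * (lam k - lam m) * (lam l - lam m)) =
      resolventWeight lam z k * (lam l - lam m) - resolventWeight lam z l * (lam k - lam m) +
        resolventWeight lam z m * (lam k - lam l) := by
  have h₁ := sub_ne_zero.2 (hz k)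
  have h₂ := sub_ne_zero.2 (hz l)
  have h₃ := sub_ne_zero.2 (hz m)
  simp only [resolventWeight]
  field_simp
  ring

lemma resolvent_minor {lam : Fin N → ℝ} (hlam : Function.Injective lam) {z : ℝ}
    (hz : ∀ k, z ≠ lam k) (Φ : Phase N) (i j : Fin 3) :
    wip (resolventWeight lam z) Φ i i * wip (resolventWeight lam z) Φ j j -
      wip (resolventWeight lam z) Φ j i * wip (resolventWeight lam z) Φ i j =
      ((∑ k, resolventWeight lam z k * pairRes lam i j k Φ : ℝ) : ℂ) := by
  rw [wip_minor]
  exact sum_mul_pairRes hlam (resolventWeight_pair hz) Φ i j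

lemma resolvent_det {lam : Fin N → ℝ} (hlam : Function.Injective lam) {z : ℝ}
    (hz : ∀ k, z ≠ lam k) (Φ : Phase N) :
    (siteGram (resolventWeight lam z) Φ).det =
      ((∑ k, resolventWeight lam z k * tripleRes lam k Φ : ℝ) : ℂ) := by
  rw [← sum_mul_tripleRes hlam (resolventWeight_triple hz) Φ, ← det_wip]
  congr 1
  ext i j
  fin_cases i <;> fin_cases j <;> rfl

lemma trace_lax_one (w : Fin N → ℝ) (Φ : Phase N) :
    (laxTrace w 1 Φ : ℂ) = 2 + wip w Φ 0 0 + wip w Φ 1 1 + wip w Φ 2 2 := by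
  rw [← trace_lax_pow, pow_one, lax, laxConst, trace_add, trace_diagonal, Fin.sum_univ_three,
    trace_fin_three]
  simp only [siteGram, of_apply]
  simp
  ring

lemma lax_secondInvariant (w : Fin N → ℝ) (Φ : Phase N) :
    ((laxTrace w 1 Φ : ℂ) ^ 2 - laxTrace w 2 Φ) / 2 =
      1 + wip w Φ 0 0 + wip w Φ 1 1 + 2 * wip w Φ 2 2 +
        ((wip w Φ 0 0 * wip w Φ 1 1 - wip w Φ 1 0 * wip w Φ 0 1) +
          (wip w Φ 0 0 * wip w Φ 2 2 - wip w Φ 2 0 * wip w Φ 0 2) +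
          (wip w Φ 1 1 * wip w Φ 2 2 - wip w Φ 2 1 * wip w Φ 1 2)) := by
  rw [trace_lax_one, ← trace_lax_pow, pow_two (lax w Φ), lax, laxConst, trace_fin_three]
  simp only [Matrix.mul_apply, Fin.sum_univ_three, Matrix.add_apply, siteGram, of_apply,
    diagonal_apply]
  simp
  ring

lemma lax_thirdInvariant (w : Fin N → ℝ) (Φ : Phase N) :
    ((laxTrace w 1 Φ : ℂ) ^ 3 - 3 * laxTrace w 1 Φ * laxTrace w 2 Φ + 2 * laxTrace w 3 Φ) / 6 =
      wip w Φ 2 2 + (wip w Φ 0 0 * wip w Φ 2 2 - wip w Φ 2 0 * wip w Φ 0 2) +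
        (wip w Φ 1 1 * wip w Φ 2 2 - wip w Φ 2 1 * wip w Φ 1 2) + (siteGram w Φ).det := by
  rw [trace_lax_one, ← trace_lax_pow, ← trace_lax_pow, pow_three (lax w Φ), pow_two (lax w Φ), lax,
    laxConst, trace_fin_three, trace_fin_three, det_fin_three]
  simp only [Matrix.mul_apply, Fin.sum_univ_three, Matrix.add_apply, siteGram, of_apply,
    diagonal_apply]
  simp
  ring

/-- In terms of the elementary symmetric functions of the eigenvalues of the Lax matrix the right
side is e₂ − e₁ + 1, which leaves the third diagonal entry and the three minors of the Gram matrix.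
-/
lemma sum_resolvent_res3 {lam : Fin N → ℝ} (hlam : Function.Injective lam) {z : ℝ}
    (hz : ∀ k, z ≠ lam k) (Φ : Phase N) :
    ∑ k, resolventWeight lam z k * res3 lam k Φ =
      (laxTrace (resolventWeight lam z) 1 Φ ^ 2 - laxTrace (resolventWeight lam z) 2 Φ) / 2 -
        laxTrace (resolventWeight lam z) 1 Φ + 1 := by
  have h := lax_secondInvariant (resolventWeight lam z) Φ
  have h' := trace_lax_one (resolventWeight lam z) Φ
  rw [resolvent_minor hlam hz, resolvent_minor hlam hz, resolvent_minor hlam hz] at h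
  apply Complex.ofReal_injective
  have e : ((∑ k, resolventWeight lam z k * res3 lam k Φ : ℝ) : ℂ) =
      wip (resolventWeight lam z) Φ 2 2 +
      (((∑ k, resolventWeight lam z k * pairRes lam 0 1 k Φ : ℝ) : ℂ) +
        ((∑ k, resolventWeight lam z k * pairRes lam 0 2 k Φ : ℝ) : ℂ) +
        ((∑ k, resolventWeight lam z k * pairRes lam 1 2 k Φ : ℝ) : ℂ)) := by
    rw [wip_self]
    simp only [res3, minorRes, mul_add, Finset.sum_add_distrib, Complex.ofReal_add]
  push_cast at e h ⊢
  rw [e, h, h']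
  ring

lemma sum_resolvent_res1 (lam : Fin N → ℝ) (z : ℝ) (Φ : Phase N) :
    ∑ k, resolventWeight lam z k * res1 lam k Φ = laxTrace (resolventWeight lam z) 1 Φ - 2 -
      ∑ k, resolventWeight lam z k * res3 lam k Φ := by
  have h' := trace_lax_one (resolventWeight lam z) Φ
  rw [wip_self, wip_self, wip_self] at h'
  have h : laxTrace (resolventWeight lam z) 1 Φ = 2 +
      ∑ k, resolventWeight lam z k * Complex.normSq (Φ 0 k) +
      ∑ k, resolventWeight lam z k * Complex.normSq (Φ 1 k) +
      ∑ k, resolventWeight lam z k * Complex.normSq (Φ 2 k) := by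
    apply Complex.ofReal_injective
    rw [h']
    push_cast
    rfl
  rw [h]
  simp only [res1, res3, mul_add, mul_sub, Finset.sum_add_distrib, Finset.sum_sub_distrib]
  ring

/-- The subtracted quotient is e₃, so the whole right side is e₂ − e₁ + 1 − e₃ = det(1 − L). -/
lemma sum_resolvent_res2 {lam : Fin N → ℝ} (hlam : Function.Injective lam) {z : ℝ}
    (hz : ∀ k, z ≠ lam k) (Φ : Phase N) :
    ∑ k, resolventWeight lam z k * res2 lam k Φ =
      ∑ k, resolventWeight lam z k * res3 lam k Φ -
      (laxTrace (resolventWeight lam z) 1 Φ ^ 3 -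
        3 * laxTrace (resolventWeight lam z) 1 Φ * laxTrace (resolventWeight lam z) 2 Φ +
        2 * laxTrace (resolventWeight lam z) 3 Φ) / 6 := by
  have h := lax_thirdInvariant (resolventWeight lam z) Φ
  rw [resolvent_minor hlam hz, resolvent_minor hlam hz, resolvent_det hlam hz, wip_self] at h
  have h' : (laxTrace (resolventWeight lam z) 1 Φ ^ 3 -
        3 * laxTrace (resolventWeight lam z) 1 Φ * laxTrace (resolventWeight lam z) 2 Φ +
        2 * laxTrace (resolventWeight lam z) 3 Φ) / 6 =
      ∑ k, resolventWeight lam z k * Complex.normSq (Φ 2 k) +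
      ∑ k, resolventWeight lam z k * pairRes lam 0 2 k Φ +
      ∑ k, resolventWeight lam z k * pairRes lam 1 2 k Φ +
      ∑ k, resolventWeight lam z k * tripleRes lam k Φ := by
    apply Complex.ofReal_injective
    push_cast at h ⊢
    exact h
  rw [h']
  simp only [res2, res3, minorRes, mul_add, mul_sub, Finset.sum_add_distrib,
    Finset.sum_sub_distrib]
  ring

end Expansion

/-! ### Involution of the residues -/

section Involution

variable {N : ℕ}

open Filter Topology

/-- Multiplying by z − λₖ and letting z tend to λₖ isolates the coefficient of that pole. Finitely
many excluded parameters do not matter. -/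
lemma eq_zero_of_resolvent_sum_eq_zero {lam : Fin N → ℝ} (hlam : Function.Injective lam)
    {A : Set ℝ} (hA : A.Finite) {c : Fin N → ℝ}
    (h : ∀ z, z ∉ A → (∀ k, z ≠ lam k) → ∑ k, resolventWeight lam z k * c k = 0) (k : Fin N) :
    c k = 0 := by
  have hfin : (A ∪ Set.range lam).Finite := hA.union (Set.finite_range lam)
  have hev : ∀ᶠ z in 𝓝[≠] lam k, z ∉ A ∧ ∀ l, z ≠ lam l := by
    have : ∀ᶠ z in 𝓝[≠] lam k, z ∉ (A ∪ Set.range lam) \ {lam k} :=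
      nhdsWithin_le_nhds ((hfin.sdiff.isClosed.isOpen_compl).mem_nhds (by simp))
    filter_upwards [this, self_mem_nhdsWithin] with z hz hzk
    have hz' : z ∉ A ∪ Set.range lam := fun hmem => hz ⟨hmem, hzk⟩
    exact ⟨fun hmem => hz' (Or.inl hmem), fun l hl => hz' (Or.inr ⟨l, hl.symm⟩)⟩
  have hlim : Tendsto (fun z => ∑ l, (z - lam k) * (resolventWeight lam z l * c l))
      (𝓝[≠] lam k) (𝓝 (∑ l, if l = k then c l else 0)) := by
    refine tendsto_finsetSum _ fun l _ => ?_
    split_ifs with hl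
    · subst hl
      refine tendsto_const_nhds.congr' ?_
      filter_upwards [self_mem_nhdsWithin] with z hz
      have : z - lam l ≠ 0 := sub_ne_zero.2 hz
      rw [resolventWeight]
      field_simp
    · have hne : lam k - lam l ≠ 0 := sub_ne_zero.2 fun e => hl (hlam e).symm
      have hcont : ContinuousAt (fun z => (z - lam k) * ((z - lam l)⁻¹ * c l)) (lam k) := by
        have := ContinuousAt.inv₀ (f := fun z : ℝ => z - lam l) (a := lam k) (by fun_prop) hne
        fun_prop
      have := hcont.tendsto.mono_left (nhdsWithin_le_nhds (s := {lam k}ᶜ))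
      simpa [resolventWeight] using this
  have hzero : (fun _ => (0 : ℝ)) =ᶠ[𝓝[≠] lam k]
      fun z => ∑ l, (z - lam k) * (resolventWeight lam z l * c l) := by
    filter_upwards [hev] with z hz
    rw [← Finset.mul_sum, h z hz.1 hz.2, mul_zero]
  have := tendsto_nhds_unique (tendsto_const_nhds.congr' hzero) hlim
  simpa using this.symm

lemma inInvolution_of_resolvent_sum {lam : Fin N → ℝ} (hlam : Function.Injective lam)
    {A : Set ℝ} (hA : A.Finite) {r : Fin N → Phase N → ℝ} (hr : ∀ k, Differentiable ℝ (r k))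
    {G : Phase N → ℝ} (h : ∀ z, z ∉ A → (∀ k, z ≠ lam k) →
      InInvolution (fun Φ => ∑ k, resolventWeight lam z k * r k Φ) G) (k : Fin N) :
    InInvolution (r k) G := fun p => by
  refine eq_zero_of_resolvent_sum_eq_zero hlam hA (c := fun k => pb (r k) G p)
    (fun z hz hzk => ?_) k
  have := h z hz hzk p
  rw [pb, fderiv_fun_sum fun k _ => ((hr k).const_mul _) p] at this
  rw [← this, sum_apply]
  refine Finset.sum_congr rfl fun k _ => ?_
  rw [fderiv_const_mul (hr k p)]
  rfl

@[fun_prop]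
lemma contDiff_normSq {n : WithTop ℕ∞} : ContDiff ℝ n (fun z : ℂ => Complex.normSq z) := by
  have : (fun z : ℂ => Complex.normSq z) = fun z : ℂ => (conj z * z).re := by
    funext z
    rw [← Complex.normSq_eq_conj_mul_self, Complex.ofReal_re]
  rw [this]
  exact contDiff_re.comp (contDiff_conj.mul contDiff_id)

@[fun_prop]
lemma contDiff_pairRes {n : WithTop ℕ∞} (lam : Fin N → ℝ) (i j : Fin 3) (k : Fin N) :
    ContDiff ℝ n (pairRes lam i j k) :=
  ContDiff.sum fun l _ => (contDiff_normSq.comp (by fun_prop :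
    ContDiff ℝ n fun Φ : Phase N => Φ i k * Φ j l - Φ j k * Φ i l)).div_const _

@[fun_prop]
lemma contDiff_tripleRes {n : WithTop ℕ∞} (lam : Fin N → ℝ) (k : Fin N) :
    ContDiff ℝ n (tripleRes lam k) :=
  contDiff_const.mul (ContDiff.sum fun l _ => ContDiff.sum fun m _ =>
    (contDiff_normSq.comp (by unfold siteDet; fun_prop :
      ContDiff ℝ n fun Φ : Phase N => siteDet k l m Φ)).div_const _)

@[fun_prop]
lemma contDiff_siteNormSq {n : WithTop ℕ∞} (i : Fin 3) (k : Fin N) :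
    ContDiff ℝ n fun Φ : Phase N => Complex.normSq (Φ i k) :=
  contDiff_normSq.comp (by fun_prop : ContDiff ℝ n fun Φ : Phase N => Φ i k)

lemma contDiff_res1 {n : WithTop ℕ∞} (lam : Fin N → ℝ) (k : Fin N) :
    ContDiff ℝ n (res1 lam k) := by
  unfold res1 minorRes
  fun_prop

lemma contDiff_res2 {n : WithTop ℕ∞} (lam : Fin N → ℝ) (k : Fin N) :
    ContDiff ℝ n (res2 lam k) := by
  unfold res2
  fun_prop

lemma contDiff_res3 {n : WithTop ℕ∞} (lam : Fin N → ℝ) (k : Fin N) :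
    ContDiff ℝ n (res3 lam k) := by
  unfold res3 minorRes
  fun_prop

/-- The three families of residues. -/
def res (lam : Fin N → ℝ) (a : Fin 3) (k : Fin N) : Phase N → ℝ :=
  match a with
  | 0 => res1 lam k
  | 1 => res2 lam k
  | 2 => res3 lam k

lemma contDiff_res {n : WithTop ℕ∞} (lam : Fin N → ℝ) (a : Fin 3) (k : Fin N) :
    ContDiff ℝ n (res lam a k) := by
  fin_cases a
  · exact contDiff_res1 lam k
  · exact contDiff_res2 lam k
  · exact contDiff_res3 lam k

lemma differentiable_res (lam : Fin N → ℝ) (a : Fin 3) (k : Fin N) :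
    Differentiable ℝ (res lam a k) :=
  (contDiff_res (n := 1) lam a k).differentiable (by simp)

/-- The generating functions of the residues are polynomials in the first three power traces, and a
bracket can be read off pole by pole. -/
lemma inInvolution_res_of_laxTrace {lam : Fin N → ℝ} (hlam : Function.Injective lam)
    {A : Set ℝ} (hA : A.Finite) {G : Phase N → ℝ}
    (h : ∀ z, z ∉ A → (∀ k, z ≠ lam k) → ∀ n,
      InInvolution (laxTrace (resolventWeight lam z) n) G) (a : Fin 3) (k : Fin N) :
    InInvolution (res lam a k) G := by
  have hd : ∀ z n, Differentiable ℝ (laxTrace (resolventWeight lam z) n) := fun z n =>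
    (contDiff_laxTrace (m := 1) _ n).differentiable (by simp)
  have i3 : ∀ z, z ∉ A → (∀ k, z ≠ lam k) →
      InInvolution (fun Φ => ∑ k, resolventWeight lam z k * res3 lam k Φ) G := fun z hz hzk => by
    simp only [sum_resolvent_res3 hlam hzk, div_eq_mul_inv]
    have h1 := h z hz hzk 1
    have h2 := h z hz hzk 2
    have d1 := hd z 1
    have d2 := hd z 2
    refine .add (by fun_prop) (by fun_prop) (.sub (by fun_prop) d1 ?_ h1) (.const 1)
    exact .mul (by fun_prop) (by fun_prop) (.sub (by fun_prop) d2 (h1.pow 2 d1) h2) (.const _)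
  have d3 : ∀ z, Differentiable ℝ (fun Φ => ∑ k, resolventWeight lam z k * res3 lam k Φ) :=
    fun z => Differentiable.fun_sum fun k _ => (differentiable_res lam 2 k).const_mul _
  fin_cases a
  · refine inInvolution_of_resolvent_sum hlam hA (r := res lam 0)
      (fun k => differentiable_res lam 0 k) (fun z hz hzk => ?_) k
    change InInvolution (fun Φ => ∑ k, resolventWeight lam z k * res1 lam k Φ) G
    simp only [sum_resolvent_res1]
    have d1 := hd z 1
    exact .sub (by fun_prop) (d3 z) (.sub d1 (by fun_prop) (h z hz hzk 1) (.const 2)) (i3 z hz hzk)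
  · refine inInvolution_of_resolvent_sum hlam hA (r := res lam 1)
      (fun k => differentiable_res lam 1 k) (fun z hz hzk => ?_) k
    change InInvolution (fun Φ => ∑ k, resolventWeight lam z k * res2 lam k Φ) G
    simp only [sum_resolvent_res2 hlam hzk, div_eq_mul_inv]
    have h1 := h z hz hzk 1
    have h2 := h z hz hzk 2
    have h3 := h z hz hzk 3
    have d1 := hd z 1
    have d2 := hd z 2
    have d3' := hd z 3
    refine .sub (d3 z) (by fun_prop) (i3 z hz hzk) (.mul (by fun_prop) (by fun_prop) ?_ (.const _))
    refine .add (by fun_prop) (by fun_prop) (.sub (by fun_prop) (by fun_prop) (h1.pow 3 d1) ?_)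
      (h3.const_mul 2 d3')
    exact .mul (by fun_prop) d2 (h1.const_mul 3 d1) h2
  · exact inInvolution_of_resolvent_sum hlam hA (r := res lam 2)
      (fun k => differentiable_res lam 2 k) i3 k

lemma inInvolution_res_res {lam : Fin N → ℝ} (hlam : Function.Injective lam) (a b : Fin 3)
    (k l : Fin N) : InInvolution (res lam a k) (res lam b l) := by
  refine inInvolution_res_of_laxTrace hlam Set.finite_empty (fun z _ hzk n => ?_) a k
  -- The second parameter must avoid the first, since the resolvent identity divides by their
  -- difference.
  refine InInvolution.symm (inInvolution_res_of_laxTrace hlam (Set.finite_singleton z)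
    (fun z' hz' hzk' n' => ?_) b l)
  have hne : z' - z ≠ 0 := sub_ne_zero.2 (by simpa using hz')
  refine inInvolution_laxTrace hne (fun j => ?_) n n'
  have h₁ := sub_ne_zero.2 (hzk j)
  have h₂ := sub_ne_zero.2 (hzk' j)
  simp only [resolventWeight]
  field_simp
  ring

lemma inInvolution_res_of_dwip {lam : Fin N → ℝ} (hlam : Function.Injective lam)
    {G : Phase N → ℝ} (i j : Fin 3)
    (hij : (![1, 1, 0] : Fin 3 → ℂ) i = (![1, 1, 0] : Fin 3 → ℂ) j)
    (hG : ∀ p v, dwip (fun _ => 1) p v i j = 0 → fderiv ℝ G p v = 0) (a : Fin 3) (k : Fin N) :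
    InInvolution (res lam a k) G :=
  inInvolution_res_of_laxTrace hlam Set.finite_empty
    (fun z _ _ n => InInvolution.symm fun p =>
      hG p _ (dwip_ambientField_laxTrace (resolventWeight lam z) n p hij)) a k

lemma inInvolution_res_sqNorm {lam : Fin N → ℝ} (hlam : Function.Injective lam) (a : Fin 3)
    (k : Fin N) (i : Fin 3) : InInvolution (res lam a k) (sqNorm i) := by
  refine inInvolution_res_of_dwip hlam i i rfl (fun p v h => ?_) a k
  have : (sqNorm i : Phase N → ℝ) = fun Φ => (wip (fun _ => 1) Φ i i).re :=
    funext (sqNorm_eq_re i)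
  rw [this, fderiv_re_wip, h, Complex.zero_re]

lemma inInvolution_res_constraint_re {lam : Fin N → ℝ} (hlam : Function.Injective lam)
    (a : Fin 3) (k : Fin N) :
    InInvolution (res lam a k) fun Φ => (wip (fun _ => 1) Φ 0 1).re :=
  inInvolution_res_of_dwip hlam 0 1 rfl
    (fun p v h => by rw [fderiv_re_wip, h, Complex.zero_re]) a k

lemma inInvolution_res_constraint_im {lam : Fin N → ℝ} (hlam : Function.Injective lam)
    (a : Fin 3) (k : Fin N) :
    InInvolution (res lam a k) fun Φ => (wip (fun _ => 1) Φ 0 1).im :=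
  inInvolution_res_of_dwip hlam 0 1 rfl
    (fun p v h => by rw [fderiv_im_wip, h, Complex.zero_im]) a k

end Involution

/-! ### Functions commuting with all residues and all norms -/

section Common

variable {N : ℕ}

lemma fderiv_sqNorm (i : Fin 3) (p v : Phase N) :
    fderiv ℝ (sqNorm i) p v = (dwip (fun _ => 1) p v i i).re := by
  have : (sqNorm i : Phase N → ℝ) = fun Φ => (wip (fun _ => 1) Φ i i).re :=
    funext (sqNorm_eq_re i)
  rw [this, fderiv_re_wip]

lemma ambientField_sqNorm (i : Fin 3) (p : Phase N) :
    ambientField (sqNorm i) p = fun j k => -Complex.I * (if j = i then p j k else 0) := by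
  rw [ambientField_eq_hamVec]
  refine hamVec_eq_of_gradient fun v => ?_
  rw [fderiv_sqNorm, Finset.sum_eq_single i]
  · simp only [dwip, Complex.re_sum, Finset.mul_sum]
    refine Finset.sum_congr rfl fun k _ => ?_
    simp
    ring
  · intro j _ hj
    simp [hj]
  · simp

/-- The flow of ⟨Φᵢ,Φᵢ⟩ rotates the phase of Φᵢ. It can rotate ⟨Φ₁,Φ₂⟩ but fixes its modulus, which
is why `CommonIntegral` asks for invariance of `constraintSq` only; otherwise the gap would be
excluded. -/
lemma dwip_ambientField_sqNorm (i a b : Fin 3) (p : Phase N) :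
    dwip (fun _ => 1) p (ambientField (sqNorm i) p) a b =
      ((if a = i then 1 else 0) - (if b = i then 1 else 0)) *
        (Complex.I * wip (fun _ => 1) p a b) := by
  rw [ambientField_sqNorm]
  simp only [dwip, wip, Finset.mul_sum]
  refine Finset.sum_congr rfl fun k _ => ?_
  split_ifs <;> simp <;> ring

lemma inInvolution_sqNorm_sqNorm (i j : Fin 3) :
    InInvolution (sqNorm i : Phase N → ℝ) (sqNorm j) := fun p => by
  rw [pb, fderiv_sqNorm, dwip_ambientField_sqNorm]
  simp

lemma constraintSq_eq (Φ : Phase N) :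
    constraintSq Φ = (wip (fun _ => 1) Φ 0 1).re * (wip (fun _ => 1) Φ 0 1).re +
      (wip (fun _ => 1) Φ 0 1).im * (wip (fun _ => 1) Φ 0 1).im := by
  rw [constraintSq, constraint_eq_wip, Complex.normSq_apply]

lemma differentiable_re_wip (w : Fin N → ℝ) (i j : Fin 3) :
    Differentiable ℝ fun Φ => (wip w Φ i j).re :=
  Complex.reCLM.differentiable.comp (differentiable_wip w i j)

lemma differentiable_im_wip (w : Fin N → ℝ) (i j : Fin 3) :
    Differentiable ℝ fun Φ => (wip w Φ i j).im :=
  Complex.imCLM.differentiable.comp (differentiable_wip w i j)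

lemma fderiv_constraintSq (p v : Phase N) :
    fderiv ℝ constraintSq p v =
      2 * (conj (wip (fun _ => 1) p 0 1) * dwip (fun _ => 1) p v 0 1).re := by
  have hre := differentiable_re_wip (N := N) (fun _ => 1) 0 1
  have him := differentiable_im_wip (N := N) (fun _ => 1) 0 1
  rw [show (constraintSq : Phase N → ℝ) = _ from funext constraintSq_eq,
    fderiv_fun_add ((hre.fun_mul hre) p) ((him.fun_mul him) p), fderiv_fun_mul (hre p) (hre p),
    fderiv_fun_mul (him p) (him p)]
  simp only [add_apply, smul_apply, fderiv_re_wip, fderiv_im_wip, smul_eq_mul]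
  simp
  ring

lemma inInvolution_constraintSq_sqNorm (i : Fin 3) :
    InInvolution (constraintSq : Phase N → ℝ) (sqNorm i) := fun p => by
  rw [pb, fderiv_constraintSq, dwip_ambientField_sqNorm]
  have : ∀ r : ℝ, (conj (wip (fun _ => 1) p 0 1) * (r * (Complex.I * wip (fun _ => 1) p 0 1))).re
      = 0 := fun r => by
    simp
    ring
  have e : ((if (0 : Fin 3) = i then 1 else 0) - (if (1 : Fin 3) = i then 1 else 0) : ℂ) =
      (((if (0 : Fin 3) = i then 1 else 0) - (if (1 : Fin 3) = i then 1 else 0) : ℝ) : ℂ) := by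
    split_ifs <;> simp
  rw [e, this, mul_zero]

/-- Smooth functions commuting with all residues, with `⟨Φ_i, Φ_i⟩` and with `|⟨Φ₁, Φ₂⟩|²`. -/
structure CommonIntegral (lam : Fin N → ℝ) (P : Phase N → ℝ) : Prop where
  contDiff : ContDiff ℝ ∞ P
  res : ∀ a k, InInvolution P (res lam a k)
  norm : ∀ i, InInvolution P (sqNorm i)
  constraintSq : InInvolution P constraintSq

namespace CommonIntegral

variable {lam : Fin N → ℝ} {P Q : Phase N → ℝ}

lemma differentiable (h : CommonIntegral lam P) : Differentiable ℝ P :=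
  h.contDiff.differentiable (by simp)

lemma const (r : ℝ) : CommonIntegral lam fun _ => r :=
  ⟨contDiff_const, fun _ _ => .const r, fun _ => .const r, .const r⟩

lemma add (hP : CommonIntegral lam P) (hQ : CommonIntegral lam Q) :
    CommonIntegral lam fun Φ => P Φ + Q Φ :=
  ⟨hP.contDiff.add hQ.contDiff,
    fun a k => .add hP.differentiable hQ.differentiable (hP.res a k) (hQ.res a k),
    fun i => .add hP.differentiable hQ.differentiable (hP.norm i) (hQ.norm i),
    .add hP.differentiable hQ.differentiable hP.constraintSq hQ.constraintSq⟩

lemma mul (hP : CommonIntegral lam P) (hQ : CommonIntegral lam Q) :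
    CommonIntegral lam fun Φ => P Φ * Q Φ :=
  ⟨hP.contDiff.mul hQ.contDiff,
    fun a k => .mul hP.differentiable hQ.differentiable (hP.res a k) (hQ.res a k),
    fun i => .mul hP.differentiable hQ.differentiable (hP.norm i) (hQ.norm i),
    .mul hP.differentiable hQ.differentiable hP.constraintSq hQ.constraintSq⟩

lemma const_mul (r : ℝ) (hP : CommonIntegral lam P) : CommonIntegral lam fun Φ => r * P Φ :=
  (const r).mul hP

lemma neg (hP : CommonIntegral lam P) : CommonIntegral lam fun Φ => -P Φ := by
  simpa using hP.const_mul (-1)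

lemma sub (hP : CommonIntegral lam P) (hQ : CommonIntegral lam Q) :
    CommonIntegral lam fun Φ => P Φ - Q Φ := by
  simpa [sub_eq_add_neg] using hP.add hQ.neg

lemma pow (n : ℕ) (hP : CommonIntegral lam P) : CommonIntegral lam fun Φ => P Φ ^ n := by
  induction n with
  | zero => simpa using const 1
  | succ n ih => simpa [pow_succ] using ih.mul hP

lemma sum {ι : Type*} (s : Finset ι) {f : ι → Phase N → ℝ} (h : ∀ i, CommonIntegral lam (f i)) :
    CommonIntegral lam fun Φ => ∑ i ∈ s, f i Φ := by
  classical
  induction s using Finset.induction_on with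
  | empty => simpa using const 0
  | insert a s ha ih => simpa only [Finset.sum_insert ha] using (h a).add ih

lemma of_res (hlam : Function.Injective lam) (a : Fin 3) (k : Fin N) :
    CommonIntegral lam (_root_.res lam a k) where
  contDiff := contDiff_res lam a k
  res b l := inInvolution_res_res hlam a b k l
  norm i := inInvolution_res_sqNorm hlam a k i
  constraintSq := by
    have hre := differentiable_re_wip (N := N) (fun _ => 1) 0 1
    have him := differentiable_im_wip (N := N) (fun _ => 1) 0 1
    have h₁ := (inInvolution_res_constraint_re hlam a k).symm
    have h₂ := (inInvolution_res_constraint_im hlam a k).symm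
    rw [show (_root_.constraintSq : Phase N → ℝ) = _ from funext constraintSq_eq]
    exact (InInvolution.add (hre.mul hre) (him.mul him) (.mul hre hre h₁ h₁)
      (.mul him him h₂ h₂)).symm

lemma sqNorm (hlam : Function.Injective lam) (i : Fin 3) :
    CommonIntegral lam (_root_.sqNorm i) where
  contDiff := contDiff_sqNorm i
  res a k := (inInvolution_res_sqNorm hlam a k i).symm
  norm j := inInvolution_sqNorm_sqNorm i j
  constraintSq := (inInvolution_constraintSq_sqNorm i).symm

lemma gap (hlam : Function.Injective lam) : CommonIntegral lam _root_.gap :=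
  (sqNorm hlam 0).sub (sqNorm hlam 1)

lemma E1 (hlam : Function.Injective lam) (m : ℕ) : CommonIntegral lam fun Φ => E1 lam Φ m := by
  simp only [E1_eq hlam]
  exact sum _ fun k => (of_res hlam 0 k).const_mul _

lemma E2 (hlam : Function.Injective lam) (m : ℕ) : CommonIntegral lam fun Φ => E2 lam Φ m := by
  simp only [E2_eq hlam]
  exact sum _ fun k => (of_res hlam 1 k).const_mul _

lemma E3 (hlam : Function.Injective lam) (m : ℕ) : CommonIntegral lam fun Φ => E3 lam Φ m := by
  simp only [E3_eq hlam]
  exact sum _ fun k => (of_res hlam 2 k).const_mul _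

lemma integrals (hlam : Function.Injective lam) (i : Fin N ⊕ Fin (N - 1) ⊕ Fin N) :
    CommonIntegral lam (integrals lam i) := by
  rcases i with m | m | m
  · exact E1 hlam m
  · exact E2 hlam m
  · exact E3 hlam m

lemma inInvolution_sum_res (hP : CommonIntegral lam P) (a : Fin 3) (x : Fin N → ℝ) :
    InInvolution (fun Φ => ∑ k, x k * _root_.res lam a k Φ) P :=
  .sum _ (fun k _ => (differentiable_res lam a k).const_mul _)
    fun k _ => .const_mul _ (differentiable_res lam a k) (hP.res a k).symm

lemma inInvolution_integrals (hlam : Function.Injective lam) (hP : CommonIntegral lam P)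
    (i : Fin N ⊕ Fin (N - 1) ⊕ Fin N) : InInvolution (_root_.integrals lam i) P := by
  rcases i with m | m | m
  · change InInvolution (fun Φ => _root_.E1 lam Φ m) P
    simp only [E1_eq hlam]
    exact hP.inInvolution_sum_res 0 _
  · change InInvolution (fun Φ => _root_.E2 lam Φ m) P
    simp only [E2_eq hlam]
    exact hP.inInvolution_sum_res 1 _
  · change InInvolution (fun Φ => _root_.E3 lam Φ m) P
    simp only [E3_eq hlam]
    exact hP.inInvolution_sum_res 2 _

lemma exists_flow (hP : CommonIntegral lam P) {p : Phase N} (hp : p ∈ constraintManifold N) :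
    ∃ c : ℝ → Phase N, c 0 = p ∧ ∀ t, c t ∈ constraintManifold N ∧
      _root_.gap (c t) = _root_.gap p ∧ HasDerivAt c (ambientField P (c t)) t :=
  exists_flow_in_constraintManifold hP.contDiff (fun i => (hP.norm i).symm)
    hP.constraintSq.symm hp

/-- The differential of `constraintSq` vanishes on the manifold and gives no tangency directly.
Instead the constraint is differentiated along an integral curve that stays in the manifold. -/
lemma ambientField_mem_levelTangent (hP : CommonIntegral lam P) {p : Phase N}
    (hp : p ∈ constraintManifold N) : ambientField P p ∈ levelTangent (constraint N) p := by
  obtain ⟨c, h0, hc⟩ := hP.exists_flow hp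
  have h₁ := (((contDiff_constraint (N := N) (n := 1)).differentiable (by simp)
    (c 0)).hasFDerivAt).comp_hasDerivAt 0 (hc 0).2.2
  have h₂ : (constraint N ∘ c) = fun _ => 0 :=
    funext fun t => (mem_constraintManifold.1 (hc t).1).1
  rw [h₂] at h₁
  have := h₁.unique (hasDerivAt_const (0 : ℝ) (0 : ℂ))
  rw [h0] at this
  exact this

end CommonIntegral

/-- At each level of the gap, `H` has the same differential along the constraint manifold as a
common integral. -/
def HasCommonModel (lam : Fin N → ℝ) (H : Phase N → ℝ) : Prop :=
  ∀ p ∈ constraintManifold N, ∃ P, CommonIntegral lam P ∧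
    ∀ q ∈ constraintManifold N, gap q = gap p → fderiv ℝ H q = fderiv ℝ P q

namespace HasCommonModel

variable {lam : Fin N → ℝ} {H : Phase N → ℝ}

lemma of_commonIntegral (h : CommonIntegral lam H) : HasCommonModel lam H :=
  fun _ _ => ⟨H, h, fun _ _ _ => rfl⟩

lemma ambientField_mem_levelTangent (h : HasCommonModel lam H) {p : Phase N}
    (hp : p ∈ constraintManifold N) : ambientField H p ∈ levelTangent (constraint N) p := by
  obtain ⟨P, hP, he⟩ := h p hp
  rw [ambientField_eq_hamVec, he p hp rfl]
  exact hP.ambientField_mem_levelTangent hp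

/-- The flow of the model conserves the gap, so one model serves along the whole integral curve. -/
lemma isCompleteOn (h : HasCommonModel lam H) :
    IsCompleteOn (hamiltonianField (symp N) (constraint N) H) (constraintManifold N) := by
  intro p hp
  obtain ⟨P, hP, he⟩ := h p hp
  obtain ⟨c, h0, hc⟩ := hP.exists_flow hp
  refine ⟨c, h0, fun t => ⟨(hc t).1, ?_⟩⟩
  rw [hamiltonianField_eq_ambientField (mem_constraintManifold.1 (hc t).1).2
    (h.ambientField_mem_levelTangent (hc t).1), ambientField_eq_hamVec,
    he _ (hc t).1 (hc t).2.1]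
  exact (hc t).2.2

lemma inducedBracket_integrals (hlam : Function.Injective lam) (h : HasCommonModel lam H)
    (i : Fin N ⊕ Fin (N - 1) ⊕ Fin N) {p : Phase N} (hp : p ∈ constraintManifold N) :
    inducedBracket (symp N) (constraint N) (integrals lam i) H p = 0 := by
  obtain ⟨P, hP, he⟩ := h p hp
  rw [inducedBracket_eq_pb (mem_constraintManifold.1 hp).2
    ((CommonIntegral.integrals hlam i).ambientField_mem_levelTangent hp)
    (h.ambientField_mem_levelTangent hp), pb, ambientField_eq_hamVec, he p hp rfl]
  exact hP.inInvolution_integrals hlam i p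

end HasCommonModel

end Common

/-! ### The three Hamiltonians in terms of the integrals -/

section Hamiltonians

variable {N : ℕ}

lemma conj_ip (lam : Fin N → ℝ) (Φ : Phase N) (i j : Fin 3) (m : ℕ) :
    conj (ip lam Φ i j m) = ip lam Φ j i m := by
  rw [ip_eq_wip, ip_eq_wip, conj_wip]

lemma normSq_ip (lam : Fin N → ℝ) (Φ : Phase N) (i j : Fin 3) (m : ℕ) :
    (Complex.normSq (ip lam Φ i j m) : ℂ) = ip lam Φ i j m * ip lam Φ j i m := by
  rw [Complex.normSq_eq_conj_mul_self, conj_ip, mul_comm]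

lemma gap_eq_ip (lam : Fin N → ℝ) (Φ : Phase N) :
    (gap Φ : ℂ) = ip lam Φ 0 0 0 - ip lam Φ 1 1 0 := by
  simp only [ip_eq_wip, pow_zero, wip_one_self, gap, Complex.ofReal_sub]

/-- The residue expansion shows that the complex expression is real, so `re` can be dropped and
identities between Hamiltonians and integrals can be checked over `ℂ`. -/
lemma ofReal_E1 {lam : Fin N → ℝ} (hlam : Function.Injective lam) (Φ : Phase N) (m : ℕ) :
    (E1 lam Φ m : ℂ) = ip lam Φ 0 0 m + ip lam Φ 1 1 m - minorSum lam Φ m := by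
  rw [E1, minorSum_eq hlam, ip_eq_wip, ip_eq_wip, wip_self, wip_self, ← Complex.ofReal_add,
    ← Complex.ofReal_sub, Complex.ofReal_re]

lemma ofReal_E3 {lam : Fin N → ℝ} (hlam : Function.Injective lam) (Φ : Phase N) (m : ℕ) :
    (E3 lam Φ m : ℂ) = ip lam Φ 2 2 m + minorSum lam Φ m := by
  rw [E3, minorSum_eq hlam, ip_eq_wip, wip_self, ← Complex.ofReal_add, Complex.ofReal_re]

lemma minorSum_zero (lam : Fin N → ℝ) (Φ : Phase N) : minorSum lam Φ 0 = 0 := by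
  simp [minorSum]

lemma minorSum_expand (lam : Fin N → ℝ) (Φ : Phase N) (m : ℕ) :
    minorSum lam Φ m = ∑ l ∈ Finset.Icc 1 m,
      ((ip lam Φ 0 0 (l - 1) * ip lam Φ 1 1 (m - l) - ip lam Φ 1 0 (m - l) * ip lam Φ 0 1 (l - 1)) +
      (ip lam Φ 0 0 (l - 1) * ip lam Φ 2 2 (m - l) - ip lam Φ 2 0 (m - l) * ip lam Φ 0 2 (l - 1)) +
      (ip lam Φ 1 1 (l - 1) * ip lam Φ 2 2 (m - l) -
        ip lam Φ 2 1 (m - l) * ip lam Φ 1 2 (l - 1))) := by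
  have h0 : Finset.Ioi (0 : Fin 3) = {1, 2} := by decide
  have h1 : Finset.Ioi (1 : Fin 3) = {2} := by decide
  have h2 : Finset.Ioi (2 : Fin 3) = ∅ := by decide
  rw [minorSum, Fin.sum_univ_three, h0, h1, h2, Finset.sum_pair (by decide),
    Finset.sum_singleton, Finset.sum_empty, add_zero]
  simp only [Matrix.det_fin_two_of, Finset.sum_add_distrib]

lemma minorSum_one (lam : Fin N → ℝ) (Φ : Phase N) : minorSum lam Φ 1 =
    (ip lam Φ 0 0 0 * ip lam Φ 1 1 0 - ip lam Φ 1 0 0 * ip lam Φ 0 1 0) +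
    (ip lam Φ 0 0 0 * ip lam Φ 2 2 0 - ip lam Φ 2 0 0 * ip lam Φ 0 2 0) +
    (ip lam Φ 1 1 0 * ip lam Φ 2 2 0 - ip lam Φ 2 1 0 * ip lam Φ 1 2 0) := by
  simp [minorSum_expand]

lemma minorSum_two (lam : Fin N → ℝ) (Φ : Phase N) : minorSum lam Φ 2 =
    (ip lam Φ 0 0 0 * ip lam Φ 1 1 1 - ip lam Φ 1 0 1 * ip lam Φ 0 1 0) +
    (ip lam Φ 0 0 0 * ip lam Φ 2 2 1 - ip lam Φ 2 0 1 * ip lam Φ 0 2 0) +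
    (ip lam Φ 1 1 0 * ip lam Φ 2 2 1 - ip lam Φ 2 1 1 * ip lam Φ 1 2 0) +
    ((ip lam Φ 0 0 1 * ip lam Φ 1 1 0 - ip lam Φ 1 0 0 * ip lam Φ 0 1 1) +
    (ip lam Φ 0 0 1 * ip lam Φ 2 2 0 - ip lam Φ 2 0 0 * ip lam Φ 0 2 1) +
    (ip lam Φ 1 1 1 * ip lam Φ 2 2 0 - ip lam Φ 2 1 0 * ip lam Φ 1 2 1)) := by
  have : Finset.Icc 1 2 = {1, 2} := by decide
  rw [minorSum_expand, this, Finset.sum_pair (by decide)]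

/-- The `3 × 3` determinant with columns of levels `a`, `b`, `c`. -/
def levelDet (lam : Fin N → ℝ) (Φ : Phase N) (a b c : ℕ) : ℂ :=
  ip lam Φ 0 0 a * (ip lam Φ 1 1 b * ip lam Φ 2 2 c - ip lam Φ 2 1 c * ip lam Φ 1 2 b)
    - ip lam Φ 1 0 b * (ip lam Φ 0 1 a * ip lam Φ 2 2 c - ip lam Φ 2 1 c * ip lam Φ 0 2 a)
    + ip lam Φ 2 0 c * (ip lam Φ 0 1 a * ip lam Φ 1 2 b - ip lam Φ 1 1 b * ip lam Φ 0 2 a)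

lemma ofReal_E2 {lam : Fin N → ℝ} (hlam : Function.Injective lam) (Φ : Phase N) (m : ℕ) :
    (E2 lam Φ m : ℂ) = ∑ l ∈ Finset.range (m + 1),
      (ip lam Φ 0 0 l * ip lam Φ 1 1 (m - l) - ip lam Φ 1 0 (m - l) * ip lam Φ 0 1 l)
    - ∑ i ∈ Finset.range m, ∑ j ∈ Finset.range m, ∑ k ∈ Finset.range m,
        if i + j + k + 1 = m then levelDet lam Φ i j k else 0 := by
  rw [E2, E2_complex hlam Φ m, Complex.ofReal_re, ← E2_complex hlam Φ m]
  simp only [Matrix.det_fin_two_of]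
  congr 1
  refine Finset.sum_congr rfl fun i _ => Finset.sum_congr rfl fun j _ =>
    Finset.sum_congr rfl fun k _ => ?_
  split_ifs
  · rw [Matrix.det_fin_three, levelDet]
    simp
    ring
  · rfl

lemma ofReal_E2_zero {lam : Fin N → ℝ} (hlam : Function.Injective lam) (Φ : Phase N) :
    (E2 lam Φ 0 : ℂ) = ip lam Φ 0 0 0 * ip lam Φ 1 1 0 - ip lam Φ 1 0 0 * ip lam Φ 0 1 0 := by
  rw [ofReal_E2 hlam]
  simp

lemma ofReal_E2_one {lam : Fin N → ℝ} (hlam : Function.Injective lam) (Φ : Phase N) :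
    (E2 lam Φ 1 : ℂ) = ip lam Φ 0 0 0 * ip lam Φ 1 1 1 - ip lam Φ 1 0 1 * ip lam Φ 0 1 0 +
      (ip lam Φ 0 0 1 * ip lam Φ 1 1 0 - ip lam Φ 1 0 0 * ip lam Φ 0 1 1) -
      levelDet lam Φ 0 0 0 := by
  rw [ofReal_E2 hlam]
  simp [Finset.sum_range_succ]
  ring

lemma ofReal_E2_two {lam : Fin N → ℝ} (hlam : Function.Injective lam) (Φ : Phase N) :
    (E2 lam Φ 2 : ℂ) = ip lam Φ 0 0 0 * ip lam Φ 1 1 2 - ip lam Φ 1 0 2 * ip lam Φ 0 1 0 +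
      (ip lam Φ 0 0 1 * ip lam Φ 1 1 1 - ip lam Φ 1 0 1 * ip lam Φ 0 1 1) +
      (ip lam Φ 0 0 2 * ip lam Φ 1 1 0 - ip lam Φ 1 0 0 * ip lam Φ 0 1 2) -
      (levelDet lam Φ 0 0 1 + levelDet lam Φ 0 1 0 + levelDet lam Φ 1 0 0) := by
  rw [ofReal_E2 hlam]
  simp [Finset.sum_range_succ]
  ring

/-- `H^x` as a polynomial in the integrals. -/
def modelX (lam : Fin N → ℝ) (Φ : Phase N) : ℝ :=
  -E1 lam Φ 1 - E2 lam Φ 0 - E1 lam Φ 0 * E3 lam Φ 0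

/-- The product of `H^y` and the gap as a polynomial in the integrals. -/
def modelY (lam : Fin N → ℝ) (Φ : Phase N) : ℝ :=
  2 * (E2 lam Φ 1 + E2 lam Φ 0 * E3 lam Φ 0) + E1 lam Φ 0 * modelX lam Φ

/-- The leading numerator of `H^t` as a polynomial in the integrals. -/
def modelT (lam : Fin N → ℝ) (Φ : Phase N) : ℝ :=
  2 * E1 lam Φ 0 * (E1 lam Φ 2 + (E2 lam Φ 1 + E2 lam Φ 0 * E3 lam Φ 0) +
      E1 lam Φ 0 * (E3 lam Φ 1 - E2 lam Φ 0 - E1 lam Φ 0 * E3 lam Φ 0) -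
      modelX lam Φ * E3 lam Φ 0) + modelX lam Φ ^ 2 -
    4 * E3 lam Φ 0 * (E2 lam Φ 1 + E2 lam Φ 0 * E3 lam Φ 0) -
    4 * E2 lam Φ 0 * (E3 lam Φ 1 - E2 lam Φ 0 - E1 lam Φ 0 * E3 lam Φ 0) - 4 * E2 lam Φ 2

/-- The factor of `⟨Φ₁, Φ₂⟩` in the remainder. -/
def remFactor (lam : Fin N → ℝ) (Φ : Phase N) : ℂ :=
  ip lam Φ 1 0 1 + ip lam Φ 1 2 0 * ip lam Φ 2 0 0

/-- The part of `H^t` that vanishes to second order on the constraint manifold, times the cube of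
the gap. -/
def remT (lam : Fin N → ℝ) (Φ : Phase N) : ℝ :=
  16 * ((constraint N Φ * remFactor lam Φ).re * (constraint N Φ * remFactor lam Φ).re) +
    4 * gap Φ ^ 2 * (Complex.normSq (ip lam Φ 2 0 0) + Complex.normSq (ip lam Φ 2 1 0)) *
      constraintSq Φ

lemma ofReal_modelX {lam : Fin N → ℝ} (hlam : Function.Injective lam) (Φ : Phase N) :
    (modelX lam Φ : ℂ) = -ip lam Φ 0 0 1 - ip lam Φ 1 1 1
      - ip lam Φ 0 2 0 * ip lam Φ 2 0 0 - ip lam Φ 1 2 0 * ip lam Φ 2 1 0 := by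
  rw [modelX]
  push_cast
  rw [ofReal_E1 hlam, ofReal_E1 hlam, ofReal_E3 hlam, ofReal_E2_zero hlam, minorSum_zero,
    minorSum_one]
  ring

lemma Hx_eq {lam : Fin N → ℝ} (hlam : Function.Injective lam) (Φ : Phase N) :
    Hx lam Φ = modelX lam Φ := by
  rw [Hx, normSq_ip, normSq_ip, ← ofReal_modelX hlam, Complex.ofReal_re]

lemma ofReal_modelY {lam : Fin N → ℝ} (hlam : Function.Injective lam) (Φ : Phase N) :
    (modelY lam Φ : ℂ) = (ip lam Φ 0 0 0 - ip lam Φ 1 1 0) *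
      (ip lam Φ 1 1 1 + ip lam Φ 1 2 0 * ip lam Φ 2 1 0 -
        ip lam Φ 0 0 1 - ip lam Φ 0 2 0 * ip lam Φ 2 0 0) -
      2 * ((ip lam Φ 1 0 1 + ip lam Φ 1 2 0 * ip lam Φ 2 0 0) * ip lam Φ 0 1 0 +
        (ip lam Φ 0 1 1 + ip lam Φ 2 1 0 * ip lam Φ 0 2 0) * ip lam Φ 1 0 0) := by
  rw [modelY]
  push_cast
  rw [ofReal_modelX hlam, ofReal_E1 hlam, ofReal_E3 hlam, ofReal_E2_zero hlam, ofReal_E2_one hlam,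
    minorSum_zero, levelDet]
  ring

lemma conj_uFun (lam : Fin N → ℝ) (Φ : Phase N) : conj (uFun lam Φ) =
    (-(2 * Complex.I * ip lam Φ 0 1 1) - 2 * Complex.I * ip lam Φ 2 1 0 * ip lam Φ 0 2 0) /
      (ip lam Φ 0 0 0 - ip lam Φ 1 1 0) := by
  simp only [uFun, map_div₀, map_add, map_sub, map_mul, conj_ip, Complex.conj_I, map_ofNat]
  ring

/-- The identity also holds off the constraint manifold. The terms of `Hy` containing `u` make it
exact, so that the ambient differentials agree as well. -/
lemma Hy_eq {lam : Fin N → ℝ} (hlam : Function.Injective lam) {Φ : Phase N} (hΦ : gap Φ ≠ 0) :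
    Hy lam Φ = modelY lam Φ / gap Φ := by
  have hg : ip lam Φ 0 0 0 - ip lam Φ 1 1 0 ≠ 0 := by
    rw [← gap_eq_ip]
    exact_mod_cast hΦ
  have h : -ip lam Φ 0 0 1 + ip lam Φ 1 1 1
    - (Complex.normSq (ip lam Φ 0 2 0) : ℂ) + (Complex.normSq (ip lam Φ 1 2 0) : ℂ)
    + Complex.I * uFun lam Φ * ip lam Φ 0 1 0
    - Complex.I * conj (uFun lam Φ) * ip lam Φ 1 0 0 = ((modelY lam Φ / gap Φ : ℝ) : ℂ) := by
    rw [normSq_ip, normSq_ip, conj_uFun, uFun, Complex.ofReal_div, ofReal_modelY hlam,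
      gap_eq_ip lam]
    field_simp
    linear_combination (2 * ((ip lam Φ 1 0 1 + ip lam Φ 1 2 0 * ip lam Φ 2 0 0) * ip lam Φ 0 1 0 +
        (ip lam Φ 0 1 1 + ip lam Φ 2 1 0 * ip lam Φ 0 2 0) * ip lam Φ 1 0 0)) * Complex.I_sq
  rw [Hy, h, Complex.ofReal_re]

end Hamiltonians

/-! ### The Hamiltonian `Ht`; smoothness and common models of the three Hamiltonians -/

section HamiltonianT

variable {N : ℕ}

lemma qFun_eq (lam : Fin N → ℝ) {Φ : Phase N}
    (hg : ip lam Φ 0 0 0 - ip lam Φ 1 1 0 ≠ 0) :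
    qFun lam Φ = -(2 * ((ip lam Φ 0 0 0 - ip lam Φ 1 1 0) * (2 * ip lam Φ 1 0 2
      + 2 * ip lam Φ 2 0 0 * ip lam Φ 1 2 1 + 2 * ip lam Φ 1 2 0 * ip lam Φ 2 0 1
      + ip lam Φ 2 0 0 * ip lam Φ 1 2 0 * (2 * ip lam Φ 2 2 0 - ip lam Φ 0 0 0 - ip lam Φ 1 1 0))
      + 2 * (ip lam Φ 1 0 1 + ip lam Φ 1 2 0 * ip lam Φ 2 0 0) *
        (ip lam Φ 2 1 0 * ip lam Φ 1 2 0 - ip lam Φ 2 0 0 * ip lam Φ 0 2 0 +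
          ip lam Φ 1 1 1 - ip lam Φ 0 0 1))) / (ip lam Φ 0 0 0 - ip lam Φ 1 1 0) ^ 2 := by
  have hu : uFun lam Φ = Complex.I * (2 * (ip lam Φ 1 0 1 + ip lam Φ 1 2 0 * ip lam Φ 2 0 0) /
      (ip lam Φ 0 0 0 - ip lam Φ 1 1 0)) := by
    rw [uFun]
    ring
  -- With the sign written as a square of `Complex.I`, the identity becomes polynomial with
  -- `Complex.I` as a free variable.
  have h : ∀ x : ℂ, -x = Complex.I ^ 2 * x := fun x => by rw [Complex.I_sq]; ring
  simp only [qFun, hu, normSq_ip, conj_ip]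
  rw [h]
  field_simp
  ring

lemma ofReal_modelT (lam : Fin N → ℝ) (Φ : Phase N) :
    (modelT lam Φ : ℂ) =
      2 * (E1 lam Φ 0 : ℂ) * (E1 lam Φ 2 + (E2 lam Φ 1 + E2 lam Φ 0 * E3 lam Φ 0) +
      E1 lam Φ 0 * (E3 lam Φ 1 - E2 lam Φ 0 - E1 lam Φ 0 * E3 lam Φ 0) -
      modelX lam Φ * E3 lam Φ 0) + modelX lam Φ ^ 2 -
    4 * E3 lam Φ 0 * (E2 lam Φ 1 + E2 lam Φ 0 * E3 lam Φ 0) -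
    4 * E2 lam Φ 0 * (E3 lam Φ 1 - E2 lam Φ 0 - E1 lam Φ 0 * E3 lam Φ 0) - 4 * E2 lam Φ 2 := by
  rw [modelT]
  push_cast
  rfl

lemma ofReal_remT (lam : Fin N → ℝ) (Φ : Phase N) :
    (remT lam Φ : ℂ) =
      4 * (ip lam Φ 0 1 0 * (ip lam Φ 1 0 1 + ip lam Φ 1 2 0 * ip lam Φ 2 0 0) +
        ip lam Φ 1 0 0 * (ip lam Φ 0 1 1 + ip lam Φ 2 1 0 * ip lam Φ 0 2 0)) ^ 2 +
      4 * (ip lam Φ 0 0 0 - ip lam Φ 1 1 0) ^ 2 *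
        (ip lam Φ 2 0 0 * ip lam Φ 0 2 0 + ip lam Φ 2 1 0 * ip lam Φ 1 2 0) *
        (ip lam Φ 0 1 0 * ip lam Φ 1 0 0) := by
  have hc : constraint N Φ = ip lam Φ 0 1 0 := by
    rw [constraint_eq_wip, ip_eq_wip]
    simp
  rw [remT, constraintSq, hc, remFactor]
  push_cast
  rw [normSq_ip, normSq_ip, normSq_ip, gap_eq_ip lam, Complex.re_eq_add_conj]
  simp only [map_mul, map_add, conj_ip]
  ring

/-- Away from the constraint manifold `Ht` is not a function of the integrals and the gap alone in
this formula; the discrepancy is collected in `remT`, which is of second order in the constraint and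
so does not affect differentials on the manifold. -/
lemma Ht_eq {lam : Fin N → ℝ} (hlam : Function.Injective lam) {Φ : Phase N} (hΦ : gap Φ ≠ 0) :
    Ht lam Φ = modelT lam Φ / gap Φ - modelY lam Φ ^ 2 / gap Φ ^ 3 + remT lam Φ / gap Φ ^ 3 := by
  have hg : ip lam Φ 0 0 0 - ip lam Φ 1 1 0 ≠ 0 := by
    rw [← gap_eq_ip]
    exact_mod_cast hΦ
  have h : 2 * ip lam Φ 0 0 2 - 2 * ip lam Φ 1 1 2
    + 4 * ((ip lam Φ 0 2 0 * ip lam Φ 2 0 1).re : ℂ)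
    - 4 * ((ip lam Φ 1 2 0 * ip lam Φ 2 1 1).re : ℂ)
    + 2 * (ip lam Φ 2 2 0 - ip lam Φ 0 0 0) * ip lam Φ 0 2 0 * ip lam Φ 2 0 0
    - 2 * (ip lam Φ 2 2 0 - ip lam Φ 1 1 0) * ip lam Φ 1 2 0 * ip lam Φ 2 1 0
    + 4 / (ip lam Φ 0 0 0 - ip lam Φ 1 1 0) *
        (Complex.normSq (ip lam Φ 1 0 1 + ip lam Φ 1 2 0 * ip lam Φ 2 0 0) : ℂ)
    - 2 * ((qFun lam Φ * ip lam Φ 0 1 0).re : ℂ) =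
      ((modelT lam Φ / gap Φ - modelY lam Φ ^ 2 / gap Φ ^ 3 + remT lam Φ / gap Φ ^ 3 : ℝ) : ℂ) := by
    push_cast
    rw [ofReal_modelT, ofReal_modelX hlam, ofReal_modelY hlam, ofReal_remT, gap_eq_ip lam,
      qFun_eq lam hg, ofReal_E1 hlam, ofReal_E1 hlam, ofReal_E3 hlam, ofReal_E3 hlam,
      ofReal_E2_zero hlam, ofReal_E2_one hlam, ofReal_E2_two hlam, minorSum_zero, minorSum_one,
      minorSum_two, Complex.normSq_eq_conj_mul_self]
    simp only [Complex.re_eq_add_conj, map_mul, map_add, map_sub, map_neg, map_div₀, map_pow,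
      conj_ip, map_ofNat, levelDet]
    -- Writing ⟨Φ₁,Φ₁⟩ = δ + ⟨Φ₂,Φ₂⟩ makes the denominator an independent variable, so that the
    -- cleared identity is polynomial.
    generalize hδ : ip lam Φ 0 0 0 - ip lam Φ 1 1 0 = δ at hg ⊢
    rw [sub_eq_iff_eq_add] at hδ
    rw [hδ]
    field_simp
    ring
  rw [Ht, h, Complex.ofReal_re]

@[fun_prop]
lemma contDiff_ip {n : WithTop ℕ∞} (lam : Fin N → ℝ) (i j : Fin 3) (m : ℕ) :
    ContDiff ℝ n fun Φ => ip lam Φ i j m := by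
  simp only [ip_eq_wip]
  fun_prop

lemma commonIntegral_modelX {lam : Fin N → ℝ} (hlam : Function.Injective lam) :
    CommonIntegral lam (modelX lam) :=
  ((CommonIntegral.E1 hlam 1).neg.sub (.E2 hlam 0)).sub ((CommonIntegral.E1 hlam 0).mul
    (.E3 hlam 0))

lemma commonIntegral_modelY {lam : Fin N → ℝ} (hlam : Function.Injective lam) :
    CommonIntegral lam (modelY lam) :=
  (((CommonIntegral.E2 hlam 1).add ((CommonIntegral.E2 hlam 0).mul (.E3 hlam 0))).const_mul 2).add
    ((CommonIntegral.E1 hlam 0).mul (commonIntegral_modelX hlam))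

lemma commonIntegral_modelT {lam : Fin N → ℝ} (hlam : Function.Injective lam) :
    CommonIntegral lam (modelT lam) := by
  have s := CommonIntegral.E1 hlam 0
  have r := CommonIntegral.E3 hlam 0
  have π := CommonIntegral.E2 hlam 0
  have x := commonIntegral_modelX hlam
  have κ := (CommonIntegral.E2 hlam 1).add (π.mul r)
  have ρ := ((CommonIntegral.E3 hlam 1).sub π).sub (s.mul r)
  exact (((((s.const_mul 2).mul ((((CommonIntegral.E1 hlam 2).add κ).add (s.mul ρ)).sub
    (x.mul r))).add (x.pow 2)).sub ((r.const_mul 4).mul κ)).sub ((π.const_mul 4).mul ρ)).sub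
    ((CommonIntegral.E2 hlam 2).const_mul 4)

lemma fderiv_mul_eq_zero {F G : Phase N → ℝ} {q : Phase N} (hF : DifferentiableAt ℝ F q)
    (hG : DifferentiableAt ℝ G q) (h : F q = 0) (hd : G q = 0 ∨ fderiv ℝ F q = 0) :
    fderiv ℝ (fun Φ => G Φ * F Φ) q = 0 := by
  rw [fderiv_fun_mul hG hF, h, zero_smul, add_zero]
  rcases hd with hd | hd <;> simp [hd]

lemma contDiff_remT {n : WithTop ℕ∞} (lam : Fin N → ℝ) : ContDiff ℝ n (remT lam) := by
  have h₀ : ContDiff ℝ n (remFactor lam) := by unfold remFactor; fun_prop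
  have h₁ : ContDiff ℝ n (constraint N) := contDiff_constraint
  have h₂ : ContDiff ℝ n fun Φ => (constraint N Φ * remFactor lam Φ).re :=
    contDiff_re.comp (h₁.mul h₀)
  have h₃ : ContDiff ℝ n (constraintSq : Phase N → ℝ) := contDiff_constraintSq
  have h₄ : ∀ i, ContDiff ℝ n fun Φ : Phase N => Complex.normSq (ip lam Φ 2 i 0) := fun i =>
    contDiff_normSq.comp (contDiff_ip lam 2 i 0)
  exact (contDiff_const.mul (h₂.mul h₂)).add
    (((contDiff_const.mul (contDiff_gap.pow 2)).mul ((h₄ 0).add (h₄ 1))).mul h₃)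

lemma differentiable_remT (lam : Fin N → ℝ) : Differentiable ℝ (remT lam) :=
  (contDiff_remT (n := 1) lam).differentiable (by simp)

/-- One summand is the square of a function vanishing at `q`; the other contains `constraintSq`,
whose value and differential both vanish there. -/
lemma fderiv_remT (lam : Fin N → ℝ) {q : Phase N} (hq : constraint N q = 0) :
    fderiv ℝ (remT lam) q = 0 := by
  have h₀ : ContDiff ℝ 1 (remFactor lam) := by unfold remFactor; fun_prop
  have h₁ : ContDiff ℝ 1 (constraint N) := contDiff_constraint
  have h₂ : ContDiff ℝ 1 fun Φ => (constraint N Φ * remFactor lam Φ).re :=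
    contDiff_re.comp (h₁.mul h₀)
  have h₃ : ContDiff ℝ 1 (constraintSq : Phase N → ℝ) := contDiff_constraintSq
  have h₄ : ∀ i, ContDiff ℝ 1 fun Φ : Phase N => Complex.normSq (ip lam Φ 2 i 0) := fun i =>
    contDiff_normSq.comp (contDiff_ip lam 2 i 0)
  have d₂ := h₂.differentiable (by simp)
  have d₃ := h₃.differentiable (by simp)
  have e₁ : fderiv ℝ (fun Φ => (constraint N Φ * remFactor lam Φ).re *
      (constraint N Φ * remFactor lam Φ).re) q = 0 :=
    fderiv_mul_eq_zero (d₂ q) (d₂ q) (by simp [hq]) (Or.inl (by simp [hq]))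
  have e₂ : fderiv ℝ (constraintSq : Phase N → ℝ) q = 0 := by
    ext v
    rw [fderiv_constraintSq, ← constraint_eq_wip, hq]
    simp
  have h₇ : ContDiff ℝ 1 fun Φ : Phase N => 4 * gap Φ ^ 2 *
      (Complex.normSq (ip lam Φ 2 0 0) + Complex.normSq (ip lam Φ 2 1 0)) :=
    (contDiff_const.mul (contDiff_gap.pow 2)).mul ((h₄ 0).add (h₄ 1))
  have d₇ := h₇.differentiable (by simp)
  have e₃ := fderiv_mul_eq_zero (d₃ q) (d₇ q) (by simp [constraintSq, hq]) (Or.inr e₂)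
  unfold remT
  rw [fderiv_fun_add (((d₂.fun_mul d₂).const_mul 16) q) ((d₇.fun_mul d₃) q), e₃,
    fderiv_const_mul ((d₂.fun_mul d₂) q), e₁]
  simp

lemma differentiable_gap : Differentiable ℝ (gap : Phase N → ℝ) :=
  (contDiff_gap (n := 1)).differentiable (by simp)

/-- Near a level of the gap, its inverse powers may be replaced by their linearizations. -/
lemma hasFDerivAt_div_gap_pow {K : Phase N → ℝ} (hK : Differentiable ℝ K) (n : ℕ) {q : Phase N}
    (hq : gap q ≠ 0) :
    HasFDerivAt (fun Φ => K Φ / gap Φ ^ n)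
      (fderiv ℝ (fun Φ => K Φ * ((n + 1) / gap q ^ n - n / gap q ^ (n + 1) * gap Φ)) q) q := by
  have h₁ : HasFDerivAt (fun Φ : Phase N => (gap Φ ^ n)⁻¹)
      ((-(n / gap q ^ (n + 1))) • fderiv ℝ gap q) q := by
    have h := ((hasDerivAt_pow n (gap q)).inv (pow_ne_zero n hq)).comp_hasFDerivAt q
      (differentiable_gap q).hasFDerivAt
    have e : -((n : ℝ) / gap q ^ (n + 1)) = -(n * gap q ^ (n - 1)) / (gap q ^ n) ^ 2 := by
      rcases n with _ | n
      · simp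
      · rw [Nat.add_sub_cancel]
        field_simp
        ring
    rw [e]
    exact h
  have h₂ : HasFDerivAt (fun Φ : Phase N => (n + 1) / gap q ^ n - n / gap q ^ (n + 1) * gap Φ)
      ((-(n / gap q ^ (n + 1))) • fderiv ℝ gap q) q := by
    have h := ((differentiable_gap q).hasFDerivAt.const_mul
      ((n : ℝ) / gap q ^ (n + 1))).const_sub ((n + 1) / gap q ^ n)
    rwa [← neg_smul] at h
  -- The first-order Taylor polynomial of x⁻ⁿ at the gap of `q` has the same value there; the slopes
  -- were matched above.
  have e : (gap q ^ n)⁻¹ = (n + 1) / gap q ^ n - n / gap q ^ (n + 1) * gap q := by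
    field_simp
    ring
  have h₃ := (hK q).hasFDerivAt.fun_mul h₂
  rw [h₃.fderiv, ← e]
  simpa only [div_eq_mul_inv] using (hK q).hasFDerivAt.fun_mul h₁

lemma eventually_gap_ne_zero {q : Phase N} (hq : gap q ≠ 0) : ∀ᶠ Φ in nhds q, gap Φ ≠ 0 :=
  (differentiable_gap q).continuousAt.eventually_ne hq

lemma commonIntegral_linearized {lam : Fin N → ℝ} (hlam : Function.Injective lam)
    {K : Phase N → ℝ} (hK : CommonIntegral lam K) (a b : ℝ) :
    CommonIntegral lam fun Φ => K Φ * (a - b * gap Φ) :=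
  hK.mul ((CommonIntegral.const a).sub ((CommonIntegral.gap hlam).const_mul b))

lemma hasCommonModel_Hx {lam : Fin N → ℝ} (hlam : Function.Injective lam) :
    HasCommonModel lam (Hx lam) := by
  rw [show Hx lam = modelX lam from funext (Hx_eq hlam)]
  exact .of_commonIntegral (commonIntegral_modelX hlam)

lemma hasCommonModel_Hy {lam : Fin N → ℝ} (hlam : Function.Injective lam) :
    HasCommonModel lam (Hy lam) := fun p _ => by
  have hY := commonIntegral_modelY hlam
  have c := commonIntegral_linearized hlam hY (((1 : ℕ) + 1) / gap p ^ 1)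
    ((1 : ℕ) / gap p ^ (1 + 1))
  refine ⟨_, c, fun q hq hgap => ?_⟩
  have hq' := (mem_constraintManifold.1 hq).2
  have h := hasFDerivAt_div_gap_pow hY.differentiable 1 hq'
  rw [hgap] at h
  refine (h.congr_of_eventuallyEq ?_).fderiv
  filter_upwards [eventually_gap_ne_zero hq'] with Φ hΦ
  rw [Hy_eq hlam hΦ, pow_one]

lemma hasCommonModel_Ht {lam : Fin N → ℝ} (hlam : Function.Injective lam) :
    HasCommonModel lam (Ht lam) := fun p _ => by
  have hY := commonIntegral_modelY hlam
  have hT := commonIntegral_modelT hlam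
  have c₁ := commonIntegral_linearized hlam hT (((1 : ℕ) + 1) / gap p ^ 1)
    ((1 : ℕ) / gap p ^ (1 + 1))
  have c₂ := commonIntegral_linearized hlam (hY.pow 2) (((3 : ℕ) + 1) / gap p ^ 3)
    ((3 : ℕ) / gap p ^ (3 + 1))
  refine ⟨_, c₁.sub c₂, fun q hq hgap => ?_⟩
  have hq' := mem_constraintManifold.1 hq
  have h₁ := hasFDerivAt_div_gap_pow hT.differentiable 1 hq'.2
  have h₂ := hasFDerivAt_div_gap_pow (hY.pow 2).differentiable 3 hq'.2
  -- Value and differential of `remT` vanish at `q`, so the denominator plays no role.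
  have h₃ : HasFDerivAt (fun Φ => remT lam Φ / gap Φ ^ 3) (0 : Phase N →L[ℝ] ℝ) q := by
    have h := hasFDerivAt_div_gap_pow (differentiable_remT lam) 3 hq'.2
    rw [fderiv_fun_mul (differentiable_remT lam q) (by
      exact ((differentiable_gap q).const_mul _).const_sub _), fderiv_remT lam hq'.1] at h
    simpa [remT, constraintSq, hq'.1] using h
  rw [hgap] at h₁ h₂
  rw [fderiv_fun_sub (c₁.differentiable q) (c₂.differentiable q), ← add_zero (_ - _)]
  refine (((h₁.fun_sub h₂).fun_add h₃).congr_of_eventuallyEq ?_).fderiv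
  filter_upwards [eventually_gap_ne_zero hq'.2] with Φ hΦ
  rw [Ht_eq hlam hΦ, pow_one]

lemma contDiffAt_Hx {lam : Fin N → ℝ} (hlam : Function.Injective lam) (p : Phase N) :
    ContDiffAt ℝ ∞ (Hx lam) p := by
  rw [show Hx lam = modelX lam from funext (Hx_eq hlam)]
  exact (commonIntegral_modelX hlam).contDiff.contDiffAt

lemma contDiffAt_div_gap_pow {K : Phase N → ℝ} (hK : ContDiff ℝ ∞ K) (n : ℕ) {q : Phase N}
    (hq : gap q ≠ 0) : ContDiffAt ℝ ∞ (fun Φ => K Φ / gap Φ ^ n) q :=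
  hK.contDiffAt.div (contDiff_gap.pow n).contDiffAt (pow_ne_zero n hq)

lemma contDiffAt_Hy {lam : Fin N → ℝ} (hlam : Function.Injective lam) {p : Phase N}
    (hp : gap p ≠ 0) : ContDiffAt ℝ ∞ (Hy lam) p := by
  refine (contDiffAt_div_gap_pow (commonIntegral_modelY hlam).contDiff 1 hp).congr_of_eventuallyEq ?_
  filter_upwards [eventually_gap_ne_zero hp] with Φ hΦ
  rw [Hy_eq hlam hΦ, pow_one]

lemma contDiffAt_Ht {lam : Fin N → ℝ} (hlam : Function.Injective lam) {p : Phase N}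
    (hp : gap p ≠ 0) : ContDiffAt ℝ ∞ (Ht lam) p := by
  have h₀ : ContDiff ℝ ∞ (remT lam) := contDiff_remT lam
  refine (((contDiffAt_div_gap_pow (commonIntegral_modelT hlam).contDiff 1 hp).sub
    (contDiffAt_div_gap_pow ((commonIntegral_modelY hlam).pow 2).contDiff 3 hp)).add
    (contDiffAt_div_gap_pow h₀ 3 hp)).congr_of_eventuallyEq ?_
  filter_upwards [eventually_gap_ne_zero hp] with Φ hΦ
  rw [Ht_eq hlam hΦ, pow_one]

end HamiltonianT

/-! ### Independence of the residues at a base point -/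

section BasePoint

variable {N : ℕ}

lemma HasDirDeriv.sub {F G : Phase N → ℂ} {p : Phase N} {D D' : Phase N → ℂ}
    (hF : HasDirDeriv F p D) (hG : HasDirDeriv G p D') :
    HasDirDeriv (fun Φ => F Φ - G Φ) p fun v => D v - D' v :=
  ⟨hF.1.sub hG.1, fun v => by
    rw [fderiv_fun_sub hF.1 hG.1, sub_apply, hF.2, hG.2]⟩

lemma HasDirDeriv.conj_comp {F : Phase N → ℂ} {p : Phase N} {D : Phase N → ℂ}
    (hF : HasDirDeriv F p D) : HasDirDeriv (fun Φ => conj (F Φ)) p fun v => conj (D v) := by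
  have h := ((Complex.conjCLE : ℂ →L[ℝ] ℂ).hasFDerivAt (x := F p)).comp p hF.1.hasFDerivAt
  refine ⟨h.differentiableAt, fun v => ?_⟩
  have h' : fderiv ℝ (fun Φ => conj (F Φ)) p = (Complex.conjCLE : ℂ →L[ℝ] ℂ).comp (fderiv ℝ F p) :=
    h.fderiv
  rw [h']
  exact congrArg conj (hF.2 v)

lemma hasDirDeriv_coord (j : Fin 3) (k : Fin N) (p : Phase N) :
    HasDirDeriv (fun Φ => Φ j k) p fun v => v j k :=
  ⟨(coordCLM j k).differentiableAt, fun v => by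
    rw [show (fun Φ : Phase N => Φ j k) = coordCLM j k from rfl, ContinuousLinearMap.fderiv,
      coordCLM_apply]⟩

lemma HasDirDeriv.fderiv_normSq {F : Phase N → ℂ} {p : Phase N} {D : Phase N → ℂ}
    (hF : HasDirDeriv F p D) (v : Phase N) :
    fderiv ℝ (fun Φ => Complex.normSq (F Φ)) p v = 2 * (conj (F p) * D v).re := by
  have e : (fun Φ => Complex.normSq (F Φ)) = fun Φ => (conj (F Φ) * F Φ).re := by
    funext Φ
    rw [← Complex.normSq_eq_conj_mul_self, Complex.ofReal_re]
  rw [e, (hF.conj_comp.mul hF).fderiv_re]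
  simp
  ring

lemma hasDirDeriv_wedge (i j : Fin 3) (k l : Fin N) (p : Phase N) :
    HasDirDeriv (fun Φ => Φ i k * Φ j l - Φ j k * Φ i l) p fun v =>
      v i k * p j l + p i k * v j l - (v j k * p i l + p j k * v i l) :=
  ((hasDirDeriv_coord i k p).mul (hasDirDeriv_coord j l p)).sub
    ((hasDirDeriv_coord j k p).mul (hasDirDeriv_coord i l p))

lemma fderiv_wedgeSq (i j : Fin 3) (k l : Fin N) (p v : Phase N) :
    fderiv ℝ (wedgeSq i j k l) p v = 2 * (conj (p i k * p j l - p j k * p i l) *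
      (v i k * p j l + p i k * v j l - (v j k * p i l + p j k * v i l))).re :=
  (hasDirDeriv_wedge i j k l p).fderiv_normSq v

lemma contDiff_wedgeSq {n : WithTop ℕ∞} (i j : Fin 3) (k l : Fin N) :
    ContDiff ℝ n (wedgeSq i j k l) :=
  contDiff_normSq.comp (by fun_prop : ContDiff ℝ n fun Φ : Phase N => Φ i k * Φ j l - Φ j k * Φ i l)

lemma fderiv_pairRes (lam : Fin N → ℝ) (i j : Fin 3) (k : Fin N) (p v : Phase N) :
    fderiv ℝ (pairRes lam i j k) p v =
      ∑ l, fderiv ℝ (wedgeSq i j k l) p v / (lam k - lam l) := by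
  have hd : ∀ l, DifferentiableAt ℝ (wedgeSq i j k l) p := fun l =>
    (contDiff_wedgeSq (n := 1) i j k l).differentiable (by simp) p
  unfold pairRes
  simp only [div_eq_mul_inv]
  rw [fderiv_fun_sum fun l _ => (hd l).mul_const _, sum_apply]
  refine Finset.sum_congr rfl fun l _ => ?_
  rw [fderiv_mul_const (hd l), smul_apply, smul_eq_mul, mul_comm]

lemma contDiff_siteDet {n : WithTop ℕ∞} (k l m : Fin N) :
    ContDiff ℝ n fun Φ : Phase N => siteDet k l m Φ := by
  unfold siteDet
  fun_prop

/-- A squared modulus has zero differential where the function vanishes. -/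
lemma fderiv_tripleRes_eq_zero (lam : Fin N → ℝ) (k : Fin N) {p : Phase N}
    (h : ∀ l m, siteDet k l m p = 0) : fderiv ℝ (tripleRes lam k) p = 0 := by
  have hd : ∀ l m, DifferentiableAt ℝ (fun Φ => Complex.normSq (siteDet k l m Φ)) p := fun l m =>
    (contDiff_normSq.comp (contDiff_siteDet (n := 1) k l m)).differentiable (by simp) p
  have h₀ : ∀ l m, fderiv ℝ (fun Φ => Complex.normSq (siteDet k l m Φ)) p = 0 := fun l m => by
    ext v
    have hs : HasDirDeriv (fun Φ => siteDet k l m Φ) p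
        fun v => fderiv ℝ (fun Φ => siteDet k l m Φ) p v :=
      ⟨(contDiff_siteDet (n := 1) k l m).differentiable (by simp) p, fun _ => rfl⟩
    rw [hs.fderiv_normSq, h]
    simp
  have hd' : ∀ l, DifferentiableAt ℝ (fun Φ => ∑ m, Complex.normSq (siteDet k l m Φ) *
      ((lam k - lam l) * (lam k - lam m))⁻¹) p := fun l =>
    DifferentiableAt.fun_sum fun m _ => (hd l m).mul_const _
  unfold tripleRes
  simp only [div_eq_mul_inv]
  rw [fderiv_const_mul (DifferentiableAt.fun_sum fun l _ => hd' l), fderiv_fun_sum fun l _ => hd' l,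
    Finset.sum_eq_zero, smul_zero]
  intro l _
  rw [fderiv_fun_sum fun m _ => (hd l m).mul_const _]
  refine Finset.sum_eq_zero fun m _ => ?_
  rw [fderiv_mul_const (hd l m), h₀, smul_zero]

/-- The configuration with value `(1, 1, 0)` at all sites but `a`, where it is `(r, s, 1)`. -/
def basePoint (a : Fin N) (r s : ℝ) : Phase N :=
  ![fun k => if k = a then (r : ℂ) else 1, fun k => if k = a then (s : ℂ) else 1,
    fun k => if k = a then 1 else 0]

variable (a : Fin N) (r s : ℝ)

/-- Only two different site vectors occur, so any three are linearly dependent. -/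
lemma siteDet_basePoint (k l m : Fin N) : siteDet k l m (basePoint a r s) = 0 := by
  by_cases hk : k = a <;> by_cases hl : l = a <;> by_cases hm : m = a <;>
    (simp [siteDet, basePoint, hk, hl, hm]; try ring)

/-- Two sites other than `a` carry the same vector, so their minor vanishes and its square
contributes nothing to first order. Only the pairing with `a` remains. -/
lemma fderiv_pairRes_basePoint (lam : Fin N → ℝ) (i j : Fin 3) {k : Fin N} (hk : k ≠ a)
    (v : Phase N) :
    fderiv ℝ (pairRes lam i j k) (basePoint a r s) v =
      fderiv ℝ (wedgeSq i j k a) (basePoint a r s) v / (lam k - lam a) := by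
  rw [fderiv_pairRes, Finset.sum_eq_single a]
  · intro l _ hl
    have : ∀ i, basePoint a r s i l = basePoint a r s i k := fun i => by
      fin_cases i <;> simp [basePoint, hk, hl]
    rw [fderiv_wedgeSq, this, this, mul_comm (basePoint a r s j k), sub_self]
    simp
  · simp

lemma fderiv_wedgeSq_basePoint_zero_one {k : Fin N} (hk : k ≠ a) (v : Phase N) :
    fderiv ℝ (wedgeSq 0 1 k a) (basePoint a r s) v =
      2 * (s - r) * ((v 0 k).re * s + (v 1 a).re - (v 1 k).re * r - (v 0 a).re) := by
  rw [fderiv_wedgeSq]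
  simp [basePoint, hk]
  ring

lemma fderiv_wedgeSq_basePoint_zero_two {k : Fin N} (hk : k ≠ a) (v : Phase N) :
    fderiv ℝ (wedgeSq 0 2 k a) (basePoint a r s) v =
      2 * ((v 0 k).re + (v 2 a).re - (v 2 k).re * r) := by
  rw [fderiv_wedgeSq]
  simp [basePoint, hk]

lemma fderiv_wedgeSq_basePoint_one_two {k : Fin N} (hk : k ≠ a) (v : Phase N) :
    fderiv ℝ (wedgeSq 1 2 k a) (basePoint a r s) v =
      2 * ((v 1 k).re + (v 2 a).re - (v 2 k).re * s) := by
  rw [fderiv_wedgeSq]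
  simp [basePoint, hk]

lemma differentiable_pairRes (lam : Fin N → ℝ) (i j : Fin 3) (k : Fin N) :
    Differentiable ℝ (pairRes lam i j k) :=
  (contDiff_pairRes (n := 1) lam i j k).differentiable (by simp)

lemma differentiable_minorRes (lam : Fin N → ℝ) (k : Fin N) :
    Differentiable ℝ (minorRes lam k) :=
  ((differentiable_pairRes lam 0 1 k).add (differentiable_pairRes lam 0 2 k)).add
    (differentiable_pairRes lam 1 2 k)

lemma fderiv_siteNormSq (i : Fin 3) (k : Fin N) (p v : Phase N) :
    fderiv ℝ (fun Φ : Phase N => Complex.normSq (Φ i k)) p v = 2 * (conj (p i k) * v i k).re :=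
  (hasDirDeriv_coord i k p).fderiv_normSq v

lemma differentiable_siteNormSq (i : Fin 3) (k : Fin N) :
    Differentiable ℝ fun Φ : Phase N => Complex.normSq (Φ i k) :=
  (contDiff_siteNormSq (n := 1) i k).differentiable (by simp)

lemma fderiv_minorRes_basePoint (lam : Fin N → ℝ) {k : Fin N} (hk : k ≠ a) (v : Phase N) :
    fderiv ℝ (minorRes lam k) (basePoint a r s) v =
      (2 * (s - r) * ((v 0 k).re * s + (v 1 a).re - (v 1 k).re * r - (v 0 a).re)
        + 2 * ((v 0 k).re + (v 2 a).re - (v 2 k).re * r)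
        + 2 * ((v 1 k).re + (v 2 a).re - (v 2 k).re * s)) / (lam k - lam a) := by
  have d := differentiable_pairRes (N := N) lam
  unfold minorRes
  rw [fderiv_fun_add ((d 0 1 k _).fun_add (d 0 2 k _)) (d 1 2 k _),
    fderiv_fun_add (d 0 1 k _) (d 0 2 k _), add_apply, add_apply, fderiv_pairRes_basePoint a r s lam _ _ hk,
    fderiv_pairRes_basePoint a r s lam _ _ hk, fderiv_pairRes_basePoint a r s lam _ _ hk,
    fderiv_wedgeSq_basePoint_zero_one a r s hk, fderiv_wedgeSq_basePoint_zero_two a r s hk,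
    fderiv_wedgeSq_basePoint_one_two a r s hk, add_div, add_div]

lemma fderiv_res1_basePoint (lam : Fin N → ℝ) {k : Fin N} (hk : k ≠ a) (v : Phase N) :
    fderiv ℝ (res1 lam k) (basePoint a r s) v = 2 * (v 0 k).re + 2 * (v 1 k).re
      - fderiv ℝ (minorRes lam k) (basePoint a r s) v := by
  have d := differentiable_siteNormSq (N := N)
  unfold res1
  rw [fderiv_fun_sub ((d 0 k _).fun_add (d 1 k _)) (differentiable_minorRes lam k _),
    fderiv_fun_add (d 0 k _) (d 1 k _), sub_apply, add_apply, fderiv_siteNormSq, fderiv_siteNormSq]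
  simp [basePoint, hk]

lemma fderiv_res3_basePoint (lam : Fin N → ℝ) {k : Fin N} (hk : k ≠ a) (v : Phase N) :
    fderiv ℝ (res3 lam k) (basePoint a r s) v =
      fderiv ℝ (minorRes lam k) (basePoint a r s) v := by
  unfold res3
  rw [fderiv_fun_add (differentiable_siteNormSq 2 k _) (differentiable_minorRes lam k _), add_apply,
    fderiv_siteNormSq]
  simp [basePoint, hk]

lemma fderiv_res2_basePoint (lam : Fin N → ℝ) {k : Fin N} (hk : k ≠ a) (v : Phase N) :
    fderiv ℝ (res2 lam k) (basePoint a r s) v =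
      2 * (s - r) * ((v 0 k).re * s + (v 1 a).re - (v 1 k).re * r - (v 0 a).re)
        / (lam k - lam a) := by
  unfold res2
  rw [fderiv_fun_sub (differentiable_pairRes lam 0 1 k _)
    ((contDiff_tripleRes (n := 1) lam k).differentiable (by simp) _),
    fderiv_tripleRes_eq_zero lam k fun l m => siteDet_basePoint a r s k l m, sub_zero,
    fderiv_pairRes_basePoint a r s lam _ _ hk, fderiv_wedgeSq_basePoint_zero_one a r s hk]

lemma sum_res1 {lam : Fin N → ℝ} (hlam : Function.Injective lam) (Φ : Phase N) :
    ∑ k, res1 lam k Φ = sqNorm 0 Φ + sqNorm 1 Φ := by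
  have h := E1_eq hlam Φ 0
  simp only [pow_zero, one_mul] at h
  rw [← h, E1, minorSum, ip_eq_wip, ip_eq_wip]
  simp [wip_one_self]

lemma sum_res3 {lam : Fin N → ℝ} (hlam : Function.Injective lam) (Φ : Phase N) :
    ∑ k, res3 lam k Φ = sqNorm 2 Φ := by
  have h := E3_eq hlam Φ 0
  simp only [pow_zero, one_mul] at h
  rw [← h, E3, minorSum, ip_eq_wip]
  simp [wip_one_self]

end BasePoint

/-! ### Independence of the integrals at a base point -/

section Independence

variable {N : ℕ}

lemma sum_fderiv_res1 {lam : Fin N → ℝ} (hlam : Function.Injective lam) (p v : Phase N) :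
    ∑ k, fderiv ℝ (res1 lam k) p v = fderiv ℝ (sqNorm 0) p v + fderiv ℝ (sqNorm 1) p v := by
  have hs : ∀ i, DifferentiableAt ℝ (sqNorm i : Phase N → ℝ) p := fun i =>
    (contDiff_sqNorm (n := 1) i).differentiable (by simp) p
  have h := fderiv_fun_sum (u := Finset.univ) fun k (_ : k ∈ Finset.univ) =>
    differentiable_res lam 0 k p
  have e : (fun Φ => ∑ k, res lam 0 k Φ) = fun Φ => sqNorm 0 Φ + sqNorm 1 Φ :=
    funext (sum_res1 hlam)
  rw [e, fderiv_fun_add (hs 0) (hs 1)] at h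
  rw [← add_apply, h, sum_apply]
  rfl

lemma sum_fderiv_res2 {lam : Fin N → ℝ} (hlam : Function.Injective lam) (p v : Phase N) :
    ∑ k, fderiv ℝ (res2 lam k) p v = 0 := by
  have h := fderiv_fun_sum (u := Finset.univ) fun k (_ : k ∈ Finset.univ) =>
    differentiable_res lam 1 k p
  have e : (fun Φ => ∑ k, res lam 1 k Φ) = fun _ => 0 := funext (sum_res2 hlam)
  rw [e, fderiv_fun_const] at h
  have h' := congrArg (fun ℓ => ℓ v) h
  simp only [sum_apply] at h'
  exact h'.symm

lemma sum_fderiv_res3 {lam : Fin N → ℝ} (hlam : Function.Injective lam) (p v : Phase N) :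
    ∑ k, fderiv ℝ (res3 lam k) p v = fderiv ℝ (sqNorm 2) p v := by
  have h := fderiv_fun_sum (u := Finset.univ) fun k (_ : k ∈ Finset.univ) =>
    differentiable_res lam 2 k p
  have e : (fun Φ => ∑ k, res lam 2 k Φ) = sqNorm 2 := funext (sum_res3 hlam)
  rw [e] at h
  rw [h, sum_apply]
  rfl

lemma fderiv_sqNorm_single (i j : Fin 3) (k : Fin N) (p : Phase N) :
    fderiv ℝ (sqNorm i) p (Pi.single j (Pi.single k 1)) = if i = j then 2 * (p i k).re else 0 := by
  rw [fderiv_sqNorm]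
  split_ifs with h
  · subst h
    rw [dwip, Finset.sum_eq_single k]
    · simp
      ring
    · intro l _ hl
      simp [hl]
    · simp
  · simp [dwip, h]

/-- The residues at `a` are eliminated through the totals: ⟨Φ₁,Φ₁⟩ + ⟨Φ₂,Φ₂⟩, zero and ⟨Φ₃,Φ₃⟩ for
the three families. Only the simple differentials at the other sites have to be computed. -/
lemma sum_residue_eq {lam : Fin N → ℝ} (hlam : Function.Injective lam) (a : Fin N)
    (A B C : Fin N → ℝ) (p v : Phase N) :
    ∑ k, (A k * fderiv ℝ (res1 lam k) p v + B k * fderiv ℝ (res2 lam k) p v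
        + C k * fderiv ℝ (res3 lam k) p v) =
      A a * (fderiv ℝ (sqNorm 0) p v + fderiv ℝ (sqNorm 1) p v) + C a * fderiv ℝ (sqNorm 2) p v
      + ∑ k, ((A k - A a) * fderiv ℝ (res1 lam k) p v + (B k - B a) * fderiv ℝ (res2 lam k) p v
        + (C k - C a) * fderiv ℝ (res3 lam k) p v) := by
  rw [← sum_fderiv_res1 hlam, ← sum_fderiv_res3 hlam, ← add_zero (A a * _ + _),
    ← mul_zero (B a), ← sum_fderiv_res2 hlam p v]
  simp only [Finset.mul_sum, ← Finset.sum_add_distrib]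
  exact Finset.sum_congr rfl fun k _ => by ring

/-- A relation between the differentials of the residues at a base point is a multiple of
the relation that the residues `res2` sum to zero. -/
lemma residue_relation_basePoint {lam : Fin N → ℝ} (hlam : Function.Injective lam) (a : Fin N)
    {r s : ℝ} (hadd : r + s ≠ 0) (hsub : s - r ≠ 0) {A B C : Fin N → ℝ}
    (h : ∀ v, ∑ k, (A k * fderiv ℝ (res1 lam k) (basePoint a r s) v
      + B k * fderiv ℝ (res2 lam k) (basePoint a r s) v
      + C k * fderiv ℝ (res3 lam k) (basePoint a r s) v) = 0) :
    (∀ k, A k = 0) ∧ (∀ k, B k = B a) ∧ ∀ k, C k = 0 := by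
  have hA : A a = 0 := by
    -- This direction leaves all residues at the other sites unchanged to first order, so only the
    -- term `A a * (2 * r + 2 * s)` is left.
    have h₁ := h (Pi.single 0 (Pi.single a 1) + Pi.single 1 (Pi.single a 1))
    rw [sum_residue_eq hlam a, Finset.sum_eq_zero] at h₁
    · simp only [map_add, fderiv_sqNorm_single] at h₁
      simp [basePoint] at h₁
      rcases h₁ with h₁ | h₁
      · exact h₁
      · exact absurd (by linarith) hadd
    · intro k _
      rcases eq_or_ne k a with rfl | hk
      · simp
      · rw [fderiv_res1_basePoint a r s lam hk, fderiv_res2_basePoint a r s lam hk,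
          fderiv_res3_basePoint a r s lam hk, fderiv_minorRes_basePoint a r s lam hk]
        simp [hk]
  have hsite : ∀ k, k ≠ a → ∀ j,
      (A k - A a) * fderiv ℝ (res1 lam k) (basePoint a r s) (Pi.single j (Pi.single k 1))
      + (B k - B a) * fderiv ℝ (res2 lam k) (basePoint a r s) (Pi.single j (Pi.single k 1))
      + (C k - C a) * fderiv ℝ (res3 lam k) (basePoint a r s) (Pi.single j (Pi.single k 1)) = 0 := by
    intro k hk j
    have h₁ := h (Pi.single j (Pi.single k 1))
    rw [sum_residue_eq hlam a, hA, zero_mul, zero_add, Finset.sum_eq_single k] at h₁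
    · simpa [fderiv_sqNorm_single, basePoint, hk, hA] using h₁
    · intro l _ hl
      rcases eq_or_ne l a with rfl | hla
      · simp [hA]
      · have : ∀ i, (Pi.single j (Pi.single k (1 : ℂ)) : Phase N) i l = 0 := fun i => by
          rcases eq_or_ne i j with rfl | hij
          · simp [hl]
          · simp [hij]
        have h' : ∀ i, (Pi.single j (Pi.single k (1 : ℂ)) : Phase N) i a = 0 := fun i => by
          rcases eq_or_ne i j with rfl | hij
          · simp [hk.symm]
          · simp [hij]
        rw [fderiv_res1_basePoint a r s lam hla, fderiv_res2_basePoint a r s lam hla,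
          fderiv_res3_basePoint a r s lam hla, fderiv_minorRes_basePoint a r s lam hla]
        simp [this, h']
    · simp
  have hdiff : ∀ k, A k = A a ∧ B k = B a ∧ C k = C a := by
    intro k
    rcases eq_or_ne k a with rfl | hk
    · simp
    have hδ : lam k - lam a ≠ 0 := sub_ne_zero.2 fun e => hk (hlam e)
    have h₀ := hsite k hk 0
    have h₁ := hsite k hk 1
    have h₂ := hsite k hk 2
    rw [fderiv_res1_basePoint a r s lam hk, fderiv_res2_basePoint a r s lam hk,
      fderiv_res3_basePoint a r s lam hk, fderiv_minorRes_basePoint a r s lam hk] at h₀ h₁ h₂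
    simp [hk.symm] at h₀ h₁ h₂
    field_simp at h₀ h₁ h₂
    -- The three coordinate directions at site `k` give a 3×3 linear system for the differences of
    -- coefficients. The third equation identifies those of `A` and `C`; the difference of the other
    -- two then removes that of `B`.
    have e₂ : (r + s) * ((A k - A a) - (C k - C a)) = 0 := by linarith
    have e₂' := (mul_eq_zero.1 e₂).resolve_left hadd
    have hc : C k - C a = A k - A a := by linarith
    rw [hc] at h₀ h₁
    have e₁ : (B k - B a) * ((s - r) * (r + s)) = 0 := by linarith
    have hb := (mul_eq_zero.1 e₁).resolve_right (mul_ne_zero hsub hadd)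
    rw [hb] at h₀
    have e₀ : (A k - A a) * (lam k - lam a) = 0 := by linarith
    have ha := (mul_eq_zero.1 e₀).resolve_right hδ
    exact ⟨by linarith, by linarith, by linarith⟩
  have hC : C a = 0 := by
    have h₁ := h (Pi.single 2 (Pi.single a 1))
    rw [sum_residue_eq hlam a, Finset.sum_eq_zero] at h₁
    · simpa [fderiv_sqNorm_single, basePoint] using h₁
    · intro k _
      obtain ⟨e₁, e₂, e₃⟩ := hdiff k
      simp [e₁, e₂, e₃]
  exact ⟨fun k => (hdiff k).1.trans hA, fun k => (hdiff k).2.1, fun k => (hdiff k).2.2.trans hC⟩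

lemma fderiv_sum_mul_res (lam : Fin N → ℝ) (b : Fin 3) (x : Fin N → ℝ) (p v : Phase N) :
    fderiv ℝ (fun Φ => ∑ k, x k * res lam b k Φ) p v = ∑ k, x k * fderiv ℝ (res lam b k) p v := by
  have hd := fun k => differentiable_res lam b k p
  rw [fderiv_fun_sum fun k _ => (hd k).const_mul _, sum_apply]
  refine Finset.sum_congr rfl fun k _ => ?_
  rw [fderiv_const_mul (hd k)]
  rfl

lemma fderiv_E1 {lam : Fin N → ℝ} (hlam : Function.Injective lam) (m : ℕ) (p v : Phase N) :
    fderiv ℝ (fun Φ => E1 lam Φ m) p v = ∑ k, lam k ^ m * fderiv ℝ (res1 lam k) p v := by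
  rw [show (fun Φ => E1 lam Φ m) = fun Φ => ∑ k, lam k ^ m * res lam 0 k Φ from
    funext fun Φ => E1_eq hlam Φ m]
  exact fderiv_sum_mul_res lam 0 _ p v

lemma fderiv_E2 {lam : Fin N → ℝ} (hlam : Function.Injective lam) (m : ℕ) (p v : Phase N) :
    fderiv ℝ (fun Φ => E2 lam Φ m) p v = ∑ k, lam k ^ (m + 1) * fderiv ℝ (res2 lam k) p v := by
  rw [show (fun Φ => E2 lam Φ m) = fun Φ => ∑ k, lam k ^ (m + 1) * res lam 1 k Φ from
    funext fun Φ => E2_eq hlam Φ m]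
  exact fderiv_sum_mul_res lam 1 _ p v

lemma fderiv_E3 {lam : Fin N → ℝ} (hlam : Function.Injective lam) (m : ℕ) (p v : Phase N) :
    fderiv ℝ (fun Φ => E3 lam Φ m) p v = ∑ k, lam k ^ m * fderiv ℝ (res3 lam k) p v := by
  rw [show (fun Φ => E3 lam Φ m) = fun Φ => ∑ k, lam k ^ m * res lam 2 k Φ from
    funext fun Φ => E3_eq hlam Φ m]
  exact fderiv_sum_mul_res lam 2 _ p v

/-- A polynomial of degree at most `M` with constant term `-b` that vanishes at `M + 1` distinct
points is zero. -/
lemma eq_zero_of_sum_mul_pow_succ_eq {M : ℕ} {x : Fin (M + 1) → ℝ} (hx : Function.Injective x)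
    {β : Fin M → ℝ} {b : ℝ} (h : ∀ k, ∑ m, β m * x k ^ ((m : ℕ) + 1) = b) (m : Fin M) :
    β m = 0 := by
  have h₁ : (Fin.cons (-b) β : Fin (M + 1) → ℝ) = 0 := by
    refine Matrix.eq_zero_of_forall_index_sum_mul_pow_eq_zero hx fun k => ?_
    rw [Fin.sum_univ_succ]
    simp [h k]
  simpa using congrFun h₁ m.succ

/-- A relation between the integrals is one between the residues, with coefficients polynomials
evaluated at λₖ. Those for `E1` and `E3` vanish at all `N` points; the one for `E2` is constant
there but has no constant term. -/
lemma linearIndependent_fderiv_integrals_basePoint {lam : Fin N → ℝ}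
    (hlam : Function.Injective lam) (a : Fin N) {r s : ℝ} (hadd : r + s ≠ 0) (hsub : s - r ≠ 0) :
    LinearIndependent ℝ fun i => fderiv ℝ (integrals lam i) (basePoint a r s) := by
  rw [Fintype.linearIndependent_iff]
  intro c hc
  set p := basePoint a r s
  set A : Fin N → ℝ := fun k => ∑ m : Fin N, c (.inl m) * lam k ^ (m : ℕ)
  set B : Fin N → ℝ := fun k => ∑ m : Fin (N - 1), c (.inr (.inl m)) * lam k ^ ((m : ℕ) + 1)
  set C : Fin N → ℝ := fun k => ∑ m : Fin N, c (.inr (.inr m)) * lam k ^ (m : ℕ)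
  have hrel : ∀ v, ∑ k, (A k * fderiv ℝ (res1 lam k) p v + B k * fderiv ℝ (res2 lam k) p v
      + C k * fderiv ℝ (res3 lam k) p v) = 0 := fun v => by
    have h := congrArg (fun ℓ => ℓ v) hc
    simp only [Fintype.sum_sum_type, add_apply, sum_apply, smul_apply, integrals, fderiv_E1 hlam,
      fderiv_E2 hlam, fderiv_E3 hlam, smul_eq_mul, zero_apply] at h
    rw [← h]
    simp only [A, B, C, Finset.sum_add_distrib, Finset.sum_mul, Finset.mul_sum, mul_assoc]
    rw [add_assoc]
    refine congrArg₂ _ Finset.sum_comm (congrArg₂ _ Finset.sum_comm Finset.sum_comm)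
  obtain ⟨hA, hB, hC⟩ := residue_relation_basePoint hlam a hadd hsub hrel
  have h₁ := Matrix.eq_zero_of_forall_index_sum_mul_pow_eq_zero hlam hA
  have h₃ := Matrix.eq_zero_of_forall_index_sum_mul_pow_eq_zero hlam hC
  have h₂ : ∀ m, c (.inr (.inl m)) = 0 := by
    obtain _ | M := N
    · exact a.elim0
    · exact eq_zero_of_sum_mul_pow_succ_eq hlam hB
  rintro (m | m | m)
  · exact congrFun h₁ m
  · exact h₂ m
  · exact congrFun h₃ m

end Independence

/-! ### Independence on a dense open subset -/

section LinearAlgebra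

variable {V ι : Type*} [NormedAddCommGroup V] [NormedSpace ℝ V] [Fintype ι] [DecidableEq ι]

/-- Finitely many independent functionals map jointly onto the coordinate space, so the standard
basis can be lifted. -/
lemma exists_dual_vectors {ℓ : ι → V →L[ℝ] ℝ} (h : LinearIndependent ℝ ℓ) :
    ∃ v : ι → V, ∀ i j, ℓ i (v j) = if i = j then 1 else 0 := by
  let coe : (V →L[ℝ] ℝ) →ₗ[ℝ] (V → ℝ) :=
    { toFun := fun m => m, map_add' := fun _ _ => rfl, map_smul' := fun _ _ => rfl }
  have hcoe : LinearMap.ker coe = ⊥ := LinearMap.ker_eq_bot.2 DFunLike.coe_injective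
  have h₁ : LinearIndependent ℝ fun i => (ℓ i : V → ℝ) := h.map' coe hcoe
  let L : V →ₗ[ℝ] (ι → ℝ) := LinearMap.pi fun i => (ℓ i : V →ₗ[ℝ] ℝ)
  have h₂ : Submodule.span ℝ (Set.range L) = ⊤ := span_flip_eq_top_iff_linearIndependent.2 h₁
  rw [← LinearMap.coe_range, Submodule.span_eq] at h₂
  choose v hv using fun j => LinearMap.range_eq_top.1 h₂ (Pi.single j 1)
  refine ⟨v, fun i j => ?_⟩
  have := congrFun (hv j) i
  rw [Pi.single_apply] at this
  exact this

lemma linearIndependent_of_det_ne_zero {ℓ : ι → V →L[ℝ] ℝ} {v : ι → V}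
    (h : (Matrix.of fun i j => ℓ i (v j)).det ≠ 0) : LinearIndependent ℝ ℓ := by
  rw [Fintype.linearIndependent_iff]
  intro c hc
  refine congrFun (Matrix.eq_zero_of_vecMul_eq_zero h (funext fun j => ?_))
  have := congrArg (fun m => m (v j)) hc
  simpa [Matrix.vecMul, dotProduct] using this

end LinearAlgebra

section Density

variable {N : ℕ}

open Filter Topology

lemma contDiff_sum_mul_res {n : WithTop ℕ∞} (lam : Fin N → ℝ) (b : Fin 3) (x : Fin N → ℝ) :
    ContDiff ℝ n fun Φ => ∑ k, x k * res lam b k Φ :=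
  ContDiff.sum fun k _ => contDiff_const.mul (contDiff_res lam b k)

lemma contDiff_integrals {n : WithTop ℕ∞} {lam : Fin N → ℝ} (hlam : Function.Injective lam)
    (i : Fin N ⊕ Fin (N - 1) ⊕ Fin N) : ContDiff ℝ n (integrals lam i) := by
  rcases i with m | m | m
  · rw [show integrals lam (.inl m) = fun Φ => ∑ k, lam k ^ (m : ℕ) * res lam 0 k Φ from
      funext fun Φ => E1_eq hlam Φ m]
    exact contDiff_sum_mul_res lam 0 _
  · rw [show integrals lam (.inr (.inl m)) =
      fun Φ => ∑ k, lam k ^ ((m : ℕ) + 1) * res lam 1 k Φ from funext fun Φ => E2_eq hlam Φ m]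
    exact contDiff_sum_mul_res lam 1 _
  · rw [show integrals lam (.inr (.inr m)) = fun Φ => ∑ k, lam k ^ (m : ℕ) * res lam 2 k Φ from
      funext fun Φ => E3_eq hlam Φ m]
    exact contDiff_sum_mul_res lam 2 _

/-- Two orthogonal pairs of vectors with nonzero first members are joined by an analytic path of
orthogonal pairs. -/
lemma exists_orthogonal_path {x y x' y' : Fin N → ℂ} (hx : ∑ k, conj (x k) * x k ≠ 0)
    (hx' : ∑ k, conj (x' k) * x' k ≠ 0) (h : ∑ k, conj (x k) * y k = 0)
    (h' : ∑ k, conj (x' k) * y' k = 0) :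
    ∃ X Y : ℝ → Fin N → ℂ, ContDiff ℝ ω X ∧ ContDiff ℝ ω Y ∧ X 0 = x ∧ Y 0 = y ∧ X 1 = x' ∧
      Y 1 = y' ∧ ∀ t, ∑ k, conj (X t k) * Y t k = 0 := by
  let X : ℝ → Fin N → ℂ := fun t k => (1 - t : ℝ) * x k + (t : ℝ) * x' k
  -- Dividing by the squared norms makes the orthogonalized path below end exactly at `y` and `y'`.
  let Z : ℝ → Fin N → ℂ := fun t k => (1 - t : ℝ) * (y k / ∑ l, conj (x l) * x l) +
    (t : ℝ) * (y' k / ∑ l, conj (x' l) * x' l)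
  -- Gram–Schmidt without division: the path remains analytic and orthogonal even where `X` passes
  -- through zero.
  let Y : ℝ → Fin N → ℂ := fun t k =>
    (∑ l, conj (X t l) * X t l) * Z t k - (∑ l, conj (X t l) * Z t l) * X t k
  have hof : ContDiff ℝ ω fun t : ℝ => (t : ℂ) := Complex.ofRealCLM.contDiff
  have hof' : ContDiff ℝ ω fun t : ℝ => ((1 - t : ℝ) : ℂ) :=
    hof.comp (contDiff_const.sub contDiff_id)
  have hX : ∀ k, ContDiff ℝ ω fun t => X t k := fun k =>
    (hof'.mul contDiff_const).add (hof.mul contDiff_const)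
  have hZ : ∀ k, ContDiff ℝ ω fun t => Z t k := fun k =>
    (hof'.mul contDiff_const).add (hof.mul contDiff_const)
  have hY : ∀ k, ContDiff ℝ ω fun t => Y t k := fun k =>
    ((ContDiff.sum fun l _ => (contDiff_conj.comp (hX l)).mul (hX l)).mul (hZ k)).sub
      ((ContDiff.sum fun l _ => (contDiff_conj.comp (hX l)).mul (hZ l)).mul (hX k))
  have X0 : X 0 = x := funext fun k => by simp [X]
  have X1 : X 1 = x' := funext fun k => by simp [X]
  have Z0 : ∀ k, Z 0 k = y k / ∑ l, conj (x l) * x l := fun k => by simp [Z]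
  have Z1 : ∀ k, Z 1 k = y' k / ∑ l, conj (x' l) * x' l := fun k => by simp [Z]
  refine ⟨X, Y, contDiff_pi.2 hX, contDiff_pi.2 hY, X0, funext fun k => ?_, X1,
    funext fun k => ?_, fun t => ?_⟩
  · simp only [Y, X0, Z0, ← mul_div_assoc, ← Finset.sum_div, h]
    field_simp
    simp
  · simp only [Y, X1, Z1, ← mul_div_assoc, ← Finset.sum_div, h']
    field_simp
    simp
  · have e : ∀ k, conj (X t k) * Y t k = (∑ l, conj (X t l) * X t l) * (conj (X t k) * Z t k) -
        (∑ l, conj (X t l) * Z t l) * (conj (X t k) * X t k) := fun k => by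
      simp only [Y]
      ring
    simp only [e, Finset.sum_sub_distrib, ← Finset.mul_sum]
    ring

lemma exists_path_constraint {p q : Phase N} (hp : p ∈ constraintManifold N)
    (hq : constraint N q = 0) (hq₀ : ∑ k, conj (q 0 k) * q 0 k ≠ 0)
    (hq₁ : ∑ k, conj (q 1 k) * q 1 k ≠ 0) :
    ∃ γ : ℝ → Phase N, ContDiff ℝ ω γ ∧ γ 0 = p ∧ γ 1 = q ∧ ∀ t, constraint N (γ t) = 0 := by
  let Z : ℝ → Fin N → ℂ := fun t => (1 - t) • p 2 + t • q 2
  have hZ : ContDiff ℝ ω Z := by fun_prop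
  have Z0 : Z 0 = p 2 := by simp [Z]
  have Z1 : Z 1 = q 2 := by simp [Z]
  have hpi : ∀ X Y : ℝ → Fin N → ℂ, ContDiff ℝ ω X → ContDiff ℝ ω Y →
      ContDiff ℝ ω fun t => (![X t, Y t, Z t] : Phase N) := fun X Y hX hY => by
    rw [contDiff_pi]
    intro i
    fin_cases i
    · exact hX
    · exact hY
    · exact hZ
  have heq : ∀ r : Phase N, ![r 0, r 1, r 2] = r := fun r => by
    funext i
    fin_cases i <;> rfl
  have hflip : ∀ {r : Phase N}, constraint N r = 0 → ∑ k, conj (r 1 k) * r 0 k = 0 := fun {r} hr => by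
    have := congrArg conj hr
    simpa [constraint, mul_comm] using this
  -- A nonzero gap excludes that Φ₁ and Φ₂ both vanish; the nonvanishing one is taken as first
  -- member of the orthogonal pair. Φ₃ is unconstrained and moves linearly.
  by_cases h₀ : ∑ k, conj (p 0 k) * p 0 k = 0
  · have h₁ : ∑ k, conj (p 1 k) * p 1 k ≠ 0 := fun h₁ => hp.2 (h₀.trans h₁.symm)
    obtain ⟨X, Y, hX, hY, X0, Y0, X1, Y1, hXY⟩ :=
      exists_orthogonal_path h₁ hq₁ (hflip hp.1) (hflip hq)
    refine ⟨_, hpi Y X hY hX, ?_, ?_, fun t => ?_⟩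
    · rw [X0, Y0, Z0, heq]
    · rw [X1, Y1, Z1, heq]
    · have := congrArg conj (hXY t)
      simpa [constraint, mul_comm] using this
  · obtain ⟨X, Y, hX, hY, X0, Y0, X1, Y1, hXY⟩ := exists_orthogonal_path h₀ hq₀ hp.1 hq
    refine ⟨_, hpi X Y hX hY, ?_, ?_, hXY⟩
    · rw [X0, Y0, Z0, heq]
    · rw [X1, Y1, Z1, heq]

/-- The nonvanishing set of an analytic function is dense in the constraint manifold if it contains
a suitable zero of the constraint. -/
lemma constraintManifold_subset_closure {f : Phase N → ℝ} (hf : ContDiff ℝ ω f) {q : Phase N}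
    (hq : constraint N q = 0) (hq₀ : ∑ k, conj (q 0 k) * q 0 k ≠ 0)
    (hq₁ : ∑ k, conj (q 1 k) * q 1 k ≠ 0) (hfq : f q ≠ 0) :
    constraintManifold N ⊆ closure (constraintManifold N ∩ {p | f p ≠ 0}) := by
  intro p hp
  obtain ⟨γ, hγ, h0, h1, hc⟩ := exists_path_constraint hp hq hq₀ hq₁
  have han : AnalyticOnNhd ℝ (f ∘ γ) Set.univ := (hf.comp hγ).analyticOnNhd
  -- If `f ∘ γ` had zeros accumulating at 0, it would vanish identically, contradicting its value at
  -- 1. The gap may vanish along the path, but not near 0.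
  have hne : ∀ᶠ t in 𝓝[≠] (0 : ℝ), f (γ t) ≠ 0 := by
    by_contra hcon
    rw [not_eventually] at hcon
    have := han.eqOn_zero_of_preconnected_of_frequently_eq_zero isPreconnected_univ
      (Set.mem_univ 0) (hcon.mono fun t ht => not_not.1 ht) (Set.mem_univ 1)
    exact hfq (h1 ▸ this)
  have hlim : Tendsto γ (𝓝 0) (𝓝 p) := h0 ▸ hγ.continuous.tendsto 0
  have hgap : ∀ᶠ t in 𝓝[≠] (0 : ℝ), gap (γ t) ≠ 0 :=
    (hlim.mono_left nhdsWithin_le_nhds).eventually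
      (eventually_gap_ne_zero (mem_constraintManifold.1 hp).2)
  refine mem_closure_of_tendsto (b := 𝓝[≠] (0 : ℝ)) (hlim.mono_left nhdsWithin_le_nhds) ?_
  filter_upwards [hne, hgap] with t h₁ h₂
  exact ⟨mem_constraintManifold.2 ⟨hc t, h₂⟩, h₁⟩

lemma sum_basePoint_mul (a : Fin N) (x y : ℂ) :
    ∑ k, conj (if k = a then x else 1) * (if k = a then y else 1) = N + conj x * y - 1 := by
  have : ∀ k, conj (if k = a then x else 1) * (if k = a then y else 1) =
      1 + if k = a then conj x * y - 1 else 0 := fun k => by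
    split_ifs <;> simp
  simp only [this, Finset.sum_add_distrib]
  simp
  ring

/-- If a combination of the differentials vanishes on the tangent space, its Hamiltonian vector is
tangent and orthogonal to all tangent vectors, hence zero. The combination then vanishes on all
vectors. -/
lemma linearIndependent_on_tangent {lam : Fin N → ℝ} (hlam : Function.Injective lam)
    {p : Phase N} (hp : p ∈ constraintManifold N)
    (h : LinearIndependent ℝ fun i => fderiv ℝ (integrals lam i) p) :
    LinearIndependent ℝ fun i =>
      (fderiv ℝ (integrals lam i) p).comp (levelTangent (constraint N) p).subtypeL := by
  rw [Fintype.linearIndependent_iff] at h ⊢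
  intro c hc
  refine h c ?_
  have hX : ∀ w, symp N w (∑ i, c i • ambientField (integrals lam i) p) =
      (∑ i, c i • fderiv ℝ (integrals lam i) p) w := fun w => by
    simp [ambientField_eq_hamVec, symp_hamVec]
  have hmem : ∑ i, c i • ambientField (integrals lam i) p ∈ levelTangent (constraint N) p :=
    Submodule.sum_mem _ fun i _ => Submodule.smul_mem _ _
      ((CommonIntegral.integrals hlam i).ambientField_mem_levelTangent hp)
  have h₀ : ∑ i, c i • ambientField (integrals lam i) p = 0 := by
    refine symp_nondegenerate_on_tangent (mem_constraintManifold.1 hp).2 hmem fun w hw => ?_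
    rw [symp_swap, hX, neg_eq_zero]
    have := congrArg (fun ℓ => ℓ ⟨w, hw⟩) hc
    simpa using this
  ext w
  rw [← hX, h₀]
  simp

lemma exists_dense_independent (hN : 2 ≤ N) {lam : Fin N → ℝ} (hlam : Function.Injective lam) :
    ∃ O : Set (Phase N), IsOpen O ∧
      constraintManifold N ⊆ closure (constraintManifold N ∩ O) ∧
      ∀ p ∈ constraintManifold N ∩ O, LinearIndependent ℝ fun i =>
        (fderiv ℝ (integrals lam i) p).comp (levelTangent (constraint N) p).subtypeL := by
  have hN' : (2 : ℝ) ≤ N := by exact_mod_cast hN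
  let a : Fin N := ⟨0, by omega⟩
  -- The choice `r * s = 1 - N` puts the base point on the zero set of the constraint, and `r + s`
  -- and `s - r` are nonzero for `N ≥ 2`.
  let r : ℝ := 2 * (N - 1)
  let s : ℝ := -1 / 2
  obtain ⟨v, hv⟩ := exists_dual_vectors (linearIndependent_fderiv_integrals_basePoint hlam a
    (r := r) (s := s) (by simp only [r, s]; linarith) (by simp only [r, s]; linarith))
  -- The vectors dual to the differentials at the base point are kept fixed. The determinant is
  -- analytic, equals one at the base point, and forces independence wherever it is nonzero.
  let f : Phase N → ℝ := fun p => (Matrix.of fun i j => fderiv ℝ (integrals lam i) p (v j)).det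
  have hf : ContDiff ℝ ω f := by
    simp only [f, Matrix.det_apply', Matrix.of_apply]
    refine ContDiff.sum fun σ _ => contDiff_const.mul (contDiff_prod fun i _ => ?_)
    exact ((contDiff_integrals (n := ω) hlam _).fderiv_right (by simp)).clm_apply contDiff_const
  refine ⟨{p | f p ≠ 0}, isOpen_ne_fun hf.continuous continuous_const,
    constraintManifold_subset_closure hf (q := basePoint a r s) ?_ ?_ ?_ ?_, fun p hp =>
    linearIndependent_on_tangent hlam hp.1 (linearIndependent_of_det_ne_zero hp.2)⟩
  · have h : constraint N (basePoint a r s) = N + conj (r : ℂ) * s - 1 := sum_basePoint_mul a r s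
    rw [h, Complex.conj_ofReal]
    have : (N : ℝ) + r * s - 1 = 0 := by simp only [r, s]; ring
    exact_mod_cast this
  · have h : ∑ k, conj (basePoint a r s 0 k) * basePoint a r s 0 k = N + conj (r : ℂ) * r - 1 :=
      sum_basePoint_mul a r r
    rw [h, Complex.conj_ofReal]
    have : (N : ℝ) + r * r - 1 ≠ 0 := by nlinarith [mul_self_nonneg r]
    exact_mod_cast this
  · have h : ∑ k, conj (basePoint a r s 1 k) * basePoint a r s 1 k = N + conj (s : ℂ) * s - 1 :=
      sum_basePoint_mul a s s
    rw [h, Complex.conj_ofReal]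
    have : (N : ℝ) + s * s - 1 ≠ 0 := by nlinarith [mul_self_nonneg s]
    exact_mod_cast this
  · have : (Matrix.of fun i j => fderiv ℝ (integrals lam i) (basePoint a r s) (v j)) = 1 := by
      ext i j
      rw [Matrix.of_apply, hv, Matrix.one_apply]
    simp [f, this]

end Density

/-! ### Liouville integrability -/

lemma HasCommonModel.isLiouvilleIntegrable {N : ℕ} (hN : 2 ≤ N) {lam : Fin N → ℝ}
    (hlam : Function.Injective lam) {H : Phase N → ℝ} (h : HasCommonModel lam H)
    (hH : ∀ p, gap p ≠ 0 → ContDiffAt ℝ ∞ H p) :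
    IsLiouvilleIntegrable (symp N) (constraintManifold N) (constraint N) H (integrals lam) where
  smooth_hamiltonian p hp := hH p (mem_constraintManifold.1 hp).2
  smooth_integral i p _ := (contDiff_integrals hlam i).contDiffAt
  half_dim p hp := by
    rw [finrank_levelTangent (mem_constraintManifold.1 hp).2]
    simp only [Fintype.card_sum, Fintype.card_fin]
    omega
  conserved i p hp := h.inducedBracket_integrals hlam i hp
  involution i j p hp :=
    (HasCommonModel.of_commonIntegral (.integrals hlam j)).inducedBracket_integrals hlam i hp
  independent := exists_dense_independent hN hlam
  complete_hamiltonian := h.isCompleteOn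
  complete_integral i := (HasCommonModel.of_commonIntegral (.integrals hlam i)).isCompleteOn

end

theorem theorem5 (N : ℕ) (hN : 2 ≤ N) (lam : Fin N → ℝ) (hlam : Function.Injective lam) :
    IsSymplecticSubmanifold (symp N) (constraintManifold N) (constraint N) (6 * N - 2) ∧
    ∀ H ∈ ({Hx lam, Hy lam, Ht lam} : Set (Phase N → ℝ)),
      (∀ p ∈ constraintManifold N,
        IsHamiltonianVector (symp N) (constraint N) H p (ambientField H p)) ∧
      IsLiouvilleIntegrable (symp N) (constraintManifold N) (constraint N) H
        (integrals lam) := by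
  refine ⟨isSymplecticSubmanifold_constraintManifold hN, fun H hH => ?_⟩
  have h : HasCommonModel lam H ∧ ∀ p, gap p ≠ 0 → ContDiffAt ℝ ∞ H p := by
    rcases hH with rfl | rfl | rfl
    · exact ⟨hasCommonModel_Hx hlam, fun p _ => contDiffAt_Hx hlam p⟩
    · exact ⟨hasCommonModel_Hy hlam, fun p hp => contDiffAt_Hy hlam hp⟩
    · exact ⟨hasCommonModel_Ht hlam, fun p hp => contDiffAt_Ht hlam hp⟩
  exact ⟨fun p hp => isHamiltonianVector_ambientField (h.1.ambientField_mem_levelTangent hp),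
    h.1.isLiouvilleIntegrable hN hlam h.2⟩
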